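/- **Setting.** Let $\mathcal X$ be a finite set and $Q:\mathcal X\times\mathcal X\to[0,\infty)$, with $Q(x,x)=0$, the transition rates of an irreducible continuous time Markov chain that is reversible with respect to its stationary distribution $\pi:\mathcal X\to(0,1]$, i.e. $\sum_x\pi(x)=1$ and $\pi(x)Q(x,y)=\pi(y)Q(y,x)$. Let $\mathcal P(\mathcal X)=\{\rho:\mathcal X\to[0,\infty):\sum_x\pi(x)\rho(x)=1\}$. For $\phi,\psi\in\mathbb R^{\mathcal X}$ and $\Phi,\Psi\in\mathbb R^{\mathcal X\times\mathcal X}$ put $$\langle\phi,\psi\rangle_\pi=\sum_x\phi(x)\psi(x)\pi(x),\qquad \langle\Phi,\Psi\rangle_Q=\tfrac12\sum_{x,y}\Phi(x,y)\Psi(x,y)Q(x,y)\pi(x),$$ $$(\nabla\psi)(x,y)=\psi(x)-\psi(y),\qquad (\operatorname{div}\Psi)(x)=\tfrac12\sum_yQ(x,y)(\Psi(y,x)-\Psi(x,y)).$$ Let $\theta:[0,\infty)^2\to[0,\infty)$ be continuous, concave, 1-homogeneous and symmetric, $C^\infty$ on $(0,\infty)^2$, with $\theta(0,s)=\theta(s,0)=0$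 and $\theta(s,s)=s$ for $s\ge0$, $\theta(s,t)>0$ for $s,t>0$, and $s\mapsto\theta(t,s)$ monotone increasing on $[0,\infty)$ for every $t\ge0$; put $\theta(s,t)=-\infty$ if $\min\{s,t\}<0$. Let $\alpha(s,t,m)=m^2/\theta(s,t)$ if $\theta(s,t)>0$, $\alpha(s,t,m)=0$ if $\theta(s,t)=0$ and $m=0$, and $\alpha(s,t,m)=+\infty$ otherwise. For $r\in\mathbb R^{\mathcal X}$, $p\in\mathbb R^{\mathcal X\times\mathcal X}$ let $a(r,p)=\frac12\sum_{x,y}\alpha(r(x),r(y),p(x,y))\,Q(x,y)\pi(x)$ with $\infty\cdot0=0$. Fix $\rho_A,\rho_B\in\mathcal P(\mathcal X)$, and let $\mathcal M=\mathcal M([0,1],\mathbb R^{\mathcal X}\times\mathbb R^{\mathcal X\times\mathcal X})$ be the space of finite vector-valued Borel measures on $[0,1]$ with its weak* topology (duality with $C([0,1],\mathbb R^{\mathcal X}\times\mathbb R^{\mathcal X\times\mathcal X})$). Functions are identified with measures via their densities with respect to Lebesgue measure. **Continuous energy.** $\mathcal{CE}(\rho_A,\rho_B)$ is the set of pairs $(\rho,m)$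 of measurable functions $\rho:[0,1]\to\mathbb R^{\mathcal X}$, $m:[0,1]\to\mathbb R^{\mathcal X\times\mathcal X}$, with $\rho$ and all $m(\cdot,x,y)$ with $Q(x,y)>0$ integrable, such that for all $\varphi\in C^1([0,1],\mathbb R^{\mathcal X})$ $$\int_0^1\langle\partial_t\varphi(t),\rho(t)\rangle_\pi+\langle\nabla\varphi(t),m(t)\rangle_Q\,dt=\langle\varphi(1),\rho_B\rangle_\pi-\langle\varphi(0),\rho_A\rangle_\pi .$$ For $(\rho,m)\in\mathcal M$ such that all components $\rho(\cdot,x)$, and all components $m(\cdot,x,y)$ with $Q(x,y)>0$, are absolutely continuous with respect to Lebesgue measure, set $$\mathcal E(\rho,m)=\int_0^1a(\rho(t),m(t))\,dt+\mathcal I_{\mathcal{CE}(\rho_A,\rho_B)}(\rho,m)$$ in terms of the densities; set $\mathcal E(\rho,m)=+\infty$ for all other $(\rho,m)\in\mathcal M$. (The components $m(\cdot,x,y)$ with $Q(x,y)=0$ enter neither term and are unrestricted.) Here $\mathcal I_C$ is $0$ on $C$ and $+\infty$ elsewhere. **Discrete energies.** For $h=1/N$, $N\in\mathbb N$, $N\ge1$,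 put $t_i=ih$ and $I_i=[t_i,t_{i+1})$ for $0\le i<N$. $\mathcal{CE}_h(\rho_A,\rho_B)$ is the set of pairs $(\rho_h,m_h)$ of functions on $[0,1]$ with $\rho_h$ continuous with values in $\mathbb R^{\mathcal X}$ and affine on each $I_i$, $m_h$ with values in $\mathbb R^{\mathcal X\times\mathcal X}$ and constant on each $I_i$, $\rho_h(0)=\rho_A$, $\rho_h(1)=\rho_B$, and $$h\sum_{i=0}^{N-1}\Big\langle\tfrac1h\big(\rho_h(t_{i+1})-\rho_h(t_i)\big)+\operatorname{div}m_h(t_i),\varphi_h(t_i)\Big\rangle_\pi=0$$ for all $\varphi_h:[0,1]\to\mathbb R^{\mathcal X}$ that are constant on each $I_i$. For $(\rho,m)\in\mathcal M$ let $(\operatorname{avg}_h\rho)(t_i)=h^{-1}\rho(I_i)$, $(\operatorname{avg}_hm)(t_i)=h^{-1}m(I_i)$ and $$\mathcal E_h(\rho,m)=h\sum_{i=0}^{N-1}a\big((\operatorname{avg}_h\rho)(t_i),(\operatorname{avg}_hm)(t_i)\big)+\mathcal I_{\mathcal{CE}_h(\rho_A,\rho_B)}(\rho,m).$$ **Theorem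 ($\Gamma$-convergence of time discrete energies).** As $h=1/N\to0$, the functionals $\mathcal E_h$ $\Gamma$-converge to $\mathcal E$ with respect to the weak* topology of $\mathcal M$, that is: (i) whenever $(\rho_h,m_h)\to(\rho,m)$ weakly* in $\mathcal M$, then $\mathcal E(\rho,m)\le\liminf_{h\to0}\mathcal E_h(\rho_h,m_h)$; (ii) for every $(\rho,m)\in\mathcal M$ there is a sequence $(\rho_h,m_h)\to(\rho,m)$ weakly* in $\mathcal M$ with $\limsup_{h\to0}\mathcal E_h(\rho_h,m_h)\le\mathcal E(\rho,m)$. -/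

import Mathlib

open MeasureTheory Filter Topology
open scoped unitInterval ENNReal ContDiff

noncomputable section

/-- An irreducible, reversible continuous time Markov chain on a finite set `X`, with transition
rates `Q` and reversible probability distribution `π`. By detailed balance `π` is stationary, and by
irreducibility it is the unique stationary distribution. -/
structure ReversibleChain (X : Type*) [Fintype X] where
  Q : X → X → ℝ
  Q_nonneg : ∀ x y, 0 ≤ Q x y
  Q_diag : ∀ x, Q x x = 0
  irreducible : ∀ x y, Relation.ReflTransGen (fun a b => 0 < Q a b) x y
  π : X → ℝ
  π_pos : ∀ x, 0 < π x
  π_sum : ∑ x, π x = 1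
  detailed_balance : ∀ x y, π x * Q x y = π y * Q y x

/-- Admissible averaging functions `θ : [0,∞)² → [0,∞)`; the values of `θ` outside the closed
quadrant are never used. -/
structure IsAveraging (θ : ℝ → ℝ → ℝ) : Prop where
  nonneg : ∀ s t, 0 ≤ s → 0 ≤ t → 0 ≤ θ s t
  continuousOn : ContinuousOn (fun p : ℝ × ℝ => θ p.1 p.2) (Set.Ici 0 ×ˢ Set.Ici 0)
  concaveOn : ConcaveOn ℝ (Set.Ici 0 ×ˢ Set.Ici 0) (fun p : ℝ × ℝ => θ p.1 p.2)
  homogeneous : ∀ c s t, 0 ≤ c → 0 ≤ s → 0 ≤ t → θ (c * s) (c * t) = c * θ s t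
  symmetric : ∀ s t, 0 ≤ s → 0 ≤ t → θ s t = θ t s
  smoothOn : ContDiffOn ℝ ∞ (fun p : ℝ × ℝ => θ p.1 p.2) (Set.Ioi 0 ×ˢ Set.Ioi 0)
  zero_left : ∀ s, 0 ≤ s → θ 0 s = 0
  zero_right : ∀ s, 0 ≤ s → θ s 0 = 0
  diag : ∀ s, 0 ≤ s → θ s s = s
  pos : ∀ s t, 0 < s → 0 < t → 0 < θ s t
  monotoneOn : ∀ t, 0 ≤ t → MonotoneOn (fun s => θ t s) (Set.Ici 0)

open Classical in
/-- The function `α(s, t, m)`, equal to `m² / θ(s, t)` if `θ(s, t) > 0`, to `0` if `θ(s, t) = 0` and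
`m = 0`, and to `∞` otherwise. Here `θ` is understood to be `-∞` outside the closed quadrant. -/
def alpha (θ : ℝ → ℝ → ℝ) (s t m : ℝ) : ℝ≥0∞ :=
  if (0 ≤ s ∧ 0 ≤ t) ∧ 0 < θ s t then ENNReal.ofReal (m ^ 2 / θ s t)
  else if (0 ≤ s ∧ 0 ≤ t) ∧ θ s t = 0 ∧ m = 0 then 0
  else ⊤

/-- A measure on `[0,1]` with values in `ℝ^X × ℝ^(X × X)`, given by its scalar components. -/
@[ext]
structure PathMeasure (X : Type*) where
  ρ : X → SignedMeasure I
  m : X → X → SignedMeasure I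

namespace PathMeasure

variable {X : Type*} [Fintype X]

/-- The duality pairing of a measure with a continuous function `[0,1] → ℝ^X × ℝ^(X × X)`. -/
def pairing (μ : PathMeasure X) (φ : C(I, (X → ℝ) × (X → X → ℝ))) : ℝ :=
  ∑ x, (∫ᵛ t, (φ t).1 x ∂•(μ.ρ x)) + ∑ x, ∑ y, (∫ᵛ t, (φ t).2 x y ∂•(μ.m x y))

/-- The weak* topology: the coarsest one for which all pairings with continuous functions are
continuous. -/
instance weakStarTopology : TopologicalSpace (PathMeasure X) :=
  TopologicalSpace.induced pairing inferInstance

/-- The measure `μ` is the pair of functions `(r, p)` times the Lebesgue measure. -/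
def HasDensity (μ : PathMeasure X) (r : I → X → ℝ) (p : I → X → X → ℝ) : Prop :=
  (∀ x, Integrable (fun t => r t x) ∧ μ.ρ x = volume.withDensityᵥ (fun t => r t x)) ∧
  ∀ x y, Integrable (fun t => p t x y) ∧ μ.m x y = volume.withDensityᵥ (fun t => p t x y)

end PathMeasure

/-- The grid point `t_i = i / N`. -/
def gridPoint (N i : ℕ) : I := Set.projIcc (0 : ℝ) 1 zero_le_one ((i : ℝ) / N)

/-- The grid cell `[t_i, t_{i+1})`, `0 ≤ i < N`. -/
def cell (N i : ℕ) : Set I := {t | (i : ℝ) / N ≤ (t : ℝ) ∧ (t : ℝ) < ((i : ℝ) + 1) / N}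

/-- Functions on `[0,1]` that are constant on each grid cell. -/
def IsPiecewiseConstant {E : Type*} (N : ℕ) (ψ : I → E) : Prop :=
  ∀ i < N, ∃ c : E, ∀ t ∈ cell N i, ψ t = c

/-- Continuous functions on `[0,1]` that are affine on each grid cell. -/
def IsPiecewiseAffine {X : Type*} (N : ℕ) (ψ : I → X → ℝ) : Prop :=
  Continuous ψ ∧ ∀ i < N, ∃ a b : X → ℝ, ∀ t ∈ cell N i, ∀ x, ψ t x = a x + (t : ℝ) * b x

/-- The average `h⁻¹ ν([t_i, t_{i+1}))` of a measure over a grid cell, where `h = 1 / N`. -/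
def cellAverage (N : ℕ) (ν : SignedMeasure I) (i : ℕ) : ℝ := (N : ℝ) * ν (cell N i)

namespace ReversibleChain

variable {X : Type*} [Fintype X] (K : ReversibleChain X)

/-- Probability densities with respect to `π`. -/
def IsProbDensity (ρ : X → ℝ) : Prop := (∀ x, 0 ≤ ρ x) ∧ ∑ x, K.π x * ρ x = 1

/-- The inner product on `ℝ^X`. -/
def innerV (φ ψ : X → ℝ) : ℝ := ∑ x, φ x * ψ x * K.π x

/-- The inner product on `ℝ^(X × X)`. -/
def innerE (Φ Ψ : X → X → ℝ) : ℝ := (1 / 2) * ∑ x, ∑ y, Φ x y * Ψ x y * K.Q x y * K.π x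

/-- The discrete gradient. -/
def grad (ψ : X → ℝ) : X → X → ℝ := fun x y => ψ x - ψ y

/-- The discrete divergence. -/
def div (Ψ : X → X → ℝ) : X → ℝ := fun x => (1 / 2) * ∑ y, K.Q x y * (Ψ y x - Ψ x y)

/-- Solutions `(ρ, m)` of the continuity equation with boundary values `ρA`, `ρB`. Entries
`m(t, x, y)` with `Q(x, y) = 0` do not contribute to the equation, so no integrability is required
of them. -/
def IsCE (ρA ρB : X → ℝ) (ρ : I → X → ℝ) (m : I → X → X → ℝ) : Prop :=
  Measurable ρ ∧ Measurable m ∧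
  (∀ x, Integrable (fun t => ρ t x)) ∧
  (∀ x y, 0 < K.Q x y → Integrable (fun t => m t x y)) ∧
  ∀ φ : ℝ → X → ℝ, ContDiffOn ℝ 1 φ (Set.Icc 0 1) →
    ∫ t : I, (K.innerV (derivWithin φ (Set.Icc 0 1) (t : ℝ)) (ρ t) +
      K.innerE (grad (φ (t : ℝ))) (m t)) =
    K.innerV (φ 1) ρB - K.innerV (φ 0) ρA

/-- The integrand of the action (with the convention `∞ * 0 = 0`). -/
def actionDensity (θ : ℝ → ℝ → ℝ) (ρ : X → ℝ) (m : X → X → ℝ) : ℝ≥0∞ :=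
  (1 / 2) * ∑ x, ∑ y, alpha θ (ρ x) (ρ y) (m x y) * ENNReal.ofReal (K.Q x y * K.π x)

/-- The action of a time-dependent density and momentum. -/
def action (θ : ℝ → ℝ → ℝ) (ρ : I → X → ℝ) (m : I → X → X → ℝ) : ℝ≥0∞ :=
  ∫⁻ t : I, K.actionDensity θ (ρ t) (m t)

open Classical in
/-- The energy of a time-dependent density and momentum. -/
def pathEnergy (θ : ℝ → ℝ → ℝ) (ρA ρB : X → ℝ) (ρ : I → X → ℝ) (m : I → X → X → ℝ) : ℝ≥0∞ :=
  K.action θ ρ m + (if K.IsCE ρA ρB ρ m then 0 else ⊤)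

open Classical in
/-- The energy on measures: the energy of the densities if all components of `ρ` and all components
`m(x, y)` on the edges `Q(x, y) > 0` are absolutely continuous, and `∞` otherwise. The components of
`m` off the edges enter neither the action nor the continuity equation, hence are not restricted. -/
def energy (θ : ℝ → ℝ → ℝ) (ρA ρB : X → ℝ) (μ : PathMeasure X) : ℝ≥0∞ :=
  if (∀ x, μ.ρ x ≪ᵥ (volume : Measure I).toENNRealVectorMeasure) ∧
      (∀ x y, 0 < K.Q x y → μ.m x y ≪ᵥ (volume : Measure I).toENNRealVectorMeasure) then
    K.pathEnergy θ ρA ρB (fun t x => (μ.ρ x).rnDeriv volume t)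
      (fun t x y => (μ.m x y).rnDeriv volume t)
  else ⊤

/-- Solutions of the time-discrete continuity equation for the step size `h = 1 / N`. -/
def IsDiscreteCE (N : ℕ) (ρA ρB : X → ℝ) (ρ : I → X → ℝ) (m : I → X → X → ℝ) : Prop :=
  IsPiecewiseAffine N ρ ∧ IsPiecewiseConstant N m ∧
  (∀ φ : I → X → ℝ, IsPiecewiseConstant N φ →
    (1 / (N : ℝ)) * ∑ i ∈ Finset.range N,
      K.innerV
        (fun x => (N : ℝ) * (ρ (gridPoint N (i + 1)) x - ρ (gridPoint N i) x) +
          K.div (m (gridPoint N i)) x)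
        (φ (gridPoint N i)) = 0) ∧
  ρ 0 = ρA ∧ ρ 1 = ρB

/-- The time-discrete action for the step size `h = 1 / N`: the action of the cell averages. -/
def discreteAction (N : ℕ) (θ : ℝ → ℝ → ℝ) (μ : PathMeasure X) : ℝ≥0∞ :=
  (N : ℝ≥0∞)⁻¹ * ∑ i ∈ Finset.range N,
    K.actionDensity θ (fun x => cellAverage N (μ.ρ x) i) (fun x y => cellAverage N (μ.m x y) i)

open Classical in
/-- The time-discrete energy for the step size `h = 1 / N` (meaningful for `N ≥ 1`): the discrete
action plus the indicator of the discrete continuity equation. -/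
def discreteEnergy (N : ℕ) (θ : ℝ → ℝ → ℝ) (ρA ρB : X → ℝ) (μ : PathMeasure X) : ℝ≥0∞ :=
  K.discreteAction N θ μ +
    (if ∃ r p, μ.HasDensity r p ∧ K.IsDiscreteCE N ρA ρB r p then 0 else ⊤)

end ReversibleChain

/-- (Sequential) Γ-convergence of a sequence of functionals on a topological space: the liminf
inequality along all convergent sequences, and existence of recovery sequences. -/
def GammaConverges {Y : Type*} [TopologicalSpace Y] (F : ℕ → Y → ℝ≥0∞) (G : Y → ℝ≥0∞) : Prop :=
  (∀ (u : Y) (v : ℕ → Y), Tendsto v atTop (𝓝 u) →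
    G u ≤ liminf (fun n => F n (v n)) atTop) ∧
  (∀ u : Y, ∃ v : ℕ → Y, Tendsto v atTop (𝓝 u) ∧
    limsup (fun n => F n (v n)) atTop ≤ G u)

end

/-! The function α is a supremum of linear functionals: if θ(s,t) ≤ as + bt, completing the square
gives m²/θ ≥ 2cm − c²(as + bt) for every c (`alpha_eq_iSup`). Hence α, and with it the action
density, is convex, lower semicontinuous and 1-homogeneous, which gives Jensen's inequality for
integrals and for weighted sums. Moreover α decreases when the densities increase. By homogeneity
the discrete action is the sum of the action density of the cell masses.

Lower bound. A discrete solution conserves mass, and finite action makes its cell averages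
nonnegative, so these are bounded by ∑ 1/π. Then θ is bounded on them, and the action bounds the
momenta in L² on the edges; the continuity equation turns this into a sup bound on the densities
(`exists_uniform_bounds`). Weak* limits of L²-bounded densities are absolutely continuous. Since ρ_h
is affine where m_h is constant, a discrete solution solves the continuous equation exactly, and
this linear equation passes to the limit. For the action (`action_le_of_tendsto`), the mollified
limit at time s is a limit of Riemann sums ∑ κ(s − t_i) · (mass of cell i); subadditivity and lower
semicontinuity bound its action density, and integrating in s, where κ has mass one, bounds its
action by the discrete one. Removing the mollifier uses Lebesgue differentiation and Fatou.

Recovery sequence. A solution of finite energy has a continuous representative R. The obstacle is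
that the discrete action sees the midpoint of two nodal values of ρ_h, whereas Jensen's inequality
needs the mean of ρ over a cell; if the midpoint is smaller, α may be larger or infinite. The cure
is to mix the path with the constant density 1 with weight c = (k/N)², where c dominates the modulus
of continuity of R: then (1 − c)b + c ≥ (1 − c)(b + c) ≥ (1 − c) · mean, and monotonicity of α
applies (`actionDensity_recovery_mid_le`). To keep the boundary values, k = o(N) cells at either end
move ρA and ρB towards 1, along a momentum whose divergence is ρA − 1 or ρB − 1; it exists by
irreducibility. The path itself is traversed on the remaining M = N − 2k cells, at the price of a
factor N/M → 1. The ramp is quadratic, so that squared increments are controlled by the weight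
itself; each ramp cell has bounded action density and the ramps cost O(k/N) in total
(`recovery_discreteEnergy_le`). -/

noncomputable section

/-! ### Supporting planes of averaging functions. -/

namespace IsAveraging

variable {θ : ℝ → ℝ → ℝ}

/-- A concave averaging function lies below its supporting planes through the origin. -/
theorem exists_supporting_plane (hθ : IsAveraging θ) {r : ℝ} (hr : 0 < r) :
    ∃ a b : ℝ, 0 ≤ a ∧ 0 ≤ b ∧ a * r + b = θ r 1 ∧
      ∀ s t, 0 ≤ s → 0 ≤ t → θ s t ≤ a * s + b * t := by
  have hmono : ∀ t, 0 ≤ t → ∀ s s', 0 ≤ s → s ≤ s' → θ s t ≤ θ s' t := by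
    intro t ht s s' hs hss
    rw [hθ.symmetric s t hs ht, hθ.symmetric s' t (hs.trans hss) ht]
    exact hθ.monotoneOn t ht hs (hs.trans hss) hss
  have hconv : ConvexOn ℝ (Set.Ici (0 : ℝ)) (fun s => -θ s 1) := by
    refine ⟨convex_Ici 0, fun x hx y hy a b ha hb hab => ?_⟩
    have := hθ.concaveOn.2 (x := (x, 1)) (y := (y, 1)) ⟨hx, zero_le_one' ℝ⟩ ⟨hy, zero_le_one' ℝ⟩
      ha hb hab
    simp only [Prod.smul_mk, smul_eq_mul, mul_one, Prod.mk_add_mk, hab] at this ⊢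
    linarith
  have hint : r ∈ interior (Set.Ici (0 : ℝ)) := by simpa using hr
  -- `g` is the right derivative of θ(·,1) at r. Monotonicity makes it nonnegative, and θ(0,1) = 0
  -- makes the intercept of the tangent nonnegative; homogeneity then turns the tangent line into a
  -- plane through the origin.
  set g : ℝ := -derivWithin (fun s => -θ s 1) (Set.Ioi r) r with hg
  have hline : ∀ s, 0 ≤ s → θ s 1 ≤ θ r 1 + g * (s - r) := by
    intro s hs
    rcases lt_trichotomy s r with h | h | h
    · have h1 := hconv.slope_le_leftDeriv_of_mem_interior (Set.mem_Ici.2 hs) hint h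
      have h2 := hconv.leftDeriv_le_rightDeriv_of_mem_interior hint
      have h3 := h1.trans h2
      rw [slope_def_field, div_le_iff₀ (by linarith)] at h3
      rw [hg]; nlinarith
    · simp [h]
    · have h1 := hconv.rightDeriv_le_slope_of_mem_interior hint (Set.mem_Ici.2 hs) h
      rw [slope_def_field, le_div_iff₀ (by linarith)] at h1
      rw [hg]; nlinarith
  have hg0 : 0 ≤ g := by
    have h1 := hline (r + 1) (by linarith)
    have h2 := hmono 1 zero_le_one r (r + 1) hr.le (by linarith)
    linarith
  have hb0 : 0 ≤ θ r 1 - g * r := by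
    have h1 := hline 0 le_rfl
    rw [hθ.zero_left 1 zero_le_one] at h1
    linarith
  refine ⟨g, θ r 1 - g * r, hg0, hb0, by ring, fun s t hs ht => ?_⟩
  rcases ht.eq_or_lt with rfl | ht'
  · rw [hθ.zero_right s hs]; positivity
  · have h1 := hline (s / t) (by positivity)
    have h2 := hθ.homogeneous t (s / t) 1 ht (by positivity) zero_le_one
    rw [mul_div_cancel₀ _ ht'.ne', mul_one] at h2
    rw [h2]
    have h3 := mul_le_mul_of_nonneg_left h1 ht
    have h4 : t * (θ r 1 + g * (s / t - r)) = g * s + (θ r 1 - g * r) * t := by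
      field_simp; ring
    linarith

theorem mono (hθ : IsAveraging θ) {s t s' t' : ℝ} (hs : 0 ≤ s) (ht : 0 ≤ t) (hss : s ≤ s')
    (htt : t ≤ t') : θ s t ≤ θ s' t' := by
  have hs' := hs.trans hss
  have ht' := ht.trans htt
  calc θ s t ≤ θ s t' := hθ.monotoneOn s hs ht ht' htt
    _ = θ t' s := hθ.symmetric s t' hs ht'
    _ ≤ θ t' s' := hθ.monotoneOn t' ht' hs hs' hss
    _ = θ s' t' := hθ.symmetric t' s' ht' hs'

theorem eq_zero_iff (hθ : IsAveraging θ) {s t : ℝ} (hs : 0 ≤ s) (ht : 0 ≤ t) :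
    θ s t = 0 ↔ s = 0 ∨ t = 0 := by
  constructor
  · intro h
    by_contra! hne
    exact (hθ.pos s t (hs.lt_of_ne' hne.1) (ht.lt_of_ne' hne.2)).ne' h
  · rintro (rfl | rfl)
    · exact hθ.zero_left t ht
    · exact hθ.zero_right s hs

/-- The supporting plane at (r,1) has b ≤ θ(r,1), which tends to 0 as r ↓ 0 because θ vanishes on
the axes. The slope `a` may blow up, which is harmless at points with s = 0. -/
theorem exists_plane_snd_le (hθ : IsAveraging θ) {ε : ℝ} (hε : 0 < ε) :
    ∃ a b : ℝ, b ≤ ε ∧ ∀ s t, 0 ≤ s → 0 ≤ t → θ s t ≤ a * s + b * t := by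
  have hcont : ContinuousWithinAt (fun s => θ s 1) (Set.Ioi 0) 0 := by
    have h1 : ContinuousOn (fun s : ℝ => θ s 1) (Set.Ici 0) :=
      hθ.continuousOn.comp (f := fun s : ℝ => (s, (1 : ℝ))) (by fun_prop)
        fun s hs => ⟨hs, zero_le_one' ℝ⟩
    exact (h1 0 Set.self_mem_Ici).mono Set.Ioi_subset_Ici_self
  have hlim : Tendsto (fun s => θ s 1) (𝓝[>] 0) (𝓝 0) := by
    simpa [ContinuousWithinAt, hθ.zero_left 1 zero_le_one] using hcont
  obtain ⟨r, hr, hr0⟩ := ((hlim.eventually_lt_const hε).and self_mem_nhdsWithin).exists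
  have hr0 : 0 < r := hr0
  obtain ⟨a, b, ha, hb, hab, hle⟩ := hθ.exists_supporting_plane hr0
  refine ⟨a, b, ?_, hle⟩
  have : 0 ≤ a * r := by positivity
  linarith

end IsAveraging

/-! ### Duality for α and its consequences. -/

/-- The linear functionals whose positive part lies below `alpha θ`. -/
def alphaMinorants (θ : ℝ → ℝ → ℝ) : Set (ℝ × ℝ × ℝ) :=
  {l | ∀ s t m, ENNReal.ofReal (l.1 * s + l.2.1 * t + l.2.2 * m) ≤ alpha θ s t m}

section

variable {θ : ℝ → ℝ → ℝ}

/-- Expanding (m − cθ)² ≥ 0 gives m²/θ ≥ 2cm − c²θ ≥ 2cm − c²(as + bt). -/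
theorem mem_alphaMinorants_of_majorant {a b : ℝ}
    (hab : ∀ s t, 0 ≤ s → 0 ≤ t → θ s t ≤ a * s + b * t) (c : ℝ) :
    (-(c ^ 2 * a), -(c ^ 2 * b), 2 * c) ∈ alphaMinorants θ := by
  intro s t m
  unfold alpha
  split_ifs with h1 h2
  · apply ENNReal.ofReal_le_ofReal
    have h := hab s t h1.1.1 h1.1.2
    rw [le_div_iff₀ h1.2]
    have h3 : c ^ 2 * θ s t ≤ c ^ 2 * (a * s + b * t) := by gcongr
    nlinarith [sq_nonneg (m - c * θ s t), h1.2]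
  · obtain ⟨⟨hs, ht⟩, h0, rfl⟩ := h2
    have h := hab s t hs ht
    rw [h0] at h
    have h3 : 0 ≤ c ^ 2 * (a * s + b * t) := by positivity
    rw [ENNReal.ofReal_of_nonpos (by nlinarith)]
  · exact le_top

theorem alpha_of_neg {s t m : ℝ} (h : s < 0 ∨ t < 0) : alpha θ s t m = ⊤ := by
  unfold alpha
  rw [if_neg, if_neg] <;> rintro ⟨⟨h1, h2⟩, -⟩ <;> rcases h with h | h <;> linarith

/-- These functionals detect the value ∞ for negative densities: they are nonpositive for s ≥ 0 and
arbitrarily large for s < 0 as c grows. -/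
theorem neg_fst_mem_alphaMinorants {c : ℝ} (hc : 0 ≤ c) : (-c, 0, 0) ∈ alphaMinorants θ := by
  intro s t m
  rcases lt_or_ge s 0 with hs | hs
  · simp [alpha_of_neg (Or.inl hs)]
  · simp [ENNReal.ofReal_of_nonpos, mul_nonneg hc hs]

theorem neg_snd_mem_alphaMinorants {c : ℝ} (hc : 0 ≤ c) : (0, -c, 0) ∈ alphaMinorants θ := by
  intro s t m
  rcases lt_or_ge t 0 with hs | hs
  · simp [alpha_of_neg (Or.inr hs)]
  · simp [ENNReal.ofReal_of_nonpos, mul_nonneg hc hs]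

/-- Duality: `alpha` is the supremum of its linear minorants. -/
theorem alpha_eq_iSup (hθ : IsAveraging θ) (s t m : ℝ) :
    alpha θ s t m =
      ⨆ l ∈ alphaMinorants θ, ENNReal.ofReal (l.1 * s + l.2.1 * t + l.2.2 * m) := by
  refine le_antisymm ?_ (iSup₂_le fun l hl => hl s t m)
  have key : alpha θ s t m = ⊤ → (∀ R : ℝ, 0 ≤ R → ∃ l ∈ alphaMinorants θ,
      R ≤ l.1 * s + l.2.1 * t + l.2.2 * m) → alpha θ s t m ≤
      ⨆ l ∈ alphaMinorants θ, ENNReal.ofReal (l.1 * s + l.2.1 * t + l.2.2 * m) := by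
    intro _ h
    refine le_top.trans (ENNReal.eq_top_of_forall_nnreal_le fun R => ?_).ge
    obtain ⟨l, hl, hR⟩ := h R R.2
    refine le_trans ?_ (le_iSup₂ (f := fun (l : ℝ × ℝ × ℝ) (_ : l ∈ alphaMinorants θ) =>
      ENNReal.ofReal (l.1 * s + l.2.1 * t + l.2.2 * m)) l hl)
    rw [← ENNReal.ofReal_coe_nnreal]
    exact ENNReal.ofReal_le_ofReal hR
  rcases lt_or_ge s 0 with hs | hs
  · refine key (alpha_of_neg (Or.inl hs)) fun R hR =>
      ⟨_, neg_fst_mem_alphaMinorants (c := R / (-s)) (div_nonneg hR (by linarith)), ?_⟩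
    have : -(R / -s) * s + 0 * t + 0 * m = R := by
      rw [div_neg, neg_neg, div_mul_cancel₀ _ hs.ne]; ring
    exact this.ge
  rcases lt_or_ge t 0 with ht | ht
  · refine key (alpha_of_neg (Or.inr ht)) fun R hR =>
      ⟨_, neg_snd_mem_alphaMinorants (c := R / (-t)) (div_nonneg hR (by linarith)), ?_⟩
    have : 0 * s + -(R / -t) * t + 0 * m = R := by
      rw [div_neg, neg_neg, div_mul_cancel₀ _ ht.ne]; ring
    exact this.ge
  by_cases h0 : θ s t = 0
  · by_cases hm : m = 0
    · unfold alpha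
      rw [if_neg (by simp [h0]), if_pos ⟨⟨hs, ht⟩, h0, hm⟩]
      exact zero_le
    · have htop : alpha θ s t m = ⊤ := by
        unfold alpha
        rw [if_neg (by simp [h0]), if_neg (by simp [hm])]
      refine key htop fun R hR => ?_
      -- Chosen so that 2cm = R + 1. One density is zero here, so the only loss is c² times the
      -- small slope times the other density; the bound `hε` on the slope keeps it below 1.
      set c := (R + 1) / (2 * m) with hc
      have hcm : 2 * c * m = R + 1 := by rw [hc]; field_simp
      have hε : 0 < 1 / (c ^ 2 * (s + t) + 1) := by positivity
      have hbound : ∀ b u, 0 ≤ u → u ≤ s + t → b ≤ 1 / (c ^ 2 * (s + t) + 1) →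
          c ^ 2 * b * u ≤ 1 := by
        intro b u hu hus hb
        calc c ^ 2 * b * u ≤ c ^ 2 * (1 / (c ^ 2 * (s + t) + 1)) * u := by gcongr
          _ ≤ c ^ 2 * (1 / (c ^ 2 * (s + t) + 1)) * (s + t) := by gcongr
          _ = (c ^ 2 * (s + t)) / (c ^ 2 * (s + t) + 1) := by ring
          _ ≤ 1 := by
            rw [div_le_one (by positivity)]
            linarith
      obtain ⟨a, b, hb, hab⟩ := hθ.exists_plane_snd_le hε
      rcases (hθ.eq_zero_iff hs ht).1 h0 with rfl | rfl
      · refine ⟨_, mem_alphaMinorants_of_majorant hab c, ?_⟩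
        have := hbound b t ht (by linarith) hb
        simp only
        linarith
      · refine ⟨_, mem_alphaMinorants_of_majorant (a := b) (b := a) (fun s t hs ht => ?_) c, ?_⟩
        · rw [hθ.symmetric s t hs ht]
          linarith [hab t s ht hs]
        have := hbound b s hs (by linarith) hb
        simp only
        linarith
  · have hpos : 0 < θ s t := (hθ.nonneg s t hs ht).lt_of_ne' h0
    have ht' : 0 < t := ht.lt_of_ne' fun h => h0 (by rw [h, hθ.zero_right s hs])
    have hs' : 0 < s := hs.lt_of_ne' fun h => h0 (by rw [h, hθ.zero_left t ht])
    obtain ⟨a, b, ha, hb, heq, hab⟩ := hθ.exists_supporting_plane (div_pos hs' ht')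
    have h2 := hθ.homogeneous t (s / t) 1 ht (by positivity) zero_le_one
    rw [mul_div_cancel₀ _ ht'.ne', mul_one, ← heq] at h2
    have h3 : θ s t = a * s + b * t := by rw [h2]; field_simp
    -- In the interior the supremum is attained: the plane touches θ at (s,t), and c = m/θ(s,t)
    -- gives equality in the completed square.
    refine le_trans ?_ (le_iSup₂ (f := fun (l : ℝ × ℝ × ℝ) (_ : l ∈ alphaMinorants θ) =>
      ENNReal.ofReal (l.1 * s + l.2.1 * t + l.2.2 * m)) _
      (mem_alphaMinorants_of_majorant hab (m / θ s t)))
    unfold alpha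
    rw [if_pos ⟨⟨hs, ht⟩, hpos⟩]
    apply ENNReal.ofReal_le_ofReal
    have : -((m / θ s t) ^ 2 * a) * s + -((m / θ s t) ^ 2 * b) * t + 2 * (m / θ s t) * m
        = 2 * (m / θ s t) * m - (m / θ s t) ^ 2 * θ s t := by rw [h3]; ring
    simp only
    rw [this]
    apply le_of_eq
    field_simp
    ring

theorem lowerSemicontinuous_alpha (hθ : IsAveraging θ) :
    LowerSemicontinuous fun q : ℝ × ℝ × ℝ => alpha θ q.1 q.2.1 q.2.2 := by
  simp_rw [alpha_eq_iSup hθ]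
  refine lowerSemicontinuous_biSup fun l _ => ?_
  exact (ENNReal.continuous_ofReal.comp (by fun_prop)).lowerSemicontinuous

theorem measurable_alpha (hθ : IsAveraging θ) :
    Measurable fun q : ℝ × ℝ × ℝ => alpha θ q.1 q.2.1 q.2.2 :=
  (lowerSemicontinuous_alpha hθ).measurable

theorem alpha_smul (hθ : IsAveraging θ) {c : ℝ} (hc : 0 < c) (s t m : ℝ) :
    alpha θ (c * s) (c * t) (c * m) = ENNReal.ofReal c * alpha θ s t m := by
  simp_rw [alpha_eq_iSup hθ, ENNReal.mul_iSup, ← ENNReal.ofReal_mul hc.le]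
  refine iSup_congr fun l => iSup_congr fun _ => ?_
  congr 1; ring

/-- Jensen's inequality for the sublinear function `alpha`. -/
theorem alpha_integral_le (hθ : IsAveraging θ) {Ω : Type*} [MeasurableSpace Ω] {ν : Measure Ω}
    {s t m : Ω → ℝ} (hs : Integrable s ν) (ht : Integrable t ν) (hm : Integrable m ν) :
    alpha θ (∫ x, s x ∂ν) (∫ x, t x ∂ν) (∫ x, m x ∂ν) ≤ ∫⁻ x, alpha θ (s x) (t x) (m x) ∂ν := by
  rw [alpha_eq_iSup hθ]
  refine iSup₂_le fun l hl => ?_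
  have : l.1 * (∫ x, s x ∂ν) + l.2.1 * (∫ x, t x ∂ν) + l.2.2 * (∫ x, m x ∂ν) =
      ∫ x, (l.1 * s x + l.2.1 * t x + l.2.2 * m x) ∂ν := by
    rw [integral_add (f := fun x => l.1 * s x + l.2.1 * t x)
      ((hs.const_mul _).add (ht.const_mul _)) (hm.const_mul _),
      integral_add (hs.const_mul _) (ht.const_mul _)]
    simp only [integral_const_mul]
  rw [this]
  have hint : Integrable (fun x => l.1 * s x + l.2.1 * t x + l.2.2 * m x) ν :=
    ((hs.const_mul _).add (ht.const_mul _)).add (hm.const_mul _)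
  calc ENNReal.ofReal (∫ x, (l.1 * s x + l.2.1 * t x + l.2.2 * m x) ∂ν)
      ≤ ENNReal.ofReal (∫ x, max (l.1 * s x + l.2.1 * t x + l.2.2 * m x) 0 ∂ν) :=
        ENNReal.ofReal_le_ofReal (integral_mono hint hint.pos_part fun x => le_max_left _ _)
    _ = ∫⁻ x, ENNReal.ofReal (max (l.1 * s x + l.2.1 * t x + l.2.2 * m x) 0) ∂ν :=
        ofReal_integral_eq_lintegral_ofReal hint.pos_part
          (Eventually.of_forall fun x => le_max_right _ _)
    _ ≤ ∫⁻ x, alpha θ (s x) (t x) (m x) ∂ν := by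
        refine lintegral_mono fun x => ?_
        simpa [ENNReal.ofReal_max] using hl (s x) (t x) (m x)

theorem alpha_sum_le (hθ : IsAveraging θ) {ι : Type*} (S : Finset ι) {w : ι → ℝ}
    (hw : ∀ i ∈ S, 0 ≤ w i) (s t m : ι → ℝ) :
    alpha θ (∑ i ∈ S, w i * s i) (∑ i ∈ S, w i * t i) (∑ i ∈ S, w i * m i) ≤
      ∑ i ∈ S, ENNReal.ofReal (w i) * alpha θ (s i) (t i) (m i) := by
  rw [alpha_eq_iSup hθ]
  refine iSup₂_le fun l hl => ?_
  have : l.1 * (∑ i ∈ S, w i * s i) + l.2.1 * (∑ i ∈ S, w i * t i) +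
      l.2.2 * (∑ i ∈ S, w i * m i) =
      ∑ i ∈ S, w i * (l.1 * s i + l.2.1 * t i + l.2.2 * m i) := by
    simp only [Finset.mul_sum, ← Finset.sum_add_distrib]
    exact Finset.sum_congr rfl fun i _ => by ring
  rw [this]
  refine (Finset.le_sum_of_subadditive _ ENNReal.ofReal_zero.le (fun _ _ => ENNReal.ofReal_add_le) _ _).trans (Finset.sum_le_sum fun i hi => ?_)
  rw [ENNReal.ofReal_mul (hw i hi)]
  exact mul_le_mul_right (hl _ _ _) _

/-- θ is monotone in both arguments. If θ(s,t) = 0, the right-hand side is infinite unless m = 0,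
and then the left-hand side vanishes. -/
theorem alpha_antitone (hθ : IsAveraging θ) {s t s' t' : ℝ} (hss : s ≤ s') (htt : t ≤ t') (m : ℝ) :
    alpha θ s' t' m ≤ alpha θ s t m := by
  rcases lt_or_ge s 0 with hs | hs
  · simp [alpha_of_neg (Or.inl hs)]
  rcases lt_or_ge t 0 with ht | ht
  · simp [alpha_of_neg (Or.inr ht)]
  have hle := hθ.mono hs ht hss htt
  have hs' := hs.trans hss
  have ht' := ht.trans htt
  unfold alpha
  by_cases h : 0 < θ s t
  · rw [if_pos ⟨⟨hs', ht'⟩, h.trans_le hle⟩, if_pos ⟨⟨hs, ht⟩, h⟩]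
    exact ENNReal.ofReal_le_ofReal (by gcongr)
  · rw [if_neg (c := (0 ≤ s ∧ 0 ≤ t) ∧ 0 < θ s t) fun h' => h h'.2]
    by_cases h2 : (0 ≤ s ∧ 0 ≤ t) ∧ θ s t = 0 ∧ m = 0
    · rw [if_pos h2]
      obtain ⟨-, -, rfl⟩ := h2
      split_ifs with h3 h4
      · simp
      · exact le_rfl
      · exfalso
        rcases (hθ.nonneg s' t' hs' ht').eq_or_lt with h5 | h5
        · exact h4 ⟨⟨hs', ht'⟩, h5.symm, rfl⟩
        · exact h3 ⟨⟨hs', ht'⟩, h5⟩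
    · rw [if_neg h2]
      exact le_top

/-- θ(C,C) = C, so comparison with the diagonal makes α quadratic in the momentum. This is the
source of the L² bounds. -/
theorem ofReal_sq_div_le_alpha (hθ : IsAveraging θ) {s t C : ℝ} (hC : 0 < C) (hsC : s ≤ C)
    (htC : t ≤ C) (m : ℝ) : ENNReal.ofReal (m ^ 2 / C) ≤ alpha θ s t m := by
  refine le_trans (le_of_eq ?_) (alpha_antitone hθ hsC htC m)
  unfold alpha
  rw [hθ.diag C hC.le, if_pos ⟨⟨hC.le, hC.le⟩, hC⟩]

theorem alpha_le_of_le (hθ : IsAveraging θ) {s t c : ℝ} (hc : 0 < c) (hs : c ≤ s) (ht : c ≤ t)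
    (m : ℝ) : alpha θ s t m ≤ ENNReal.ofReal (m ^ 2 / c) := by
  refine (alpha_antitone hθ hs ht m).trans (le_of_eq ?_)
  unfold alpha
  rw [hθ.diag c hc.le, if_pos ⟨⟨hc.le, hc.le⟩, hc⟩]

end


/-! ### The action density: convexity, homogeneity, lower semicontinuity. -/

namespace ReversibleChain

variable {X : Type*} [Fintype X] (K : ReversibleChain X) {θ : ℝ → ℝ → ℝ}

theorem Q_mul_π_pos {x y : X} (h : 0 < K.Q x y) : 0 < K.Q x y * K.π x := mul_pos h (K.π_pos x)

theorem Q_pos_comm {x y : X} : 0 < K.Q x y ↔ 0 < K.Q y x := by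
  have h := K.detailed_balance x y
  constructor <;> intro hQ
  · have := mul_pos (K.π_pos x) hQ
    rw [h] at this
    exact (mul_pos_iff_of_pos_left (K.π_pos y)).1 this
  · have := mul_pos (K.π_pos y) hQ
    rw [← h] at this
    exact (mul_pos_iff_of_pos_left (K.π_pos x)).1 this

theorem Q_eq_zero_of_not_pos {x y : X} (h : ¬ 0 < K.Q x y) : K.Q x y = 0 :=
  le_antisymm (not_lt.1 h) (K.Q_nonneg x y)

/-- Pairs with Q(x,y) = 0 contribute nothing, even where α is infinite, so a comparison on the edges
suffices. -/
theorem actionDensity_le_mul (c : ℝ≥0∞) {ρ ρ' : X → ℝ} {m m' : X → X → ℝ}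
    (h : ∀ x y, 0 < K.Q x y → alpha θ (ρ x) (ρ y) (m x y) ≤ c * alpha θ (ρ' x) (ρ' y) (m' x y)) :
    K.actionDensity θ ρ m ≤ c * K.actionDensity θ ρ' m' := by
  unfold actionDensity
  rw [mul_left_comm, Finset.mul_sum (a := c)]
  simp_rw [Finset.mul_sum (a := c)]
  refine mul_le_mul_right (Finset.sum_le_sum fun x _ => Finset.sum_le_sum fun y _ => ?_) _
  by_cases hQ : 0 < K.Q x y
  · rw [← mul_assoc]
    exact mul_le_mul_left (h x y hQ) _
  · simp [K.Q_eq_zero_of_not_pos hQ]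

theorem actionDensity_mono {ρ ρ' : X → ℝ} {m m' : X → X → ℝ}
    (h : ∀ x y, 0 < K.Q x y → alpha θ (ρ x) (ρ y) (m x y) ≤ alpha θ (ρ' x) (ρ' y) (m' x y)) :
    K.actionDensity θ ρ m ≤ K.actionDensity θ ρ' m' := by
  simpa using K.actionDensity_le_mul 1 (by simpa using h)

theorem actionDensity_congr {ρ : X → ℝ} {m m' : X → X → ℝ}
    (h : ∀ x y, 0 < K.Q x y → m x y = m' x y) :
    K.actionDensity θ ρ m = K.actionDensity θ ρ m' :=
  le_antisymm (K.actionDensity_mono fun x y hQ => by rw [h x y hQ])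
    (K.actionDensity_mono fun x y hQ => by rw [h x y hQ])

theorem alpha_mul_le_actionDensity (ρ : X → ℝ) (m : X → X → ℝ) (x y : X) :
    alpha θ (ρ x) (ρ y) (m x y) * ENNReal.ofReal (K.Q x y * K.π x) ≤
      2 * K.actionDensity θ ρ m := by
  unfold actionDensity
  rw [← mul_assoc, one_div, ENNReal.mul_inv_cancel two_ne_zero ENNReal.ofNat_ne_top, one_mul]
  exact (Finset.single_le_sum (f := fun y =>
      alpha θ (ρ x) (ρ y) (m x y) * ENNReal.ofReal (K.Q x y * K.π x))
    (fun _ _ => zero_le) (Finset.mem_univ y)).trans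
    (Finset.single_le_sum (f := fun x => ∑ y, alpha θ (ρ x) (ρ y) (m x y) *
      ENNReal.ofReal (K.Q x y * K.π x)) (fun _ _ => zero_le) (Finset.mem_univ x))

theorem lowerSemicontinuous_actionDensity (hθ : IsAveraging θ) :
    LowerSemicontinuous fun q : (X → ℝ) × (X → X → ℝ) => K.actionDensity θ q.1 q.2 := by
  unfold actionDensity
  refine (ENNReal.continuous_const_mul (by simp)).comp_lowerSemicontinuous
    (lowerSemicontinuous_sum fun x _ => lowerSemicontinuous_sum fun y _ => ?_)
    fun a b h => mul_le_mul_right h _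
  have h : LowerSemicontinuous fun q : (X → ℝ) × (X → X → ℝ) =>
      alpha θ (q.1 x) (q.1 y) (q.2 x y) :=
    (lowerSemicontinuous_alpha hθ).comp
      (g := fun q : (X → ℝ) × (X → X → ℝ) => (q.1 x, q.1 y, q.2 x y)) (by fun_prop)
  exact (ENNReal.continuous_mul_const ENNReal.ofReal_ne_top).comp_lowerSemicontinuous h
    fun a b h => mul_le_mul_left h _

theorem actionDensity_le_liminf (hθ : IsAveraging θ) {ι : Type*} {l : Filter ι}
    {ρ : X → ℝ} {m : X → X → ℝ} {ρ' : ι → X → ℝ} {m' : ι → X → X → ℝ}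
    (hρ : ∀ x, Tendsto (fun i => ρ' i x) l (𝓝 (ρ x)))
    (hm : ∀ x y, 0 < K.Q x y → Tendsto (fun i => m' i x y) l (𝓝 (m x y))) :
    K.actionDensity θ ρ m ≤ liminf (fun i => K.actionDensity θ (ρ' i) (m' i)) l := by
  classical
  -- Momenta need not converge off the edges. `T` sets those entries to zero, which leaves the
  -- action density unchanged.
  set T : (X → X → ℝ) → X → X → ℝ := fun p x y => if 0 < K.Q x y then p x y else 0 with hT
  have hT' : ∀ ρ p, K.actionDensity θ ρ p = K.actionDensity θ ρ (T p) := fun ρ p =>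
    K.actionDensity_congr fun x y h => by simp [hT, h]
  rw [hT', funext fun i => hT' (ρ' i) (m' i)]
  have hlim : Tendsto (fun i => (ρ' i, T (m' i))) l (𝓝 (ρ, T m)) := by
    refine Tendsto.prodMk_nhds (tendsto_pi_nhds.2 hρ)
      (tendsto_pi_nhds.2 fun x => tendsto_pi_nhds.2 fun y => ?_)
    by_cases h : 0 < K.Q x y
    · simpa [hT, h] using hm x y h
    · simpa [hT, h] using tendsto_const_nhds
  refine le_of_forall_lt fun c hc => ?_
  obtain ⟨d, hcd, hd⟩ := exists_between hc
  refine hcd.trans_le (le_liminf_of_le (by isBoundedDefault) ?_)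
  filter_upwards [hlim.eventually
    (K.lowerSemicontinuous_actionDensity hθ (ρ, T m) d hd)] with i hi using hi.le

theorem actionDensity_smul (hθ : IsAveraging θ) {c : ℝ} (hc : 0 < c) (ρ : X → ℝ)
    (m : X → X → ℝ) :
    K.actionDensity θ (fun x => c * ρ x) (fun x y => c * m x y) =
      ENNReal.ofReal c * K.actionDensity θ ρ m := by
  unfold actionDensity
  simp_rw [alpha_smul hθ hc, Finset.mul_sum]
  refine Finset.sum_congr rfl fun x _ => Finset.sum_congr rfl fun y _ => ?_
  ring

theorem actionDensity_sum_le (hθ : IsAveraging θ) {ι : Type*} (S : Finset ι) {w : ι → ℝ}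
    (hw : ∀ i ∈ S, 0 ≤ w i) (ρ : ι → X → ℝ) (m : ι → X → X → ℝ) :
    K.actionDensity θ (fun x => ∑ i ∈ S, w i * ρ i x) (fun x y => ∑ i ∈ S, w i * m i x y) ≤
      ∑ i ∈ S, ENNReal.ofReal (w i) * K.actionDensity θ (ρ i) (m i) := by
  have h : ∑ i ∈ S, ENNReal.ofReal (w i) * K.actionDensity θ (ρ i) (m i) =
      (1 / 2) * ∑ x, ∑ y, (∑ i ∈ S, ENNReal.ofReal (w i) * alpha θ (ρ i x) (ρ i y) (m i x y)) *
        ENNReal.ofReal (K.Q x y * K.π x) := by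
    unfold actionDensity
    simp_rw [Finset.sum_mul, Finset.mul_sum]
    rw [Finset.sum_comm]
    refine Finset.sum_congr rfl fun x _ => ?_
    rw [Finset.sum_comm]
    refine Finset.sum_congr rfl fun y _ => Finset.sum_congr rfl fun i _ => ?_
    ring
  rw [h]
  unfold actionDensity
  gcongr with x _ y _
  exact alpha_sum_le hθ S hw _ _ _

/-- Jensen's inequality for the action density. -/
theorem actionDensity_integral_le (hθ : IsAveraging θ) {Ω : Type*} [MeasurableSpace Ω]
    {ν : Measure Ω} {r : Ω → X → ℝ} {p : Ω → X → X → ℝ} (hr : ∀ x, Integrable (fun t => r t x) ν)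
    (hp : ∀ x y, 0 < K.Q x y → Integrable (fun t => p t x y) ν) :
    K.actionDensity θ (fun x => ∫ t, r t x ∂ν) (fun x y => ∫ t, p t x y ∂ν) ≤
      ∫⁻ t, K.actionDensity θ (r t) (p t) ∂ν := by
  have hmeas : ∀ x y, 0 < K.Q x y →
      AEMeasurable (fun t => alpha θ (r t x) (r t y) (p t x y)) ν := fun x y h =>
    (measurable_alpha hθ).comp_aemeasurable
      (f := fun t => (r t x, r t y, p t x y))
      ((hr x).aemeasurable.prodMk ((hr y).aemeasurable.prodMk (hp x y h).aemeasurable))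
  have hmeas' : ∀ x y, AEMeasurable (fun t => alpha θ (r t x) (r t y) (p t x y) *
      ENNReal.ofReal (K.Q x y * K.π x)) ν := fun x y => by
    by_cases h : 0 < K.Q x y
    · exact (hmeas x y h).mul_const _
    · simp [K.Q_eq_zero_of_not_pos h]
  have h : ∫⁻ t, K.actionDensity θ (r t) (p t) ∂ν = (1 / 2) * ∑ x, ∑ y,
      ∫⁻ t, alpha θ (r t x) (r t y) (p t x y) * ENNReal.ofReal (K.Q x y * K.π x) ∂ν := by
    unfold actionDensity
    rw [lintegral_const_mul' _ _ (by simp),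
      lintegral_finsetSum' _ fun x _ => Finset.aemeasurable_fun_sum _ fun y _ => hmeas' x y]
    simp_rw [lintegral_finsetSum' _ fun y _ => hmeas' _ y]
  rw [h]
  unfold actionDensity
  gcongr with x _ y _
  rw [lintegral_mul_const' _ _ ENNReal.ofReal_ne_top]
  by_cases hQ : 0 < K.Q x y
  · gcongr
    exact alpha_integral_le hθ (hr x) (hr y) (hp x y hQ)
  · simp [K.Q_eq_zero_of_not_pos hQ]

/-- Homogeneity pulls the factor N out of the cell averages, and it cancels the step size. -/
theorem discreteAction_eq_sum (hθ : IsAveraging θ) {N : ℕ} (hN : 0 < N) (μ : PathMeasure X) :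
    K.discreteAction N θ μ = ∑ i ∈ Finset.range N,
      K.actionDensity θ (fun x => μ.ρ x (cell N i)) (fun x y => μ.m x y (cell N i)) := by
  unfold discreteAction cellAverage
  have hN' : (0 : ℝ) < N := by exact_mod_cast hN
  simp_rw [K.actionDensity_smul hθ hN', ← Finset.mul_sum, ENNReal.ofReal_natCast]
  rw [← mul_assoc, ENNReal.inv_mul_cancel (by simpa using hN.ne') (by simp), one_mul]

end ReversibleChain


/-! ### Integration against signed measures. -/

namespace MeasureTheory.SignedMeasure

instance isFiniteMeasure_variation {Ω : Type*} [MeasurableSpace Ω] (ν : SignedMeasure Ω) :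
    IsFiniteMeasure ν.variation := by
  rw [← totalVariation_eq_variation]
  infer_instance

variable {Ω : Type*} [MeasurableSpace Ω]

theorem integrable_of_bound (ν : SignedMeasure Ω) {f : Ω → ℝ} (hf : Measurable f) {C : ℝ}
    (hC : ∀ x, |f x| ≤ C) : ν.Integrable f :=
  Integrable.of_bound hf.aestronglyMeasurable C (Eventually.of_forall hC)

theorem abs_integral_le (ν : SignedMeasure Ω) {f : Ω → ℝ} {C : ℝ} (hC : ∀ x, |f x| ≤ C) :
    |∫ᵛ x, f x ∂•ν| ≤ C * ν.variation.real Set.univ := by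
  have h := VectorMeasure.norm_integral_le_of_norm_le_const (μ := ν) (f := f)
    (B := ContinuousLinearMap.lsmul ℝ ℝ) (Eventually.of_forall hC)
  simpa [ContinuousLinearMap.opNorm_lsmul] using h

theorem integral_withDensityᵥ {μ : Measure Ω} {f g : Ω → ℝ} (hf : Integrable f μ)
    (hg : Measurable g) {C : ℝ} (hC : ∀ x, |g x| ≤ C) :
    ∫ᵛ x, g x ∂•(μ.withDensityᵥ f) = ∫ x, g x * f x ∂μ := by
  have := isFiniteMeasure_withDensity_ofReal hf.2
  have := isFiniteMeasure_withDensity_ofReal hf.neg.2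
  have hflip : (ContinuousLinearMap.lsmul ℝ ℝ : ℝ →L[ℝ] ℝ →L[ℝ] ℝ) =
      (ContinuousLinearMap.lsmul ℝ ℝ : ℝ →L[ℝ] ℝ →L[ℝ] ℝ).flip := by
    ext; simp
  have key : ∀ {u : Ω → ℝ}, Integrable u μ → ∫ x, g x ∂μ.withDensity (fun x => ENNReal.ofReal (u x))
      = ∫ x, g x * max (u x) 0 ∂μ := by
    intro u hu
    rw [integral_withDensity_eq_integral_toReal_smul₀ hu.aemeasurable.ennreal_ofReal
      (by simp)]
    refine integral_congr_ae (Eventually.of_forall fun x => ?_)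
    simp [ENNReal.toReal_ofReal', mul_comm]
  rw [withDensityᵥ_eq_withDensity_pos_part_sub_withDensity_neg_part hf,
    VectorMeasure.integral_sub_vectorMeasure (integrable_of_bound _ hg hC)
      (integrable_of_bound _ hg hC), hflip, VectorMeasure.integral_toSignedMeasure,
    VectorMeasure.integral_toSignedMeasure, key hf, key (u := fun x => -f x) hf.neg, ← integral_sub]
  · refine integral_congr_ae (Eventually.of_forall fun x => ?_)
    rcases le_total (f x) 0 with h | h
    · simp [h]
    · simp [h]
  · exact hf.pos_part.bdd_mul hg.aestronglyMeasurable (Eventually.of_forall hC)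
  · exact hf.neg.pos_part.bdd_mul hg.aestronglyMeasurable (Eventually.of_forall hC)

/-- A function that factors through a finite set is integrated by summing over the fibres. -/
theorem integral_comp_fin_range (ν : SignedMeasure Ω) {N : ℕ} {idx : Ω → ℕ} (hidx : Measurable idx)
    (hlt : ∀ x, idx x < N) (g : ℕ → ℝ) :
    ∫ᵛ x, g (idx x) ∂•ν = ∑ j ∈ Finset.range N, g j * ν (idx ⁻¹' {j}) := by
  have h1 : (fun x => g (idx x)) =
      fun x => ∑ j ∈ Finset.range N, (idx ⁻¹' {j}).indicator (fun _ => g j) x := by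
    ext x
    rw [Finset.sum_eq_single (idx x)]
    · simp
    · intro j _ hj
      simp [hj.symm]
    · intro h
      exact absurd (Finset.mem_range.2 (hlt x)) h
  have hm : ∀ j, MeasurableSet (idx ⁻¹' {j}) := fun j => hidx (measurableSet_singleton j)
  rw [h1, VectorMeasure.integral_finsetSum]
  · refine Finset.sum_congr rfl fun j _ => ?_
    rw [VectorMeasure.integral_indicator_const _ (hm j)]
    simp
  · intro j _
    refine integrable_of_bound ν (measurable_const.indicator (hm j)) (C := |g j|) fun x => ?_
    by_cases hx : x ∈ idx ⁻¹' {j} <;> simp [hx]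

end MeasureTheory.SignedMeasure

theorem ContinuousMap.exists_abs_le {Y : Type*} [TopologicalSpace Y] [CompactSpace Y]
    (φ : C(Y, ℝ)) :
    ∃ C, 0 ≤ C ∧ ∀ t, |φ t| ≤ C :=
  ⟨‖φ‖, norm_nonneg _, fun t => φ.norm_coe_le_norm t⟩

/-! ### Absolute continuity from an L² bound on the pairing. -/

namespace MeasureTheory.SignedMeasure

/-- If the integrals of continuous functions against `ν` are controlled by their `L²` norms, compact
Lebesgue null sets are `ν`-null. -/
theorem apply_eq_zero_of_isCompact {ν : SignedMeasure I} {C : ℝ}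
    (h : ∀ φ : C(I, ℝ), (∫ᵛ t, φ t ∂•ν) ^ 2 ≤ C * ∫ t, φ t ^ 2) {A : Set I} (hA : IsCompact A)
    (hA0 : volume A = 0) : ν A = 0 := by
  have hδ : ∀ n : ℕ, (0 : ℝ) < 1 / ((n : ℝ) + 1) := fun n => by positivity
  -- Continuous functions decreasing to the indicator of the closed set A. Bounded convergence
  -- identifies the limit as ν(A) on the left of the estimate and as a multiple of the Lebesgue
  -- measure of A on the right.
  let φ : ℕ → C(I, ℝ) := fun n =>
    ⟨fun t => (thickenedIndicator (hδ n) A t : ℝ), by fun_prop⟩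
  have hlim : ∀ t, Tendsto (fun n => φ n t) atTop (𝓝 (A.indicator (fun _ => (1 : ℝ)) t)) := by
    intro t
    have h1 := thickenedIndicator_tendsto_indicator_closure hδ
      tendsto_one_div_add_atTop_nhds_zero_nat A
    rw [tendsto_pi_nhds] at h1
    have h2 := (NNReal.continuous_coe.tendsto _).comp (h1 t)
    rw [hA.isClosed.closure_eq] at h2
    refine h2.congr' (Eventually.of_forall fun n => rfl) |>.trans_eq ?_
    by_cases ht : t ∈ A <;> simp [ht]
  have hle : ∀ n t, |φ n t| ≤ 1 := by
    intro n t
    have h1 : thickenedIndicator (hδ n) A t ≤ 1 := thickenedIndicator_le_one _ _ _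
    simp only [φ, ContinuousMap.coe_mk, NNReal.abs_eq]
    exact_mod_cast h1
  have hν : Tendsto (fun n => ∫ᵛ t, φ n t ∂•ν) atTop (𝓝 (ν A)) := by
    have h1 : Tendsto (fun n => ∫ᵛ t, φ n t ∂•ν) atTop
        (𝓝 (∫ᵛ t, A.indicator (fun _ => (1 : ℝ)) t ∂•ν)) :=
      VectorMeasure.tendsto_integral_filter_of_norm_le_const
      (Eventually.of_forall fun n => (φ n).continuous.measurable.aestronglyMeasurable)
      ⟨1, Eventually.of_forall fun n => Eventually.of_forall fun t => hle n t⟩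
      (Eventually.of_forall hlim)
    rw [VectorMeasure.integral_indicator_const _ hA.measurableSet] at h1
    simpa using h1
  have hL : Tendsto (fun n => ∫ t, φ n t ^ 2) atTop (𝓝 0) := by
    have h1 : Tendsto (fun n => ∫ t, φ n t ^ 2) atTop
        (𝓝 (∫ t, (A.indicator (fun _ => (1 : ℝ)) t) ^ 2)) := by
      refine tendsto_integral_of_dominated_convergence (fun _ => 1)
        (fun n => ((φ n).continuous.pow 2).measurable.aestronglyMeasurable)
        (integrable_const _) (fun n => Eventually.of_forall fun t => ?_)
        (Eventually.of_forall fun t => (hlim t).pow 2)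
      rw [Real.norm_eq_abs, abs_pow]
      exact pow_le_one₀ (abs_nonneg _) (hle n t)
    have h2 : ∫ t, (A.indicator (fun _ => (1 : ℝ)) t) ^ 2 = 0 := by
      rw [show (fun t => (A.indicator (fun _ => (1 : ℝ)) t) ^ 2) = A.indicator fun _ => 1 by
        ext t; by_cases ht : t ∈ A <;> simp [ht], integral_indicator hA.measurableSet]
      simp [Measure.real, hA0]
    rwa [h2] at h1
  have h3 := le_of_tendsto_of_tendsto' (hν.pow 2) (hL.const_mul C) fun n => h (φ n)
  rw [mul_zero] at h3
  exact pow_eq_zero_iff two_ne_zero |>.1 (le_antisymm h3 (sq_nonneg _))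

/-- The positive part is the restriction of ν to a Hahn set `i`. Inner regularity reduces the claim
to compact subsets of i ∩ A, on which the positive part equals ν. -/
theorem posPart_absolutelyContinuous_of_isCompact {ν : SignedMeasure I}
    (h : ∀ A : Set I, IsCompact A → volume A = 0 → ν A = 0) :
    ν.toJordanDecomposition.posPart ≪ volume := by
  obtain ⟨i, hi₁, hi₂, hi₃, hpos, hneg⟩ := ν.toJordanDecomposition_spec
  refine Measure.AbsolutelyContinuous.mk fun A hA hA0 => ?_
  have h1 : ν.toJordanDecomposition.posPart A = ν.toJordanDecomposition.posPart (i ∩ A) := by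
    rw [hpos, toMeasureOfZeroLE_apply _ _ _ hA, toMeasureOfZeroLE_apply _ _ _ (hi₁.inter hA)]
    simp [← Set.inter_assoc]
  rw [h1, (hi₁.inter hA).measure_eq_iSup_isCompact_of_ne_top (measure_ne_top _ _)]
  simp only [ENNReal.iSup_eq_zero]
  intro B hB hBc
  rw [hpos, toMeasureOfZeroLE_apply _ _ _ hBc.measurableSet]
  have h2 : i ∩ B = B := Set.inter_eq_right.2 (hB.trans Set.inter_subset_left)
  have h3 := h B hBc (measure_mono_null (hB.trans Set.inter_subset_right) hA0)
  rw [ENNReal.coe_eq_zero]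
  ext
  simp [h2, h3]

theorem absolutelyContinuous_of_sq_integral_le {ν : SignedMeasure I} {C : ℝ}
    (h : ∀ φ : C(I, ℝ), (∫ᵛ t, φ t ∂•ν) ^ 2 ≤ C * ∫ t, φ t ^ 2) :
    ν ≪ᵥ (volume : Measure I).toENNRealVectorMeasure := by
  have h1 : ∀ A : Set I, IsCompact A → volume A = 0 → ν A = 0 := fun A hA hA0 =>
    apply_eq_zero_of_isCompact h hA hA0
  rw [absolutelyContinuous_ennreal_iff,
    VectorMeasure.ennrealToMeasure_toENNRealVectorMeasure,
    totalVariation_absolutelyContinuous_iff]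
  refine ⟨posPart_absolutelyContinuous_of_isCompact h1, ?_⟩
  have h2 := posPart_absolutelyContinuous_of_isCompact (ν := -ν)
    fun A hA hA0 => by simp [h1 A hA hA0]
  rwa [toJordanDecomposition_neg] at h2

end MeasureTheory.SignedMeasure

/-! ### Weak* convergence, component by component. -/

namespace PathMeasure

variable {X : Type*} [Fintype X] {ι : Type*} {l : Filter ι}

theorem tendsto_nhds_iff {v : ι → PathMeasure X} {u : PathMeasure X} :
    Tendsto v l (𝓝 u) ↔ ∀ φ, Tendsto (fun i => (v i).pairing φ) l (𝓝 (u.pairing φ)) := by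
  rw [(Topology.IsInducing.mk rfl : Topology.IsInducing (pairing (X := X))).tendsto_nhds_iff,
    tendsto_pi_nhds]
  rfl

theorem tendsto_nhds_iff_components {v : ι → PathMeasure X} {u : PathMeasure X} :
    Tendsto v l (𝓝 u) ↔
      (∀ x (φ : C(I, ℝ)), Tendsto (fun i => ∫ᵛ t, φ t ∂•((v i).ρ x)) l
        (𝓝 (∫ᵛ t, φ t ∂•(u.ρ x)))) ∧
      ∀ x y (φ : C(I, ℝ)), Tendsto (fun i => ∫ᵛ t, φ t ∂•((v i).m x y)) l
        (𝓝 (∫ᵛ t, φ t ∂•(u.m x y))) := by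
  classical
  rw [tendsto_nhds_iff]
  constructor
  · intro h
    constructor
    · intro x φ
      have key : ∀ w : PathMeasure X,
          w.pairing ⟨fun t => (Pi.single x (φ t), 0),
            ((continuous_single x).comp φ.continuous).prodMk continuous_const⟩ = ∫ᵛ t, φ t ∂•(w.ρ x) := by
        intro w
        unfold pairing
        rw [Finset.sum_eq_single x]
        · simp
        · intro x' _ hx
          simp [Pi.single_eq_of_ne hx]
        · simp
      have := h ⟨fun t => (Pi.single x (φ t), 0),
            ((continuous_single x).comp φ.continuous).prodMk continuous_const⟩
      simp_rw [key] at this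
      exact this
    · intro x y φ
      have key : ∀ w : PathMeasure X,
          w.pairing ⟨fun t => (0, Pi.single x (Pi.single y (φ t))),
            continuous_const.prodMk
              ((continuous_single x).comp ((continuous_single y).comp φ.continuous))⟩ =
            ∫ᵛ t, φ t ∂•(w.m x y) := by
        intro w
        unfold pairing
        have h1 : ∑ y', ∫ᵛ t, (Pi.single (M := fun _ => ℝ) y (φ t)) y' ∂•(w.m x y') =
            ∫ᵛ t, φ t ∂•(w.m x y) := by
          rw [Finset.sum_eq_single y]
          · simp
          · intro y' _ hy
            simp [Pi.single_eq_of_ne hy]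
          · simp
        simp only [ContinuousMap.coe_mk, Pi.zero_apply, VectorMeasure.integral_zero,
          Finset.sum_const_zero, zero_add]
        rw [Finset.sum_eq_single x]
        · simpa using h1
        · intro x' _ hx
          simp [Pi.single_eq_of_ne hx]
        · simp
      have := h ⟨fun t => (0, Pi.single x (Pi.single y (φ t))),
            continuous_const.prodMk
              ((continuous_single x).comp ((continuous_single y).comp φ.continuous))⟩
      simp_rw [key] at this
      exact this
  · rintro ⟨hρ, hm⟩ φ
    unfold pairing
    refine Tendsto.add (tendsto_finsetSum _ fun x _ => ?_)
      (tendsto_finsetSum _ fun x _ => tendsto_finsetSum _ fun y _ => ?_)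
    · exact hρ x ⟨fun t => (φ t).1 x, by fun_prop⟩
    · exact hm x y ⟨fun t => (φ t).2 x y, by fun_prop⟩

end PathMeasure


/-! ### The unit interval and its grid cells. -/

theorem integrableOn_IccExtend {f : I → ℝ} :
    IntegrableOn (Set.IccExtend (zero_le_one' ℝ) f) (Set.Icc 0 1) ↔ Integrable f := by
  have h := (MeasurableEmbedding.subtype_coe (measurableSet_Icc (a := (0 : ℝ)) (b := 1))).integrable_map_iff
    (μ := (volume : Measure I)) (g := Set.IccExtend (zero_le_one' ℝ) f)
  rw [show Set.IccExtend (zero_le_one' ℝ) f ∘ ((↑) : I → ℝ) = f by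
    ext t; simp] at h
  rw [← h, IntegrableOn]
  congr!
  exact (map_comap_subtype_coe measurableSet_Icc volume).symm

theorem intervalIntegrable_IccExtend {f : I → ℝ} (hf : Integrable f) :
    IntervalIntegrable (Set.IccExtend (zero_le_one' ℝ) f) volume 0 1 := by
  rw [intervalIntegrable_iff_integrableOn_Icc_of_le zero_le_one]
  exact integrableOn_IccExtend.2 hf

theorem setIntegral_Icc_eq_integral_unitInterval (F : ℝ → ℝ) :
    ∫ s in Set.Icc (0 : ℝ) 1, F s = ∫ t : I, F t := by
  rw [← map_comap_subtype_coe measurableSet_Icc volume,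
    (MeasurableEmbedding.subtype_coe measurableSet_Icc).integral_map]
  rfl

theorem intervalIntegral_eq_integral_unitInterval (F : ℝ → ℝ) :
    ∫ s in (0 : ℝ)..1, F s = ∫ t : I, F t := by
  rw [intervalIntegral.integral_of_le zero_le_one, ← integral_Icc_eq_integral_Ioc,
    setIntegral_Icc_eq_integral_unitInterval]

theorem intervalIntegral_IccExtend (f : I → ℝ) :
    ∫ s in (0 : ℝ)..1, Set.IccExtend (zero_le_one' ℝ) f s = ∫ t, f t := by
  rw [intervalIntegral_eq_integral_unitInterval]
  simp

theorem coe_gridPoint {N i : ℕ} (hi : i ≤ N) : (gridPoint N i : ℝ) = i / N := by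
  unfold gridPoint
  rw [Set.projIcc_of_mem]
  refine ⟨by positivity, div_le_one_of_le₀ (by exact_mod_cast hi) (by positivity)⟩

theorem gridPoint_zero (N : ℕ) : gridPoint N 0 = 0 := by
  ext; rw [coe_gridPoint (Nat.zero_le _)]; simp

theorem gridPoint_self {N : ℕ} (hN : 0 < N) : gridPoint N N = 1 := by
  have : (N : ℝ) ≠ 0 := by exact_mod_cast hN.ne'
  ext; rw [coe_gridPoint le_rfl, div_self this]; simp

theorem gridPoint_mem_cell {N i : ℕ} (hi : i < N) : gridPoint N i ∈ cell N i := by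
  have : (0 : ℝ) < N := by exact_mod_cast (Nat.zero_le i).trans_lt hi
  unfold cell
  rw [Set.mem_ofPred_eq, coe_gridPoint hi.le]
  exact ⟨le_rfl, by gcongr; linarith⟩

/-- The index of the grid cell that contains `t`, the last cell being closed. -/
def cellIndex (N : ℕ) (t : I) : ℕ := min ⌊(N : ℝ) * t⌋₊ (N - 1)

theorem measurable_cellIndex (N : ℕ) : Measurable (cellIndex N) := by
  unfold cellIndex
  exact (Nat.measurable_floor.comp (by fun_prop)).min measurable_const

theorem cellIndex_lt {N : ℕ} (hN : 0 < N) (t : I) : cellIndex N t < N :=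
  (min_le_right _ _).trans_lt (Nat.sub_lt hN one_pos)

theorem cellIndex_of_mem_cell {N i : ℕ} (hi : i < N) {t : I} (ht : t ∈ cell N i) :
    cellIndex N t = i := by
  have hN : (0 : ℝ) < N := by exact_mod_cast (Nat.zero_le i).trans_lt hi
  have h : ⌊(N : ℝ) * t⌋₊ = i := by
    rw [Nat.floor_eq_iff (mul_nonneg hN.le t.2.1)]
    have h1 := (div_le_iff₀ hN).1 ht.1
    have h2 := (lt_div_iff₀ hN).1 ht.2
    constructor <;> linarith
  unfold cellIndex
  rw [h, min_eq_left (by omega)]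

theorem mem_cell_cellIndex {N : ℕ} (hN : 0 < N) {t : I} (ht : t ≠ 1) :
    t ∈ cell N (cellIndex N t) := by
  have hN' : (0 : ℝ) < N := by exact_mod_cast hN
  have ht1 : (t : ℝ) < 1 := lt_of_le_of_ne t.2.2 fun h => ht (Subtype.ext h)
  have h0 : 0 ≤ (N : ℝ) * t := mul_nonneg hN'.le t.2.1
  have hlt : ⌊(N : ℝ) * t⌋₊ < N := by
    rw [Nat.floor_lt h0]
    nlinarith
  have h : cellIndex N t = ⌊(N : ℝ) * t⌋₊ := min_eq_left (by omega)
  rw [h]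
  constructor
  · rw [div_le_iff₀ hN', mul_comm (t : ℝ)]
    exact Nat.floor_le h0
  · rw [lt_div_iff₀ hN', mul_comm]
    exact Nat.lt_floor_add_one _

theorem mem_cell_iff {N i : ℕ} (hi : i < N) {t : I} :
    t ∈ cell N i ↔ t ≠ 1 ∧ cellIndex N t = i := by
  have hN : 0 < N := (Nat.zero_le i).trans_lt hi
  constructor
  · intro h
    refine ⟨?_, cellIndex_of_mem_cell hi h⟩
    rintro rfl
    have h2 := h.2
    have hN' : (0 : ℝ) < N := by exact_mod_cast hN
    rw [lt_div_iff₀ hN'] at h2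
    have : (i : ℝ) + 1 ≤ N := by exact_mod_cast hi
    simp at h2
    linarith
  · rintro ⟨h1, rfl⟩
    exact mem_cell_cellIndex hN h1

theorem abs_sub_gridPoint_cellIndex_le {N : ℕ} (hN : 0 < N) (t : I) :
    |(t : ℝ) - gridPoint N (cellIndex N t)| ≤ 1 / N := by
  have hN' : (0 : ℝ) < N := by exact_mod_cast hN
  rw [coe_gridPoint (cellIndex_lt hN t).le]
  by_cases ht : t = 1
  · subst ht
    have h : cellIndex N 1 = N - 1 := by
      unfold cellIndex
      simp
    rw [h, Nat.cast_sub hN]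
    have : ((1 : I) : ℝ) - ((N : ℝ) - (1 : ℕ)) / N = 1 / N := by
      simp; field_simp; ring
    rw [this, abs_of_pos (by positivity)]
  · obtain ⟨h1, h2⟩ := mem_cell_cellIndex hN ht
    rw [add_div] at h2
    rw [abs_le]
    have : 0 < 1 / (N : ℝ) := by positivity
    constructor <;> linarith

theorem measurableSet_cell (N i : ℕ) : MeasurableSet (cell N i) :=
  (measurableSet_le measurable_const measurable_subtype_coe).inter
    (measurableSet_lt measurable_subtype_coe measurable_const)

theorem volume_cell {N i : ℕ} (hi : i < N) : volume (cell N i) = ENNReal.ofReal (1 / N) := by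
  have hN : (0 : ℝ) < N := by exact_mod_cast (Nat.zero_le i).trans_lt hi
  have h : ((↑) : I → ℝ) '' cell N i = Set.Ico ((i : ℝ) / N) (((i : ℝ) + 1) / N) := by
    ext s
    constructor
    · rintro ⟨t, ht, rfl⟩
      exact ht
    · intro hs
      have h1 : ((i : ℝ) + 1) / N ≤ 1 := by
        rw [div_le_one hN]
        exact_mod_cast hi
      exact ⟨⟨s, le_trans (by positivity) hs.1, hs.2.le.trans h1⟩, hs, rfl⟩
  rw [unitInterval.volume_apply, h, Real.volume_Ico]
  congr 1
  field_simp; ring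

theorem volume_real_cell {N i : ℕ} (hi : i < N) : volume.real (cell N i) = 1 / N := by
  rw [Measure.real, volume_cell hi, ENNReal.toReal_ofReal (by positivity)]

theorem pairwiseDisjoint_cell (N : ℕ) :
    Set.PairwiseDisjoint (↑(Finset.range N)) (cell N) := by
  intro i hi j hj hij
  refine Set.disjoint_left.2 fun t h1 h2 => hij ?_
  rw [← cellIndex_of_mem_cell (by simpa using hi) h1,
    cellIndex_of_mem_cell (by simpa using hj) h2]

theorem iUnion_cell {N : ℕ} (hN : 0 < N) : ⋃ i ∈ Finset.range N, cell N i = {1}ᶜ := by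
  ext t
  simp only [Set.mem_iUnion, Finset.mem_range, exists_prop, Set.mem_compl_iff,
    Set.mem_singleton_iff]
  constructor
  · rintro ⟨i, hi, ht⟩
    exact ((mem_cell_iff hi).1 ht).1
  · intro ht
    exact ⟨_, cellIndex_lt hN t, mem_cell_cellIndex hN ht⟩

theorem integral_eq_sum_cell {N : ℕ} (hN : 0 < N) {f : I → ℝ} (hf : Integrable f) :
    ∫ t, f t = ∑ i ∈ Finset.range N, ∫ t in cell N i, f t := by
  rw [← integral_biUnion_finset _ (fun i _ => measurableSet_cell N i) (pairwiseDisjoint_cell N)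
    (fun i _ => hf.integrableOn), iUnion_cell hN]
  -- The half-open cells miss the point 1, which is a null set.
  exact (setIntegral_eq_integral_of_ae_compl_eq_zero (by
    filter_upwards [Measure.ae_ne volume (1 : I)] with t ht h
    exact absurd ht h)).symm

theorem lintegral_eq_sum_cell {N : ℕ} (hN : 0 < N) (f : I → ℝ≥0∞) :
    ∫⁻ t, f t = ∑ i ∈ Finset.range N, ∫⁻ t in cell N i, f t := by
  rw [← lintegral_biUnion_finset (pairwiseDisjoint_cell N) (fun i _ => measurableSet_cell N i),
    iUnion_cell hN, restrict_compl_singleton]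

theorem IsPiecewiseConstant.eq_gridPoint {E : Type*} {N : ℕ} {ψ : I → E}
    (h : IsPiecewiseConstant N ψ) {i : ℕ} (hi : i < N) {t : I} (ht : t ∈ cell N i) :
    ψ t = ψ (gridPoint N i) := by
  obtain ⟨c, hc⟩ := h i hi
  rw [hc t ht, hc _ (gridPoint_mem_cell hi)]

theorem setIntegral_cell_eq {N i : ℕ} (hi : i < N) {f : I → ℝ} {c : ℝ}
    (h : ∀ t ∈ cell N i, f t = c) : ∫ t in cell N i, f t = c / N := by
  rw [setIntegral_congr_fun (measurableSet_cell N i) (g := fun _ => c) h]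
  simp [volume_real_cell hi]
  ring

theorem setLIntegral_cell_eq {N i : ℕ} (hi : i < N) {f : I → ℝ≥0∞} {c : ℝ≥0∞}
    (h : ∀ t ∈ cell N i, f t = c) : ∫⁻ t in cell N i, f t = ENNReal.ofReal (1 / N) * c := by
  rw [setLIntegral_congr_fun (measurableSet_cell N i) (g := fun _ => c) h]
  simp only [lintegral_const, Measure.restrict_apply, MeasurableSet.univ, Set.univ_inter,
    volume_cell hi]
  rw [mul_comm]


/-! ### The discrete continuity equation. -/

namespace ReversibleChain

variable {X : Type*} [Fintype X] (K : ReversibleChain X)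

theorem innerE_grad (φ : X → ℝ) (m : X → X → ℝ) :
    K.innerE (grad φ) m = -K.innerV φ (K.div m) := by
  have hw : ∀ x y, K.Q x y * K.π x = K.Q y x * K.π y := fun x y => by
    linarith [K.detailed_balance x y]
  have h1 : ∑ x, ∑ y, φ y * m x y * (K.Q x y * K.π x) =
      ∑ x, ∑ y, φ x * m y x * (K.Q x y * K.π x) := by
    rw [Finset.sum_comm]
    refine Finset.sum_congr rfl fun x _ => Finset.sum_congr rfl fun y _ => ?_
    rw [hw]
  have h2 : ∑ x, ∑ y, (φ x - φ y) * m x y * K.Q x y * K.π x =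
      ∑ x, ∑ y, φ x * m x y * (K.Q x y * K.π x) - ∑ x, ∑ y, φ y * m x y * (K.Q x y * K.π x) := by
    simp_rw [← Finset.sum_sub_distrib]
    refine Finset.sum_congr rfl fun x _ => Finset.sum_congr rfl fun y _ => ?_
    ring
  unfold innerE innerV div grad
  rw [h2, h1, ← Finset.sum_sub_distrib, Finset.mul_sum, ← Finset.sum_neg_distrib]
  refine Finset.sum_congr rfl fun x _ => ?_
  rw [← Finset.sum_sub_distrib, Finset.mul_sum, Finset.mul_sum, Finset.mul_sum, Finset.sum_mul,
    ← Finset.sum_neg_distrib]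
  refine Finset.sum_congr rfl fun y _ => ?_
  ring

theorem sum_π_mul_div (m : X → X → ℝ) : ∑ x, K.π x * K.div m x = 0 := by
  have h := K.innerE_grad (fun _ => 1) m
  unfold innerE innerV grad at h
  simp only [sub_self, zero_mul, Finset.sum_const_zero, mul_zero, one_mul] at h
  simp_rw [mul_comm (K.π _)]
  linarith

/-- By irreducibility a vertex other than x has an outgoing edge on its way to x. One edge is
assumed because a one-point chain has none. -/
theorem exists_pos_of_edge {x y : X} (h : 0 < K.Q x y) (z : X) : ∃ w, 0 < K.Q z w := by
  by_cases hz : z = x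
  · exact ⟨y, hz ▸ h⟩
  · rcases (K.irreducible z x).cases_head with h1 | ⟨w, hw, -⟩
    · exact absurd h1 hz
    · exact ⟨w, hw⟩

namespace IsDiscreteCE

variable {K} {N : ℕ} {ρA ρB : X → ℝ} {r : I → X → ℝ} {p : I → X → X → ℝ}

theorem grid_eq (hN : 0 < N) (h : K.IsDiscreteCE N ρA ρB r p) {i : ℕ} (hi : i < N) (x : X) :
    (N : ℝ) * (r (gridPoint N (i + 1)) x - r (gridPoint N i) x) =
      -K.div (p (gridPoint N i)) x := by
  classical
  obtain ⟨-, -, h, -, -⟩ := h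
  -- Testing with the indicator of one cell times the indicator of one vertex isolates a single
  -- nodal equation.
  have hpc : IsPiecewiseConstant N
      (fun t => if t ∈ cell N i then (Pi.single x 1 : X → ℝ) else 0) := by
    intro j hj
    refine ⟨if j = i then Pi.single x 1 else 0, fun t ht => ?_⟩
    have : t ∈ cell N i ↔ j = i := by
      rw [mem_cell_iff hi, cellIndex_of_mem_cell hj ht]
      exact ⟨fun h => h.2, fun h => ⟨((mem_cell_iff hj).1 ht).1, h⟩⟩
    simp [this]
  have h1 := h _ hpc
  rw [Finset.sum_eq_single i] at h1
  · simp only [gridPoint_mem_cell hi, if_true, innerV] at h1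
    rw [Finset.sum_eq_single x] at h1
    · have hN' : (N : ℝ) ≠ 0 := by exact_mod_cast hN.ne'
      simp [hN', (K.π_pos x).ne'] at h1
      linarith
    · intro y _ hy
      simp [Pi.single_eq_of_ne hy]
    · simp
  · intro j hj hji
    have : gridPoint N j ∉ cell N i := by
      rw [mem_cell_iff hi, cellIndex_of_mem_cell (Finset.mem_range.1 hj)
        (gridPoint_mem_cell (Finset.mem_range.1 hj))]
      simp [hji]
    simp [this, innerV]
  · simp [hi]

/-- Cells are closed on the left, so the right derivative exists at every s < 1, grid points
included, and equals the value of −div p on that cell. This is what the fundamental theorem of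
calculus for right derivatives needs. -/
theorem hasDerivWithinAt (hN : 0 < N) (h : K.IsDiscreteCE N ρA ρB r p) (x : X) {s : ℝ}
    (hs0 : 0 ≤ s) (hs1 : s < 1) :
    HasDerivWithinAt (Set.IccExtend (zero_le_one' ℝ) fun t => r t x)
      (Set.IccExtend (zero_le_one' ℝ) (fun t => -K.div (p t) x) s) (Set.Ioi s) s := by
  have hN' : (0 : ℝ) < N := by exact_mod_cast hN
  set t : I := ⟨s, hs0, hs1.le⟩ with ht
  have hproj : ∀ (u : ℝ) (hu : u ∈ Set.Icc (0 : ℝ) 1), Set.projIcc 0 1 zero_le_one u = ⟨u, hu⟩ :=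
    fun u hu => Set.projIcc_of_mem _ hu
  have ht1 : t ≠ 1 := fun h => hs1.ne (congrArg Subtype.val h)
  set i := cellIndex N t with hi
  have hiN : i < N := cellIndex_lt hN t
  have htc : t ∈ cell N i := mem_cell_cellIndex hN ht1
  obtain ⟨⟨hcont, haff⟩, hpc, -, -, -⟩ := id h
  obtain ⟨a, b, hab⟩ := haff i hiN
  have hi1 : ((i : ℝ) + 1) / N ≤ 1 := by
    rw [div_le_one hN']; exact_mod_cast hiN
  -- The point t_{i+1} is outside the cell; continuity extends the affine formula to it.
  have hend : r (gridPoint N (i + 1)) x = a x + (((i : ℝ) + 1) / N) * b x := by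
    have hq : ((i : ℝ) + 1) / N ∈ Set.Icc (0 : ℝ) 1 := ⟨by positivity, hi1⟩
    have hc1 : ContinuousWithinAt (Set.IccExtend (zero_le_one' ℝ) fun t => r t x)
        (Set.Ioo ((i : ℝ) / N) (((i : ℝ) + 1) / N)) (((i : ℝ) + 1) / N) := by
      have : Continuous fun t => r t x := by fun_prop
      exact (this.Icc_extend' (h := zero_le_one)).continuousWithinAt
    have hc2 : ContinuousWithinAt (fun u => a x + u * b x)
        (Set.Ioo ((i : ℝ) / N) (((i : ℝ) + 1) / N)) (((i : ℝ) + 1) / N) := by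
      fun_prop
    have hne : (𝓝[Set.Ioo ((i : ℝ) / N) (((i : ℝ) + 1) / N)] (((i : ℝ) + 1) / N)).NeBot := by
      apply mem_closure_iff_nhdsWithin_neBot.1
      have hlt : (i : ℝ) / N < ((i : ℝ) + 1) / N := by gcongr; linarith
      rw [closure_Ioo hlt.ne]
      exact Set.right_mem_Icc.2 hlt.le
    have heq : Set.EqOn (Set.IccExtend (zero_le_one' ℝ) fun t => r t x) (fun u => a x + u * b x)
        (Set.Ioo ((i : ℝ) / N) (((i : ℝ) + 1) / N)) := by
      intro u hu
      have hu' : u ∈ Set.Icc (0 : ℝ) 1 := ⟨le_trans (by positivity) hu.1.le, hu.2.le.trans hi1⟩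
      simp only [Set.IccExtend, Function.comp_apply, hproj u hu']
      exact hab ⟨u, hu'⟩ ⟨hu.1.le, hu.2⟩ x
    have h1 := tendsto_nhds_unique (hc1.tendsto.congr' (heq.eventuallyEq_nhdsWithin)) hc2.tendsto
    simp only [Set.IccExtend, Function.comp_apply, hproj _ hq] at h1
    rw [← h1]
    congr 1
    ext
    rw [coe_gridPoint (by omega)]
    push_cast
    rfl
  have hstart : r (gridPoint N i) x = a x + ((i : ℝ) / N) * b x := by
    rw [hab _ (gridPoint_mem_cell hiN) x, coe_gridPoint hiN.le]
  have hb : -K.div (p t) x = b x := by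
    rw [hpc.eq_gridPoint hiN htc, ← h.grid_eq hN hiN x, hend, hstart]
    field_simp
    ring
  have hval : Set.IccExtend (zero_le_one' ℝ) (fun t => -K.div (p t) x) s = b x := by
    simp only [Set.IccExtend, Function.comp_apply, hproj s t.2]
    exact hb
  rw [hval]
  have hd : HasDerivWithinAt (fun u => a x + u * b x) (b x) (Set.Ioi s) s := by
    simpa using (((hasDerivAt_id s).mul_const (b x)).const_add (a x)).hasDerivWithinAt
  have heq : ∀ u, s ≤ u → u < ((i : ℝ) + 1) / N →
      Set.IccExtend (zero_le_one' ℝ) (fun t => r t x) u = a x + u * b x := by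
    intro u hu1 hu2
    have hu' : u ∈ Set.Icc (0 : ℝ) 1 := ⟨hs0.trans hu1, hu2.le.trans hi1⟩
    simp only [Set.IccExtend, Function.comp_apply, hproj u hu']
    exact hab ⟨u, hu'⟩ ⟨htc.1.trans hu1, hu2⟩ x
  refine hd.congr_of_eventuallyEq ?_ (heq s le_rfl htc.2)
  filter_upwards [Ioo_mem_nhdsGT htc.2] with u hu using heq u hu.1.le hu.2

theorem integrable_div (hp : ∀ x y, 0 < K.Q x y → Integrable fun t => p t x y) (x : X) :
    Integrable fun t => K.div (p t) x := by
  unfold div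
  refine (integrable_finsetSum _ fun y _ => ?_).const_mul _
  by_cases hQ : 0 < K.Q x y
  · exact ((hp y x (K.Q_pos_comm.1 hQ)).sub (hp x y hQ)).const_mul _
  · simp [K.Q_eq_zero_of_not_pos hQ]

theorem eq_sub_integral (hN : 0 < N) (h : K.IsDiscreteCE N ρA ρB r p)
    (hp : ∀ x y, 0 < K.Q x y → Integrable fun t => p t x y) (x : X) (t : I) :
    r t x = ρA x - ∫ s in (0 : ℝ)..t, Set.IccExtend (zero_le_one' ℝ) (fun t => K.div (p t) x) s := by
  have hcont : Continuous fun t => r t x := by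
    have := h.1.1
    fun_prop
  have h1 := intervalIntegral.integral_eq_sub_of_hasDeriv_right (a := 0) (b := (t : ℝ))
    (f := Set.IccExtend (zero_le_one' ℝ) fun t => r t x)
    (f' := Set.IccExtend (zero_le_one' ℝ) (fun t => -K.div (p t) x))
    (hcont.Icc_extend' (h := zero_le_one)).continuousOn ?_ ?_
  · rw [show Set.IccExtend (zero_le_one' ℝ) (fun t => -K.div (p t) x) =
      fun s => -Set.IccExtend (zero_le_one' ℝ) (fun t => K.div (p t) x) s from rfl,
      intervalIntegral.integral_neg] at h1
    have h2 : Set.IccExtend (zero_le_one' ℝ) (fun t => r t x) t = r t x := by simp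
    have h3 : Set.IccExtend (zero_le_one' ℝ) (fun t => r t x) 0 = ρA x := by
      rw [← h.2.2.2.1]
      simp [Set.IccExtend, Set.projIcc_left]
    linarith
  · intro s hs
    rw [min_eq_left t.2.1, max_eq_right t.2.1] at hs
    exact h.hasDerivWithinAt hN x hs.1.le (hs.2.trans_le t.2.2)
  · refine (intervalIntegrable_IccExtend (integrable_div hp x).neg).mono_set ?_
    rw [Set.uIcc_of_le t.2.1, Set.uIcc_of_le zero_le_one]
    exact Set.Icc_subset_Icc_right t.2.2

/-- A divergence has zero mean with respect to π, so the total mass stays that of `ρA`. -/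
theorem sum_π_mul (hA : ∑ x, K.π x * ρA x = 1) (hN : 0 < N) (h : K.IsDiscreteCE N ρA ρB r p)
    (hp : ∀ x y, 0 < K.Q x y → Integrable fun t => p t x y) (t : I) :
    ∑ x, K.π x * r t x = 1 := by
  simp_rw [h.eq_sub_integral hN hp, mul_sub, Finset.sum_sub_distrib, hA,
    ← intervalIntegral.integral_const_mul]
  rw [← intervalIntegral.integral_finsetSum]
  · rw [intervalIntegral.integral_congr (g := fun _ => 0)]
    · simp
    · intro s _
      exact K.sum_π_mul_div _
  · intro x _
    refine ((intervalIntegrable_IccExtend (integrable_div hp x)).mono_set ?_).const_mul _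
    rw [Set.uIcc_of_le t.2.1, Set.uIcc_of_le zero_le_one]
    exact Set.Icc_subset_Icc_right t.2.2

theorem abs_le (hN : 0 < N) (h : K.IsDiscreteCE N ρA ρB r p)
    (hp : ∀ x y, 0 < K.Q x y → Integrable fun t => p t x y) (x : X) (t : I) :
    |r t x| ≤ |ρA x| + ∫ s, |K.div (p s) x| := by
  rw [h.eq_sub_integral hN hp x t]
  refine (abs_sub _ _).trans (add_le_add le_rfl ?_)
  refine (intervalIntegral.abs_integral_le_integral_abs t.2.1).trans ?_
  rw [← intervalIntegral_IccExtend]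
  refine intervalIntegral.integral_mono_interval le_rfl t.2.1 t.2.2 ?_
    (intervalIntegrable_IccExtend (integrable_div hp x).abs)
  exact Eventually.of_forall fun s => abs_nonneg _

/-- Solutions of the discrete continuity equation solve the continuity equation. -/
theorem integral_eq (hN : 0 < N) (h : K.IsDiscreteCE N ρA ρB r p)
    (hp : ∀ x y, 0 < K.Q x y → Integrable fun t => p t x y) {φ : ℝ → X → ℝ}
    (hφ : ContDiffOn ℝ 1 φ (Set.Icc 0 1)) :
    ∫ t : I, (K.innerV (derivWithin φ (Set.Icc 0 1) (t : ℝ)) (r t) +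
      K.innerE (grad (φ (t : ℝ))) (p t)) = K.innerV (φ 1) ρB - K.innerV (φ 0) ρA := by
  have hcont : ∀ x, Continuous fun t => r t x := fun x => by
    have := h.1.1
    fun_prop
  have hcont' : ∀ x, Continuous (Set.IccExtend (zero_le_one' ℝ) fun t => r t x) := fun x =>
    (hcont x).Icc_extend' (h := zero_le_one)
  have hφc : ∀ x, ContinuousOn (fun s => φ s x) (Set.Icc 0 1) := fun x =>
    (continuous_apply x).comp_continuousOn hφ.continuousOn
  have hφ'c : ContinuousOn (derivWithin φ (Set.Icc 0 1)) (Set.Icc 0 1) :=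
    hφ.continuousOn_derivWithin uniqueDiffOn_Icc_zero_one le_rfl
  -- `F'` is the right derivative of the pairing of φ and r with respect to π. Integrating it over
  -- [0,1] leaves the boundary terms, without discretisation error.
  set F' : ℝ → ℝ := fun s => ∑ x,
    (derivWithin φ (Set.Icc 0 1) s x * Set.IccExtend (zero_le_one' ℝ) (fun t => r t x) s +
      φ s x * Set.IccExtend (zero_le_one' ℝ) (fun t => -K.div (p t) x) s) * K.π x with hF'
  have h1 := intervalIntegral.integral_eq_sub_of_hasDeriv_right (a := 0) (b := 1)
    (f := fun s => ∑ x, φ s x * Set.IccExtend (zero_le_one' ℝ) (fun t => r t x) s * K.π x)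
    (f' := F') ?_ ?_ ?_
  · have h2 : ∫ t : I, (K.innerV (derivWithin φ (Set.Icc 0 1) (t : ℝ)) (r t) +
        K.innerE (grad (φ (t : ℝ))) (p t)) = ∫ s in (0 : ℝ)..1, F' s := by
      rw [intervalIntegral_eq_integral_unitInterval]
      refine integral_congr_ae (Eventually.of_forall fun t => ?_)
      simp only [K.innerE_grad, hF', Set.IccExtend_val, innerV]
      rw [← Finset.sum_neg_distrib, ← Finset.sum_add_distrib]
      refine Finset.sum_congr rfl fun x _ => ?_
      ring
    rw [h2, h1]
    have h3 : ∀ x, Set.IccExtend (zero_le_one' ℝ) (fun t => r t x) 0 = ρA x := fun x => by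
      rw [← h.2.2.2.1]
      simp [Set.IccExtend, Set.projIcc_left]
    have h4 : ∀ x, Set.IccExtend (zero_le_one' ℝ) (fun t => r t x) 1 = ρB x := fun x => by
      rw [← h.2.2.2.2]
      simp [Set.IccExtend, Set.projIcc_right]
    simp_rw [h3, h4]
    rfl
  · rw [Set.uIcc_of_le zero_le_one]
    exact continuousOn_finsetSum _ fun x _ =>
      ((hφc x).mul (hcont' x).continuousOn).mul continuousOn_const
  · intro s hs
    rw [min_eq_left zero_le_one, max_eq_right zero_le_one] at hs
    refine HasDerivWithinAt.fun_sum fun x _ => HasDerivWithinAt.mul_const ?_ _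
    refine HasDerivWithinAt.fun_mul ?_ (h.hasDerivWithinAt hN x hs.1.le hs.2)
    have hd : HasDerivAt φ (derivWithin φ (Set.Icc 0 1) s) s :=
      ((hφ.differentiableOn one_ne_zero s (Set.Ioo_subset_Icc_self hs)).hasDerivWithinAt).hasDerivAt
        (Icc_mem_nhds hs.1 hs.2)
    exact ((hasDerivAt_pi.1 hd) x).hasDerivWithinAt
  · have hint : ∀ x, IntervalIntegrable (fun s => (derivWithin φ (Set.Icc 0 1) s x *
        Set.IccExtend (zero_le_one' ℝ) (fun t => r t x) s +
        φ s x * Set.IccExtend (zero_le_one' ℝ) (fun t => -K.div (p t) x) s) * K.π x)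
        volume 0 1 := by
      intro x
      refine (IntervalIntegrable.add ?_ ?_).mul_const _
      · refine ContinuousOn.intervalIntegrable ?_
        rw [Set.uIcc_of_le zero_le_one]
        exact ((continuous_apply x).comp_continuousOn hφ'c).mul (hcont' x).continuousOn
      · refine (intervalIntegrable_IccExtend (integrable_div hp x).neg).continuousOn_mul ?_
        rw [Set.uIcc_of_le zero_le_one]
        exact hφc x
    have := IntervalIntegrable.sum Finset.univ fun x _ => hint x
    simpa [hF', Finset.sum_fn] using this

end IsDiscreteCE

end ReversibleChain


/-! ### L² bounds and Riemann sums. -/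

theorem sq_integral_mul_le {Ω : Type*} [MeasurableSpace Ω] {μ : Measure Ω} {f g : Ω → ℝ}
    (hf : Integrable (fun x => f x ^ 2) μ) (hg : Integrable (fun x => g x ^ 2) μ)
    (hfg : Integrable (fun x => f x * g x) μ) :
    (∫ x, f x * g x ∂μ) ^ 2 ≤ (∫ x, f x ^ 2 ∂μ) * ∫ x, g x ^ 2 ∂μ := by
  have h : ∀ c : ℝ, 0 ≤ (∫ x, f x ^ 2 ∂μ) * (c * c) + (2 * ∫ x, f x * g x ∂μ) * c +
      ∫ x, g x ^ 2 ∂μ := by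
    intro c
    have h1 : ∫ x, (c * f x + g x) ^ 2 ∂μ = (∫ x, f x ^ 2 ∂μ) * (c * c) +
        (2 * ∫ x, f x * g x ∂μ) * c + ∫ x, g x ^ 2 ∂μ := by
      rw [show (fun x => (c * f x + g x) ^ 2) =
        fun x => (c * c * f x ^ 2 + 2 * c * (f x * g x)) + g x ^ 2 by ext x; ring,
        integral_add (f := fun x => c * c * f x ^ 2 + 2 * c * (f x * g x))
          ((hf.const_mul _).add (hfg.const_mul _)) hg,
        integral_add (hf.const_mul _) (hfg.const_mul _), integral_const_mul, integral_const_mul]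
      ring
    rw [← h1]
    exact integral_nonneg fun x => sq_nonneg _
  -- Cauchy–Schwarz: the nonnegative quadratic c ↦ ∫ (cf + g)² has nonpositive discriminant.
  have h2 := discrim_le_zero h
  unfold discrim at h2
  linarith

theorem abs_le_of_sq_integral {f : I → ℝ} (hf : Integrable f)
    (hf2 : Integrable fun t => f t ^ 2) {B : ℝ} (hB : ∫ t, f t ^ 2 ≤ B) : ∫ t, |f t| ≤ 1 + B := by
  calc ∫ t, |f t| ≤ ∫ t, (1 + f t ^ 2) := by
        refine integral_mono hf.abs ((integrable_const _).add hf2) fun t => ?_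
        simp only
        rw [← sq_abs]
        nlinarith [sq_nonneg (|f t| - 1), abs_nonneg (f t)]
    _ ≤ 1 + B := by
        rw [integral_add (integrable_const _) hf2]
        simpa using hB

/-- Cauchy–Schwarz bounds each squared pairing by B ∫ φ², and this bound passes to the limit. -/
theorem absolutelyContinuous_of_tendsto {ι : Type*} {l : Filter ι} [l.NeBot] {ν : SignedMeasure I}
    {f : ι → I → ℝ} {B : ℝ} (hf : ∀ j, Integrable (f j)) (hf2 : ∀ j, Integrable fun t => f j t ^ 2)
    (hB : ∀ j, ∫ t, f j t ^ 2 ≤ B)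
    (hlim : ∀ φ : C(I, ℝ), Tendsto (fun j => ∫ t, φ t * f j t) l (𝓝 (∫ᵛ t, φ t ∂•ν))) :
    ν ≪ᵥ (volume : Measure I).toENNRealVectorMeasure := by
  refine SignedMeasure.absolutelyContinuous_of_sq_integral_le (C := B) fun φ => ?_
  refine le_of_tendsto' ((hlim φ).pow 2) fun j => ?_
  obtain ⟨C, -, hC⟩ := φ.exists_abs_le
  have hφ2 : Integrable fun t => φ t ^ 2 :=
    (φ.continuous.pow 2).integrable_of_hasCompactSupport (HasCompactSupport.of_compactSpace _)
  have hφf : Integrable fun t => φ t * f j t :=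
    (hf j).bdd_mul φ.continuous.measurable.aestronglyMeasurable (Eventually.of_forall hC)
  calc _ ≤ (∫ t, φ t ^ 2) * ∫ t, f j t ^ 2 := sq_integral_mul_le hφ2 (hf2 j) hφf
    _ ≤ (∫ t, φ t ^ 2) * B :=
        mul_le_mul_of_nonneg_left (hB j) (integral_nonneg fun t => sq_nonneg _)
    _ = _ := mul_comm _ _

theorem exists_forall_abs_sub_lt (φ : C(I, ℝ)) {ε : ℝ} (hε : 0 < ε) :
    ∃ δ > 0, ∀ s t : I, |(s : ℝ) - t| < δ → |φ s - φ t| < ε := by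
  obtain ⟨δ, hδ, h⟩ := Metric.uniformContinuous_iff.1
    (CompactSpace.uniformContinuous_of_continuous φ.continuous) ε hε
  exact ⟨δ, hδ, fun s t hst => h hst⟩

theorem integral_mul_comp_cellIndex {N : ℕ} (hN : 0 < N) {f : I → ℝ} (hf : Integrable f)
    (g : ℕ → ℝ) : ∫ t, g (cellIndex N t) * f t =
      ∑ i ∈ Finset.range N, g i * ∫ t in cell N i, f t := by
  have hint : Integrable fun t => g (cellIndex N t) * f t := by
    refine hf.bdd_mul (c := ∑ i ∈ Finset.range N, |g i|)
      ((measurable_from_nat.comp (measurable_cellIndex N)).aestronglyMeasurable)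
      (Eventually.of_forall fun t => ?_)
    exact Finset.single_le_sum (f := fun i => |g i|) (fun _ _ => abs_nonneg _)
      (Finset.mem_range.2 (cellIndex_lt hN t))
  rw [integral_eq_sum_cell hN hint]
  refine Finset.sum_congr rfl fun i hi => ?_
  rw [← integral_const_mul]
  refine setIntegral_congr_fun (measurableSet_cell N i) fun t ht => ?_
  simp only [cellIndex_of_mem_cell (Finset.mem_range.1 hi) ht]

/-- Riemann sums of a continuous function against densities bounded in `L¹` approximate the
integral. -/
theorem tendsto_riemannSum {ι : Type*} {l : Filter ι} {N : ι → ℕ} (hN : ∀ j, 0 < N j)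
    (hNl : Tendsto N l atTop) {f : ι → I → ℝ} (hf : ∀ j, Integrable (f j)) {B : ℝ}
    (hB : ∀ j, ∫ t, |f j t| ≤ B) (φ : C(I, ℝ)) {L : ℝ}
    (hL : Tendsto (fun j => ∫ t, φ t * f j t) l (𝓝 L)) :
    Tendsto (fun j => ∑ i ∈ Finset.range (N j),
      φ (gridPoint (N j) i) * ∫ t in cell (N j) i, f j t) l (𝓝 L) := by
  -- The Riemann sum is the integral of f against φ frozen at the left end point of each cell;
  -- uniform continuity of φ and the L¹ bound make the error vanish.
  have hdiff : Tendsto (fun j => (∫ t, φ (gridPoint (N j) (cellIndex (N j) t)) * f j t) -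
      ∫ t, φ t * f j t) l (𝓝 0) := by
    rw [Metric.tendsto_nhds]
    intro ε hε
    have hε' : 0 < ε / (|B| + 1) := by positivity
    obtain ⟨δ, hδ, hφ⟩ := exists_forall_abs_sub_lt φ hε'
    have h1 : Tendsto (fun j => 1 / (N j : ℝ)) l (𝓝 0) :=
      tendsto_one_div_atTop_nhds_zero_nat.comp hNl
    filter_upwards [h1.eventually_lt_const hδ] with j hj
    obtain ⟨C, -, hC⟩ := φ.exists_abs_le
    have hi1 : Integrable fun t => φ t * f j t :=
      (hf j).bdd_mul φ.continuous.measurable.aestronglyMeasurable (Eventually.of_forall hC)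
    have hi2 : Integrable fun t => φ (gridPoint (N j) (cellIndex (N j) t)) * f j t :=
      (hf j).bdd_mul ((measurable_from_nat (f := fun i => φ (gridPoint (N j) i))).comp
        (measurable_cellIndex (N j))).aestronglyMeasurable (Eventually.of_forall fun t => hC _)
    rw [← integral_sub hi2 hi1, dist_zero_right]
    calc ‖∫ t, (φ (gridPoint (N j) (cellIndex (N j) t)) * f j t - φ t * f j t)‖
        ≤ ∫ t, ε / (|B| + 1) * |f j t| := by
          refine norm_integral_le_of_norm_le ((hf j).abs.const_mul _)
            (Eventually.of_forall fun t => ?_)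
          rw [← sub_mul, Real.norm_eq_abs, abs_mul]
          refine mul_le_mul_of_nonneg_right (hφ _ _ ?_).le (abs_nonneg _)
          rw [abs_sub_comm]
          exact (abs_sub_gridPoint_cellIndex_le (hN j) t).trans_lt hj
      _ ≤ ε / (|B| + 1) * |B| := by
          rw [integral_const_mul]
          exact mul_le_mul_of_nonneg_left ((hB j).trans (le_abs_self B)) hε'.le
      _ < ε := by
          rw [div_mul_eq_mul_div, div_lt_iff₀ (by positivity)]
          nlinarith [abs_nonneg B]
  have h2 := hdiff.add hL
  rw [zero_add] at h2
  refine h2.congr fun j => ?_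
  rw [sub_add_cancel, integral_mul_comp_cellIndex (hN j) (hf j) fun i => φ (gridPoint (N j) i)]

/-! ### Mollification on the unit interval. -/

/-- The extension of a function on `[0,1]` by zero. -/
def zeroExtend (f : I → ℝ) : ℝ → ℝ := (Set.Icc 0 1).indicator (Set.IccExtend (zero_le_one' ℝ) f)

theorem zeroExtend_coe (f : I → ℝ) (t : I) : zeroExtend f t = f t := by
  unfold zeroExtend
  rw [Set.indicator_of_mem t.2]
  simp

theorem integrable_zeroExtend {f : I → ℝ} (hf : Integrable f) : Integrable (zeroExtend f) :=
  (integrable_indicator_iff measurableSet_Icc).2 (integrableOn_IccExtend.2 hf)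

theorem integral_mul_zeroExtend (g : ℝ → ℝ) (f : I → ℝ) :
    ∫ s, g s * zeroExtend f s = ∫ t : I, g t * f t := by
  unfold zeroExtend
  simp_rw [← Set.indicator_mul_right (Set.Icc (0 : ℝ) 1) g]
  rw [integral_indicator measurableSet_Icc, setIntegral_Icc_eq_integral_unitInterval]
  simp

/-- The mollification of the extension by zero of a function on `[0,1]`. -/
def mollify (k : ContDiffBump (0 : ℝ)) (f : I → ℝ) (s : ℝ) : ℝ :=
  ∫ t : I, k.normed volume (s - t) * f t

open scoped Convolution in
theorem convolution_zeroExtend (k : ContDiffBump (0 : ℝ)) (f : I → ℝ) :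
    (k.normed volume ⋆[ContinuousLinearMap.lsmul ℝ ℝ, volume] zeroExtend f) = mollify k f := by
  ext s
  rw [convolution_eq_swap]
  exact integral_mul_zeroExtend (fun u => k.normed volume (s - u)) f

theorem continuous_mollify (k : ContDiffBump (0 : ℝ)) {f : I → ℝ} (hf : Integrable f) :
    Continuous (mollify k f) := by
  rw [← convolution_zeroExtend]
  exact k.hasCompactSupport_normed.continuous_convolution_left _ k.continuous_normed
    (integrable_zeroExtend hf).locallyIntegrable

theorem ae_tendsto_mollify {k : ℕ → ContDiffBump (0 : ℝ)}
    (hk1 : Tendsto (fun n => (k n).rOut) atTop (𝓝 0))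
    (hk2 : ∀ᶠ n in atTop, (k n).rOut ≤ 2 * (k n).rIn) {f : I → ℝ} (hf : Integrable f) :
    ∀ᵐ s, Tendsto (fun n => mollify (k n) f s) atTop (𝓝 (zeroExtend f s)) := by
  simp_rw [← convolution_zeroExtend]
  exact ContDiffBump.ae_convolution_tendsto_right_of_locallyIntegrable hk1 hk2
    (integrable_zeroExtend hf).locallyIntegrable

theorem lintegral_unitInterval_le (F : ℝ → ℝ≥0∞) : ∫⁻ t : I, F t ≤ ∫⁻ s, F s := by
  have h : ∫⁻ t : I, F t = ∫⁻ s in Set.Icc (0 : ℝ) 1, F s := by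
    rw [← map_comap_subtype_coe measurableSet_Icc volume,
      (MeasurableEmbedding.subtype_coe measurableSet_Icc).lintegral_map]
    rfl
  rw [h]
  exact setLIntegral_le_lintegral _ _

/-! ### Lower semicontinuity of the action along refining grids. -/

namespace ReversibleChain

variable {X : Type*} [Fintype X] (K : ReversibleChain X) {θ : ℝ → ℝ → ℝ}

theorem measurable_actionDensity_comp (hθ : IsAveraging θ) {Ω : Type*} [MeasurableSpace Ω]
    {f : Ω → X → ℝ} {g : Ω → X → X → ℝ} (hf : ∀ x, Measurable fun s => f s x)
    (hg : ∀ x y, Measurable fun s => g s x y) :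
    Measurable fun s => K.actionDensity θ (f s) (g s) :=
  Measurable.const_mul (Finset.measurable_fun_sum _ fun x _ => Finset.measurable_fun_sum _ fun y _ =>
    ((measurable_alpha hθ).comp (g := fun q : ℝ × ℝ × ℝ => alpha θ q.1 q.2.1 q.2.2)
      (f := fun s => (f s x, f s y, g s x y))
      ((hf x).prodMk ((hf y).prodMk (hg x y)))).mul_const _) _

/-- The action of a mollified limit is bounded by the discrete actions. -/
theorem lintegral_mollify_le_of_tendsto (hθ : IsAveraging θ) {N : ℕ → ℕ} (hN : ∀ j, 0 < N j)
    (hNl : Tendsto N atTop atTop) {r : ℕ → I → X → ℝ} {p : ℕ → I → X → X → ℝ}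
    {ρ : I → X → ℝ} {m : I → X → X → ℝ} {B : ℝ}
    (hr : ∀ j x, Integrable fun t => r j t x) (hp : ∀ j x y, Integrable fun t => p j t x y)
    (hrB : ∀ j x, ∫ t, |r j t x| ≤ B) (hpB : ∀ j x y, 0 < K.Q x y → ∫ t, |p j t x y| ≤ B)
    (hlimr : ∀ x (φ : C(I, ℝ)),
      Tendsto (fun j => ∫ t, φ t * r j t x) atTop (𝓝 (∫ t, φ t * ρ t x)))
    (hlimp : ∀ x y, 0 < K.Q x y → ∀ φ : C(I, ℝ),
      Tendsto (fun j => ∫ t, φ t * p j t x y) atTop (𝓝 (∫ t, φ t * m t x y)))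
    {c : ℝ≥0∞} (hc : ∀ j, ∑ i ∈ Finset.range (N j), K.actionDensity θ
      (fun x => ∫ t in cell (N j) i, r j t x) (fun x y => ∫ t in cell (N j) i, p j t x y) ≤ c)
    (k : ContDiffBump (0 : ℝ)) :
    ∫⁻ s, K.actionDensity θ (fun x => mollify k (fun t => ρ t x) s)
      (fun x y => mollify k (fun t => m t x y) s) ≤ c := by
  set κ := k.normed volume with hκ
  have hκc : Continuous κ := k.continuous_normed
  have h1 : ∀ s, K.actionDensity θ (fun x => mollify k (fun t => ρ t x) s)
      (fun x y => mollify k (fun t => m t x y) s) ≤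
      liminf (fun j => ∑ i ∈ Finset.range (N j), ENNReal.ofReal (κ (s - gridPoint (N j) i)) *
        K.actionDensity θ (fun x => ∫ t in cell (N j) i, r j t x)
          (fun x y => ∫ t in cell (N j) i, p j t x y)) atTop := by
    intro s
    -- The kernel centred at s is the test function: pairing with it gives the mollification at s,
    -- which is also the limit of the Riemann sums of cell masses with weights κ(s − t_i).
    let φ : C(I, ℝ) := ⟨fun t => κ (s - t), by fun_prop⟩
    refine (K.actionDensity_le_liminf hθ
      (ρ' := fun j x => ∑ i ∈ Finset.range (N j), φ (gridPoint (N j) i) *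
        ∫ t in cell (N j) i, r j t x)
      (m' := fun j x y => ∑ i ∈ Finset.range (N j), φ (gridPoint (N j) i) *
        ∫ t in cell (N j) i, p j t x y) (l := atTop)
      (fun x => tendsto_riemannSum hN hNl (fun j => hr j x) (fun j => hrB j x) φ (hlimr x φ))
      (fun x y hQ => tendsto_riemannSum hN hNl (fun j => hp j x y) (fun j => hpB j x y hQ) φ
        (hlimp x y hQ φ))).trans ?_
    refine liminf_le_liminf (Eventually.of_forall fun j => ?_)
    exact K.actionDensity_sum_le hθ _ (fun i _ => k.nonneg_normed _) _ _
  calc _ ≤ _ := lintegral_mono h1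
    _ ≤ liminf (fun j => ∫⁻ s, ∑ i ∈ Finset.range (N j),
        ENNReal.ofReal (κ (s - gridPoint (N j) i)) *
        K.actionDensity θ (fun x => ∫ t in cell (N j) i, r j t x)
          (fun x y => ∫ t in cell (N j) i, p j t x y)) atTop := by
      refine lintegral_liminf_le fun j => Finset.measurable_fun_sum _ fun i _ => ?_
      exact Measurable.mul_const (by fun_prop) _
    _ ≤ c := by
      refine liminf_le_of_le (by isBoundedDefault) fun b hb => ?_
      obtain ⟨j, hj⟩ := hb.exists
      refine hj.trans (le_trans (le_of_eq ?_) (hc j))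
      -- Integration is over all of ℝ, so every translated kernel has mass exactly one and no
      -- boundary terms appear.
      rw [lintegral_finsetSum _ fun i _ => Measurable.mul_const (by fun_prop) _]
      refine Finset.sum_congr rfl fun i _ => ?_
      rw [lintegral_mul_const _ (by fun_prop),
        lintegral_sub_right_eq_self (fun s => ENNReal.ofReal (κ s)),
        ← ofReal_integral_eq_lintegral_ofReal k.integrable_normed
          (Eventually.of_forall fun s => k.nonneg_normed s), k.integral_normed,
        ENNReal.ofReal_one, one_mul]

/-- Lower semicontinuity of the action along time discrete momenta with densities bounded
in `L¹`. -/
theorem action_le_of_tendsto (hθ : IsAveraging θ) {N : ℕ → ℕ} (hN : ∀ j, 0 < N j)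
    (hNl : Tendsto N atTop atTop) {r : ℕ → I → X → ℝ} {p : ℕ → I → X → X → ℝ}
    {ρ : I → X → ℝ} {m : I → X → X → ℝ} {B : ℝ}
    (hr : ∀ j x, Integrable fun t => r j t x) (hp : ∀ j x y, Integrable fun t => p j t x y)
    (hrB : ∀ j x, ∫ t, |r j t x| ≤ B) (hpB : ∀ j x y, 0 < K.Q x y → ∫ t, |p j t x y| ≤ B)
    (hρ : ∀ x, Integrable fun t => ρ t x) (hm : ∀ x y, Integrable fun t => m t x y)
    (hlimr : ∀ x (φ : C(I, ℝ)),
      Tendsto (fun j => ∫ t, φ t * r j t x) atTop (𝓝 (∫ t, φ t * ρ t x)))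
    (hlimp : ∀ x y, 0 < K.Q x y → ∀ φ : C(I, ℝ),
      Tendsto (fun j => ∫ t, φ t * p j t x y) atTop (𝓝 (∫ t, φ t * m t x y)))
    {c : ℝ≥0∞} (hc : ∀ j, ∑ i ∈ Finset.range (N j), K.actionDensity θ
      (fun x => ∫ t in cell (N j) i, r j t x) (fun x y => ∫ t in cell (N j) i, p j t x y) ≤ c) :
    K.action θ ρ m ≤ c := by
  have key := K.lintegral_mollify_le_of_tendsto hθ hN hNl hr hp hrB hpB hlimr hlimp hc
  have hpos : ∀ n : ℕ, (0 : ℝ) < 1 / ((n : ℝ) + 1) := fun n => by positivity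
  -- Outer radius 1/(n+1) and inner radius half of it: the bounded ratio is what Lebesgue
  -- differentiation for bump functions requires.
  obtain ⟨k, hk1, hk2⟩ : ∃ k : ℕ → ContDiffBump (0 : ℝ),
      Tendsto (fun n => (k n).rOut) atTop (𝓝 0) ∧
      ∀ᶠ n in atTop, (k n).rOut ≤ 2 * (k n).rIn :=
    ⟨fun n => ⟨1 / ((n : ℝ) + 1) / 2, 1 / ((n : ℝ) + 1), half_pos (hpos n), half_lt_self (hpos n)⟩,
      tendsto_one_div_add_atTop_nhds_zero_nat,
      Eventually.of_forall fun n => (mul_div_cancel₀ _ two_ne_zero).ge⟩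
  have hae1 : ∀ᵐ s, ∀ x, Tendsto (fun n => mollify (k n) (fun t => ρ t x) s) atTop
      (𝓝 (zeroExtend (fun t => ρ t x) s)) :=
    ae_all_iff.2 fun x => ae_tendsto_mollify hk1 hk2 (hρ x)
  have hae2 : ∀ᵐ s, ∀ x y, Tendsto (fun n => mollify (k n) (fun t => m t x y) s) atTop
      (𝓝 (zeroExtend (fun t => m t x y) s)) :=
    ae_all_iff.2 fun x => ae_all_iff.2 fun y => ae_tendsto_mollify hk1 hk2 (hm x y)
  calc K.action θ ρ m = ∫⁻ t : I, K.actionDensity θ (fun x => zeroExtend (fun t => ρ t x) t)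
        (fun x y => zeroExtend (fun t => m t x y) t) := by
        simp_rw [zeroExtend_coe]
        rfl
    _ ≤ ∫⁻ s, K.actionDensity θ (fun x => zeroExtend (fun t => ρ t x) s)
        (fun x y => zeroExtend (fun t => m t x y) s) :=
        lintegral_unitInterval_le fun s => K.actionDensity θ (fun x => zeroExtend (fun t => ρ t x) s)
          (fun x y => zeroExtend (fun t => m t x y) s)
    _ ≤ ∫⁻ s, liminf (fun n => K.actionDensity θ (fun x => mollify (k n) (fun t => ρ t x) s)
        (fun x y => mollify (k n) (fun t => m t x y) s)) atTop := by
        refine lintegral_mono_ae ?_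
        filter_upwards [hae1, hae2] with s h1 h2
        exact K.actionDensity_le_liminf hθ h1 fun x y _ => h2 x y
    _ ≤ liminf (fun n => ∫⁻ s, K.actionDensity θ (fun x => mollify (k n) (fun t => ρ t x) s)
        (fun x y => mollify (k n) (fun t => m t x y) s)) atTop := by
        refine lintegral_liminf_le fun n => K.measurable_actionDensity_comp hθ (fun x => ?_)
          fun x y => ?_
        · exact (continuous_mollify (k n) (hρ x)).measurable
        · exact (continuous_mollify (k n) (hm x y)).measurable
    _ ≤ c := by
        refine liminf_le_of_le (by isBoundedDefault) fun b hb => ?_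
        obtain ⟨n, hn⟩ := hb.exists
        exact hn.trans (key (k n))

end ReversibleChain


/-! ### Compactness and the liminf inequality. -/

namespace ReversibleChain

variable {X : Type*} [Fintype X] (K : ReversibleChain X) {θ : ℝ → ℝ → ℝ} {ρA ρB : X → ℝ}

theorem exists_density_of_discreteEnergy_le (hθ : IsAveraging θ) {N : ℕ} (hN : 0 < N)
    {v : PathMeasure X} {c : ℝ≥0∞} (hc : c ≠ ⊤) (h : K.discreteEnergy N θ ρA ρB v ≤ c) :
    ∃ r p, v.HasDensity r p ∧ K.IsDiscreteCE N ρA ρB r p ∧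
      ∑ i ∈ Finset.range N, K.actionDensity θ (fun x => ∫ t in cell N i, r t x)
        (fun x y => ∫ t in cell N i, p t x y) ≤ c := by
  unfold discreteEnergy at h
  by_cases hex : ∃ r p, v.HasDensity r p ∧ K.IsDiscreteCE N ρA ρB r p
  · obtain ⟨r, p, hd, hce⟩ := id hex
    refine ⟨r, p, hd, hce, ?_⟩
    rw [if_pos hex, add_zero, K.discreteAction_eq_sum hθ hN] at h
    refine le_trans (le_of_eq (Finset.sum_congr rfl fun i _ => ?_)) h
    congr 1
    · ext x
      rw [(hd.1 x).2, withDensityᵥ_apply (hd.1 x).1 (measurableSet_cell N i)]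
    · ext x y
      rw [(hd.2 x y).2, withDensityᵥ_apply (hd.2 x y).1 (measurableSet_cell N i)]
  · rw [if_neg hex, add_top, top_le_iff] at h
    exact absurd h hc

/-- A negative value at z makes α infinite on an edge at z, which exists as soon as the chain has an
edge at all. -/
theorem nonneg_of_actionDensity_ne_top {x y : X} (hQ : 0 < K.Q x y) {ρ : X → ℝ} {m : X → X → ℝ}
    (h : K.actionDensity θ ρ m ≠ ⊤) (z : X) : 0 ≤ ρ z := by
  obtain ⟨w, hw⟩ := K.exists_pos_of_edge hQ z
  by_contra! hz
  have h1 := K.alpha_mul_le_actionDensity (θ := θ) ρ m z w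
  rw [alpha_of_neg (Or.inl hz), ENNReal.top_mul
    (by simpa using K.Q_mul_π_pos hw), top_le_iff] at h1
  exact ENNReal.mul_ne_top (by simp) h h1

/-- Total mass one and nonnegative cell integrals give ∫ r(z) ≤ C/N on each cell, with C = ∑ 1/π.
For momentum q on a cell, α is then at least (q/N)² · N/C, that is, 1/C times the integral of q²
over the cell. -/
theorem lintegral_sq_le (hθ : IsAveraging θ) (hA : ∑ x, K.π x * ρA x = 1) {N : ℕ} (hN : 0 < N)
    {r : I → X → ℝ} {p : I → X → X → ℝ} (hr : ∀ x, Integrable fun t => r t x)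
    (hp : ∀ x y, Integrable fun t => p t x y) (hce : K.IsDiscreteCE N ρA ρB r p) {c : ℝ≥0∞}
    (hc : c ≠ ⊤) (h : ∑ i ∈ Finset.range N, K.actionDensity θ (fun x => ∫ t in cell N i, r t x)
        (fun x y => ∫ t in cell N i, p t x y) ≤ c) {x y : X} (hQ : 0 < K.Q x y) :
    ∫⁻ t, ENNReal.ofReal (p t x y ^ 2) ≤
      ENNReal.ofReal (∑ z, 1 / K.π z) * (2 * c / ENNReal.ofReal (K.Q x y * K.π x)) := by
  have hN' : (0 : ℝ) < N := by exact_mod_cast hN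
  set C := ∑ z, 1 / K.π z with hC
  have hCz : ∀ z, 1 / K.π z ≤ C := fun z =>
    Finset.single_le_sum (f := fun z => 1 / K.π z) (fun z _ => (one_div_pos.2 (K.π_pos z)).le)
      (Finset.mem_univ z)
  have hC0 : 0 < C := (one_div_pos.2 (K.π_pos x)).trans_le (hCz x)
  have hw := K.Q_mul_π_pos hQ
  have hne : ∀ i ∈ Finset.range N, K.actionDensity θ (fun x => ∫ t in cell N i, r t x)
      (fun x y => ∫ t in cell N i, p t x y) ≠ ⊤ := fun i hi =>
    ((Finset.single_le_sum (f := fun i => K.actionDensity θ (fun x => ∫ t in cell N i, r t x)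
      (fun x y => ∫ t in cell N i, p t x y)) (fun _ _ => zero_le) hi).trans_lt
      (h.trans_lt hc.lt_top)).ne
  have hsum : ∀ i ∈ Finset.range N, ∑ z, K.π z * ∫ t in cell N i, r t z = 1 / N := by
    intro i hi
    simp_rw [← integral_const_mul]
    rw [← integral_finsetSum _ fun z _ => ((hr z).const_mul _).integrableOn]
    exact setIntegral_cell_eq (Finset.mem_range.1 hi) fun t _ =>
      hce.sum_π_mul hA hN (fun x y _ => hp x y) t
  have hup : ∀ i ∈ Finset.range N, ∀ z, ∫ t in cell N i, r t z ≤ C / N := by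
    intro i hi z
    have h1 : K.π z * ∫ t in cell N i, r t z ≤ 1 / N := by
      rw [← hsum i hi]
      exact Finset.single_le_sum (f := fun z => K.π z * ∫ t in cell N i, r t z)
        (fun z _ => mul_nonneg (K.π_pos z).le
          (K.nonneg_of_actionDensity_ne_top hQ (hne i hi) z)) (Finset.mem_univ z)
    rw [← le_div_iff₀' (K.π_pos z)] at h1
    calc _ ≤ 1 / (N : ℝ) / K.π z := h1
      _ = 1 / K.π z / N := by field_simp
      _ ≤ C / N := by gcongr; exact hCz z
  rw [lintegral_eq_sum_cell hN]
  calc ∑ i ∈ Finset.range N, ∫⁻ t in cell N i, ENNReal.ofReal (p t x y ^ 2)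
      ≤ ∑ i ∈ Finset.range N, ENNReal.ofReal C * (2 * K.actionDensity θ
        (fun x => ∫ t in cell N i, r t x) (fun x y => ∫ t in cell N i, p t x y) /
          ENNReal.ofReal (K.Q x y * K.π x)) := by
        refine Finset.sum_le_sum fun i hi => ?_
        have hi' := Finset.mem_range.1 hi
        have hpc : ∀ t ∈ cell N i, p t x y = p (gridPoint N i) x y := fun t ht => by
          rw [hce.2.1.eq_gridPoint hi' ht]
        rw [setLIntegral_cell_eq hi' (c := ENNReal.ofReal (p (gridPoint N i) x y ^ 2))
          fun t ht => by rw [hpc t ht]]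
        have h1 := K.alpha_mul_le_actionDensity (θ := θ) (fun x => ∫ t in cell N i, r t x)
          (fun x y => ∫ t in cell N i, p t x y) x y
        rw [← ENNReal.le_div_iff_mul_le (Or.inl (by simpa using hw)) (Or.inl (by simp))] at h1
        refine le_trans ?_ (mul_le_mul_right h1 _)
        refine le_trans ?_ (mul_le_mul_right (ofReal_sq_div_le_alpha hθ (div_pos hC0 hN')
          (hup i hi x) (hup i hi y) _) _)
        rw [← ENNReal.ofReal_mul hC0.le, ← ENNReal.ofReal_mul (by positivity),
          setIntegral_cell_eq hi' hpc]
        apply ENNReal.ofReal_le_ofReal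
        apply le_of_eq
        field_simp
    _ ≤ _ := by
        rw [← Finset.mul_sum]
        simp_rw [div_eq_mul_inv]
        rw [← Finset.sum_mul, ← Finset.mul_sum]
        gcongr

/-- The action controls only cell averages of r. Pointwise bounds come in a second step: the L²
bounds on the edges bound div p in L¹, and r differs from `ρA` by the time integral of div p. -/
theorem exists_uniform_bounds (hθ : IsAveraging θ) (hA : ∑ x, K.π x * ρA x = 1) {c : ℝ≥0∞}
    (hc : c ≠ ⊤) :
    ∃ B : ℝ, 0 ≤ B ∧ ∀ (N : ℕ) (r : I → X → ℝ) (p : I → X → X → ℝ), 0 < N →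
      (∀ x, Integrable fun t => r t x) → (∀ x y, Integrable fun t => p t x y) →
      K.IsDiscreteCE N ρA ρB r p →
      ∑ i ∈ Finset.range N, K.actionDensity θ (fun x => ∫ t in cell N i, r t x)
        (fun x y => ∫ t in cell N i, p t x y) ≤ c →
      (∀ t x, |r t x| ≤ B) ∧
      ∀ x y, 0 < K.Q x y → (Integrable fun t => p t x y ^ 2) ∧ ∫ t, p t x y ^ 2 ≤ B := by
  set b : X → X → ℝ := fun x y =>
    (ENNReal.ofReal (∑ z, 1 / K.π z) * (2 * c / ENNReal.ofReal (K.Q x y * K.π x))).toReal with hb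
  have hb0 : ∀ x y, 0 ≤ b x y := fun x y => ENNReal.toReal_nonneg
  set B₁ := ∑ x, ∑ y, b x y with hB₁
  have hB₁0 : 0 ≤ B₁ := Finset.sum_nonneg fun x _ => Finset.sum_nonneg fun y _ => hb0 x y
  have hbB : ∀ x y, b x y ≤ B₁ := fun x y =>
    (Finset.single_le_sum (f := fun y => b x y) (fun y _ => hb0 x y) (Finset.mem_univ y)).trans
      (Finset.single_le_sum (f := fun x => ∑ y, b x y)
        (fun x _ => Finset.sum_nonneg fun y _ => hb0 x y) (Finset.mem_univ x))
  -- Since |p| ≤ 1 + p², each edge momentum has L¹ norm at most 1 + B₁; `R` is the resulting sup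
  -- bound for r.
  set R : X → ℝ := fun x => |ρA x| + ∑ y, K.Q x y * (1 + B₁) with hR
  have hR0 : ∀ x, 0 ≤ R x := fun x => add_nonneg (abs_nonneg _)
    (Finset.sum_nonneg fun y _ => mul_nonneg (K.Q_nonneg x y) (by linarith))
  have hRsum : ∀ x, R x ≤ ∑ x, R x := fun x =>
    Finset.single_le_sum (fun x _ => hR0 x) (Finset.mem_univ x)
  refine ⟨∑ x, R x + B₁, add_nonneg (Finset.sum_nonneg fun x _ => hR0 x) hB₁0,
    fun N r p hN hr hp hce h => ?_⟩
  have hsq : ∀ x y, 0 < K.Q x y →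
      (Integrable fun t => p t x y ^ 2) ∧ ∫ t, p t x y ^ 2 ≤ B₁ := by
    intro x y hQ
    have h1 := K.lintegral_sq_le hθ hA hN hr hp hce hc h hQ
    have htop : ENNReal.ofReal (∑ z, 1 / K.π z) *
        (2 * c / ENNReal.ofReal (K.Q x y * K.π x)) ≠ ⊤ :=
      ENNReal.mul_ne_top ENNReal.ofReal_ne_top (ENNReal.div_ne_top
        (ENNReal.mul_ne_top (by simp) hc) (by simpa using K.Q_mul_π_pos hQ))
    have hmeas : AEStronglyMeasurable fun t => p t x y ^ 2 :=
      (hp x y).aestronglyMeasurable.pow 2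
    have hnn : 0 ≤ᵐ[volume] fun t => p t x y ^ 2 := Eventually.of_forall fun t => sq_nonneg _
    refine ⟨⟨hmeas, ?_⟩, ?_⟩
    · rw [hasFiniteIntegral_iff_ofReal hnn]
      exact h1.trans_lt htop.lt_top
    · rw [integral_eq_lintegral_of_nonneg_ae hnn hmeas]
      exact (ENNReal.toReal_mono htop h1).trans (hbB x y)
  refine ⟨fun t x => ?_, fun x y hQ => ⟨(hsq x y hQ).1, (hsq x y hQ).2.trans ?_⟩⟩
  · have hp' : ∀ x y, 0 < K.Q x y → Integrable fun t => p t x y := fun x y _ => hp x y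
    refine (hce.abs_le hN hp' x t).trans ?_
    suffices ∫ s, |K.div (p s) x| ≤ ∑ y, K.Q x y * (1 + B₁) by linarith [hRsum x]
    have hL1 : ∀ x y, 0 < K.Q x y → ∫ t, |p t x y| ≤ 1 + B₁ := fun x y hQ =>
      abs_le_of_sq_integral (hp x y) (hsq x y hQ).1 (hsq x y hQ).2
    have hint : ∀ y, Integrable fun s => K.Q x y * (1 / 2 * (|p s y x| + |p s x y|)) := fun y =>
      (((hp y x).abs.add (hp x y).abs).const_mul _).const_mul _
    calc ∫ s, |K.div (p s) x| ≤ ∫ s, ∑ y, K.Q x y * (1 / 2 * (|p s y x| + |p s x y|)) := by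
          refine integral_mono (IsDiscreteCE.integrable_div hp' x).abs
            (integrable_finsetSum _ fun y _ => hint y) fun s => ?_
          simp only [div]
          rw [Finset.mul_sum]
          refine (Finset.abs_sum_le_sum_abs _ _).trans (Finset.sum_le_sum fun y _ => ?_)
          rw [abs_mul, abs_mul, abs_of_nonneg (K.Q_nonneg x y), abs_of_pos (by norm_num :
            (0 : ℝ) < 1 / 2), mul_left_comm]
          have := abs_sub (p s y x) (p s x y)
          have hq := K.Q_nonneg x y
          gcongr
      _ = ∑ y, K.Q x y * (1 / 2 * ((∫ s, |p s y x|) + ∫ s, |p s x y|)) := by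
          rw [integral_finsetSum _ fun y _ => hint y]
          refine Finset.sum_congr rfl fun y _ => ?_
          rw [integral_const_mul, integral_const_mul, integral_add (hp y x).abs (hp x y).abs]
      _ ≤ ∑ y, K.Q x y * (1 + B₁) := by
          refine Finset.sum_le_sum fun y _ => ?_
          by_cases hQ : 0 < K.Q x y
          · have h1 := hL1 x y hQ
            have h2 := hL1 y x (K.Q_pos_comm.1 hQ)
            refine mul_le_mul_of_nonneg_left ?_ hQ.le
            linarith
          · simp [K.Q_eq_zero_of_not_pos hQ]
  · linarith [Finset.sum_nonneg fun x (_ : x ∈ Finset.univ) => hR0 x]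

theorem integral_innerV_add_innerE {r : I → X → ℝ} {p : I → X → X → ℝ}
    (hr : ∀ x, Integrable fun t => r t x) (hp : ∀ x y, 0 < K.Q x y → Integrable fun t => p t x y)
    {f g : I → X → ℝ} (hf : Continuous f) (hg : Continuous g) :
    ∫ t, (K.innerV (f t) (r t) + K.innerE (grad (g t)) (p t)) =
      ∑ x, (∫ t, f t x * r t x) * K.π x +
      (1 / 2) * ∑ x, ∑ y, (∫ t, (g t x - g t y) * p t x y) * K.Q x y * K.π x := by
  have hbdd : ∀ {φ : I → ℝ}, Continuous φ → ∀ {u : I → ℝ}, Integrable u →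
      Integrable fun t => φ t * u t := fun {φ} hφ {u} hu => by
    obtain ⟨C, -, hC⟩ := ContinuousMap.exists_abs_le ⟨φ, hφ⟩
    exact hu.bdd_mul hφ.measurable.aestronglyMeasurable (Eventually.of_forall hC)
  have h1 : ∀ x, Integrable fun t => f t x * r t x * K.π x := fun x =>
    (hbdd (by fun_prop) (hr x)).mul_const _
  have h2 : ∀ x y, Integrable fun t => (g t x - g t y) * p t x y * K.Q x y * K.π x := fun x y => by
    by_cases hQ : 0 < K.Q x y
    · exact ((hbdd (φ := fun t => g t x - g t y) (by fun_prop) (hp x y hQ)).mul_const _).mul_const _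
    · simp [K.Q_eq_zero_of_not_pos hQ]
  unfold innerV innerE grad
  rw [integral_add (integrable_finsetSum _ fun x _ => h1 x)
    ((integrable_finsetSum _ fun x _ => integrable_finsetSum _ fun y _ => h2 x y).const_mul _),
    integral_finsetSum _ fun x _ => h1 x, integral_const_mul,
    integral_finsetSum _ fun x _ => integrable_finsetSum _ fun y _ => h2 x y]
  simp_rw [integral_finsetSum _ fun y _ => h2 _ y, integral_mul_const]

theorem energy_le_of_tendsto (hθ : IsAveraging θ) (hA : ∑ x, K.π x * ρA x = 1) {N : ℕ → ℕ}
    (hN : ∀ j, 0 < N j) (hNl : Tendsto N atTop atTop) {w : ℕ → PathMeasure X} {u : PathMeasure X}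
    (hw : Tendsto w atTop (𝓝 u)) {c : ℝ≥0∞} (hc : c ≠ ⊤)
    (h : ∀ j, K.discreteEnergy (N j) θ ρA ρB (w j) ≤ c) : K.energy θ ρA ρB u ≤ c := by
  choose r p hd hce hact using fun j => K.exists_density_of_discreteEnergy_le hθ (hN j) hc (h j)
  obtain ⟨B, hB0, hB⟩ := K.exists_uniform_bounds (ρB := ρB) hθ hA hc
  have hr : ∀ j x, Integrable fun t => r j t x := fun j x => ((hd j).1 x).1
  have hp : ∀ j x y, Integrable fun t => p j t x y := fun j x y => ((hd j).2 x y).1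
  have hrB : ∀ j t x, |r j t x| ≤ B := fun j =>
    (hB (N j) (r j) (p j) (hN j) (hr j) (hp j) (hce j) (hact j)).1
  have hpB : ∀ j x y, 0 < K.Q x y → (Integrable fun t => p j t x y ^ 2) ∧
      ∫ t, p j t x y ^ 2 ≤ B := fun j =>
    (hB (N j) (r j) (p j) (hN j) (hr j) (hp j) (hce j) (hact j)).2
  have hpair : ∀ (φ : C(I, ℝ)) {f : I → ℝ}, Integrable f →
      ∫ᵛ t, φ t ∂•(volume.withDensityᵥ f) = ∫ t, φ t * f t := fun φ f hf => by
    obtain ⟨C, -, hC⟩ := φ.exists_abs_le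
    exact SignedMeasure.integral_withDensityᵥ hf φ.continuous.measurable hC
  rw [PathMeasure.tendsto_nhds_iff_components] at hw
  have hlimr : ∀ x (φ : C(I, ℝ)), Tendsto (fun j => ∫ t, φ t * r j t x) atTop
      (𝓝 (∫ᵛ t, φ t ∂•(u.ρ x))) := fun x φ => by
    refine (hw.1 x φ).congr fun j => ?_
    rw [((hd j).1 x).2, hpair φ (hr j x)]
  have hlimp : ∀ x y (φ : C(I, ℝ)), Tendsto (fun j => ∫ t, φ t * p j t x y) atTop
      (𝓝 (∫ᵛ t, φ t ∂•(u.m x y))) := fun x y φ => by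
    refine (hw.2 x y φ).congr fun j => ?_
    rw [((hd j).2 x y).2, hpair φ (hp j x y)]
  have hr2 : ∀ j x, Integrable fun t => r j t x ^ 2 := fun j x =>
    Integrable.of_bound ((hr j x).aestronglyMeasurable.pow 2) (B ^ 2)
      (Eventually.of_forall fun t => by
        rw [Real.norm_eq_abs, abs_pow]
        exact pow_le_pow_left₀ (abs_nonneg _) (hrB j t x) 2)
  have hr2B : ∀ j x, ∫ t, r j t x ^ 2 ≤ B ^ 2 := fun j x => by
    refine (integral_mono (hr2 j x) (integrable_const (B ^ 2)) fun t => ?_).trans (by simp)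
    simp only
    rw [← sq_abs]
    exact pow_le_pow_left₀ (abs_nonneg _) (hrB j t x) 2
  have hacρ : ∀ x, u.ρ x ≪ᵥ (volume : Measure I).toENNRealVectorMeasure := fun x =>
    absolutelyContinuous_of_tendsto (fun j => hr j x) (fun j => hr2 j x) (fun j => hr2B j x)
      (hlimr x)
  have hacm : ∀ x y, 0 < K.Q x y → u.m x y ≪ᵥ (volume : Measure I).toENNRealVectorMeasure :=
    fun x y hQ => absolutelyContinuous_of_tendsto (fun j => hp j x y)
      (fun j => (hpB j x y hQ).1) (fun j => (hpB j x y hQ).2) (hlimp x y)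
  set ρ : I → X → ℝ := fun t x => (u.ρ x).rnDeriv volume t with hρ
  set m : I → X → X → ℝ := fun t x y => (u.m x y).rnDeriv volume t with hm
  have hρi : ∀ x, Integrable fun t => ρ t x := fun x => SignedMeasure.integrable_rnDeriv _ _
  have hmi : ∀ x y, Integrable fun t => m t x y := fun x y => SignedMeasure.integrable_rnDeriv _ _
  have hlimr' : ∀ x (φ : C(I, ℝ)), Tendsto (fun j => ∫ t, φ t * r j t x) atTop
      (𝓝 (∫ t, φ t * ρ t x)) := fun x φ => by
    rw [← hpair φ (hρi x)]
    simp only [hρ]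
    rw [SignedMeasure.withDensityᵥ_rnDeriv_eq _ _ (hacρ x)]
    exact hlimr x φ
  have hlimp' : ∀ x y, 0 < K.Q x y → ∀ (φ : C(I, ℝ)),
      Tendsto (fun j => ∫ t, φ t * p j t x y) atTop (𝓝 (∫ t, φ t * m t x y)) := fun x y hQ φ => by
    rw [← hpair φ (hmi x y)]
    simp only [hm]
    rw [SignedMeasure.withDensityᵥ_rnDeriv_eq _ _ (hacm x y hQ)]
    exact hlimp x y φ
  have hIsCE : K.IsCE ρA ρB ρ m := by
    refine ⟨measurable_pi_lambda _ fun x => SignedMeasure.measurable_rnDeriv _ _,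
      measurable_pi_lambda _ fun x => measurable_pi_lambda _ fun y =>
        SignedMeasure.measurable_rnDeriv _ _, hρi, fun x y _ => hmi x y, fun φ hφ => ?_⟩
    have hg : Continuous fun t : I => φ t := hφ.continuousOn.domRestrict
    have hf : Continuous fun t : I => derivWithin φ (Set.Icc 0 1) (t : ℝ) :=
      (hφ.continuousOn_derivWithin uniqueDiffOn_Icc_zero_one le_rfl).domRestrict
    rw [K.integral_innerV_add_innerE hρi (fun x y _ => hmi x y) hf hg]
    -- Every discrete pair satisfies the weak equation with the same right-hand side, so the limit
    -- does too.
    have hconst : ∀ j, ∑ x, (∫ t : I, derivWithin φ (Set.Icc 0 1) (t : ℝ) x * r j t x) * K.π x +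
        (1 / 2) * ∑ x, ∑ y, (∫ t : I, (φ t x - φ t y) * p j t x y) * K.Q x y * K.π x =
        K.innerV (φ 1) ρB - K.innerV (φ 0) ρA := fun j => by
      rw [← K.integral_innerV_add_innerE (hr j) (fun x y _ => hp j x y) hf hg]
      exact (hce j).integral_eq (hN j) (fun x y _ => hp j x y) hφ
    refine tendsto_nhds_unique (Tendsto.add (tendsto_finsetSum _ fun x _ => Tendsto.mul_const _
      (hlimr' x ⟨fun t => derivWithin φ (Set.Icc 0 1) (t : ℝ) x, by fun_prop⟩))
      (Tendsto.const_mul _ (tendsto_finsetSum _ fun x _ => tendsto_finsetSum _ fun y _ => ?_)))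
      ((tendsto_const_nhds (x := K.innerV (φ 1) ρB - K.innerV (φ 0) ρA)).congr
        fun j => (hconst j).symm)
    by_cases hQ : 0 < K.Q x y
    · exact ((hlimp' x y hQ ⟨fun t => φ t x - φ t y,
        ((continuous_apply x).comp hg).sub ((continuous_apply y).comp hg)⟩).mul_const _).mul_const _
    · simp [K.Q_eq_zero_of_not_pos hQ]
  have hL1r : ∀ j x, ∫ t, |r j t x| ≤ 1 + B + B ^ 2 := fun j x => by
    have := abs_le_of_sq_integral (hr j x) (hr2 j x) (hr2B j x)
    linarith
  have hL1p : ∀ j x y, 0 < K.Q x y → ∫ t, |p j t x y| ≤ 1 + B + B ^ 2 := fun j x y hQ => by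
    have := abs_le_of_sq_integral (hp j x y) (hpB j x y hQ).1 (hpB j x y hQ).2
    nlinarith [sq_nonneg B]
  unfold energy pathEnergy
  rw [if_pos ⟨hacρ, hacm⟩, if_pos hIsCE, add_zero]
  exact K.action_le_of_tendsto hθ hN hNl hr hp hL1r hL1p hρi hmi hlimr' hlimp' hact

/-- Below any level above the liminf lie the energies of a subsequence of positive N; the
bounded-energy statement is applied to it. -/
theorem energy_le_liminf (hθ : IsAveraging θ) (hA : ∑ x, K.π x * ρA x = 1) {v : ℕ → PathMeasure X}
    {u : PathMeasure X} (hv : Tendsto v atTop (𝓝 u)) :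
    K.energy θ ρA ρB u ≤ liminf (fun N => K.discreteEnergy N θ ρA ρB (v N)) atTop := by
  refine le_of_forall_gt fun c hc => ?_
  obtain ⟨d, hd1, hd2⟩ := exists_between hc
  have hfreq : ∃ᶠ N in atTop, K.discreteEnergy N θ ρA ρB (v N) < d :=
    frequently_lt_of_liminf_lt (by isBoundedDefault) hd1
  obtain ⟨N, hNmono, hN⟩ := extraction_of_frequently_atTop
    (hfreq.and_eventually (eventually_gt_atTop 0))
  exact (K.energy_le_of_tendsto hθ hA (fun j => (hN j).2) hNmono.tendsto_atTop
    (hv.comp hNmono.tendsto_atTop) hd2.ne_top fun j => (hN j).1.le).trans_lt hd2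

end ReversibleChain


theorem ae_eq_of_integral_mul_eq {f g : I → ℝ} (hf : Integrable f) (hg : Integrable g)
    (h : ∀ φ : ℝ → ℝ, Continuous φ → ∫ t : I, φ t * f t = ∫ t : I, φ t * g t) : f =ᵐ[volume] g := by
  have hpos : ∀ n : ℕ, (0 : ℝ) < 1 / ((n : ℝ) + 1) := fun n => by positivity
  obtain ⟨k, hk1, hk2⟩ : ∃ k : ℕ → ContDiffBump (0 : ℝ),
      Tendsto (fun n => (k n).rOut) atTop (𝓝 0) ∧
      ∀ᶠ n in atTop, (k n).rOut ≤ 2 * (k n).rIn :=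
    ⟨fun n => ⟨1 / ((n : ℝ) + 1) / 2, 1 / ((n : ℝ) + 1), half_pos (hpos n), half_lt_self (hpos n)⟩,
      tendsto_one_div_add_atTop_nhds_zero_nat,
      Eventually.of_forall fun n => (mul_div_cancel₀ _ two_ne_zero).ge⟩
  -- Equal pairings give equal mollifications, and these converge almost everywhere to the two
  -- functions.
  have heq : ∀ n, mollify (k n) f = mollify (k n) g := fun n => by
    ext s
    have := (k n).continuous_normed (μ := volume)
    exact h (fun t => (k n).normed volume (s - t)) (by fun_prop)
  have hae : ∀ᵐ s, zeroExtend f s = zeroExtend g s := by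
    filter_upwards [ae_tendsto_mollify hk1 hk2 hf, ae_tendsto_mollify hk1 hk2 hg] with s h1 h2
    simp_rw [heq] at h1
    exact tendsto_nhds_unique h1 h2
  have hae' : ∀ᵐ s ∂(volume.restrict (Set.Icc (0 : ℝ) 1)), zeroExtend f s = zeroExtend g s :=
    ae_restrict_of_ae hae
  rw [← map_comap_subtype_coe measurableSet_Icc volume,
    (MeasurableEmbedding.subtype_coe measurableSet_Icc).ae_map_iff] at hae'
  filter_upwards [hae'] with t ht
  rwa [zeroExtend_coe, zeroExtend_coe] at ht

theorem setIntegral_cell_eq_intervalIntegral {N i : ℕ} (hi : i < N) (F : ℝ → ℝ) :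
    ∫ t in cell N i, F t = ∫ s in ((i : ℝ) / N)..(((i : ℝ) + 1) / N), F s := by
  have hN : (0 : ℝ) < N := by exact_mod_cast (Nat.zero_le i).trans_lt hi
  have hsub : Set.Ico ((i : ℝ) / N) (((i : ℝ) + 1) / N) ⊆ Set.Icc 0 1 := by
    refine fun s hs => ⟨le_trans (by positivity) hs.1, hs.2.le.trans ?_⟩
    rw [div_le_one hN]
    exact_mod_cast hi
  have h : cell N i = ((↑) : I → ℝ) ⁻¹' Set.Ico ((i : ℝ) / N) (((i : ℝ) + 1) / N) := rfl
  rw [intervalIntegral.integral_of_le (by gcongr; linarith), ← integral_Ico_eq_integral_Ioc, h,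
    ← integral_indicator measurableSet_Ico,
    ← integral_indicator (measurable_subtype_coe measurableSet_Ico)]
  have h2 : ∀ t : I, (((↑) : I → ℝ) ⁻¹' Set.Ico ((i : ℝ) / N) (((i : ℝ) + 1) / N)).indicator
      (fun t : I => F t) t = (Set.Ico ((i : ℝ) / N) (((i : ℝ) + 1) / N)).indicator F t :=
    fun t => rfl
  simp_rw [h2]
  rw [← setIntegral_Icc_eq_integral_unitInterval, setIntegral_indicator measurableSet_Ico,
    Set.inter_eq_right.2 hsub, integral_indicator measurableSet_Ico]

/-! ### The range of the divergence. -/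

namespace ReversibleChain

variable {X : Type*} [Fintype X] (K : ReversibleChain X) {ρA ρB : X → ℝ}

/-- The divergence as a linear map. -/
def divLinear : (X → X → ℝ) →ₗ[ℝ] X → ℝ where
  toFun := K.div
  map_add' Φ Ψ := by
    ext x
    simp only [div, Pi.add_apply, ← mul_add, ← Finset.sum_add_distrib]
    congr 1
    exact Finset.sum_congr rfl fun y _ => by ring
  map_smul' c Φ := by
    ext x
    simp only [div, Pi.smul_apply, smul_eq_mul, RingHom.id_apply, Finset.mul_sum]
    exact Finset.sum_congr rfl fun y _ => by ring

-- A flow along one edge transports a normalised point mass from b to c; telescoping along a path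
-- given by irreducibility joins any two vertices.
open Classical in
theorem single_sub_single_mem_range {a b : X} :
    (Pi.single b (1 / K.π b) - Pi.single a (1 / K.π a) : X → ℝ) ∈ LinearMap.range K.divLinear := by
  induction K.irreducible a b with
  | refl => simp
  | @tail b c _ hbc ih =>
    have hbc : 0 < K.Q b c := hbc
    have hne : b ≠ c := fun h => by rw [h, K.Q_diag] at hbc; exact lt_irrefl _ hbc
    have h1 : (Pi.single c (1 / K.π c) - Pi.single b (1 / K.π b) : X → ℝ) ∈
        LinearMap.range K.divLinear := by
      -- The 2 cancels the factor 1/2 in the divergence, and detailed balance turns the weight into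
      -- 1/π(c) at the other end.
      refine ⟨Pi.single b (Pi.single c (2 / (K.π b * K.Q b c))), ?_⟩
      have hπb := (K.π_pos b).ne'
      have hπc := (K.π_pos c).ne'
      have hdb := K.detailed_balance b c
      ext x
      change K.div _ x = _
      have hval : ∀ x y, (Pi.single b (Pi.single c (2 / (K.π b * K.Q b c))) : X → X → ℝ) x y =
          if x = b ∧ y = c then 2 / (K.π b * K.Q b c) else 0 := fun x y => by
        by_cases hx : x = b
        · subst hx
          by_cases hy : y = c
          · subst hy; simp
          · simp [hy]
        · simp [hx]
      simp only [div, hval]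
      by_cases hx : x = c
      · subst hx
        rw [Finset.sum_eq_single b]
        · simp only [and_self, if_true, Ne.symm hne, false_and, if_false, Pi.sub_apply,
            Pi.single_eq_same, Pi.single_eq_of_ne (Ne.symm hne)]
          rw [hdb]
          have : K.Q x b ≠ 0 := (K.Q_pos_comm.1 hbc).ne'
          field_simp
          ring
        · intro y _ hy
          simp [hy, Ne.symm hne]
        · simp
      · by_cases hxb : x = b
        · subst hxb
          rw [Finset.sum_eq_single c]
          · simp only [and_self, if_true, hne, and_false, if_false, Pi.sub_apply,
              Pi.single_eq_same, Pi.single_eq_of_ne hne]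
            field_simp
            ring
          · intro y _ hy
            simp [hy, hne]
          · simp
        · simp [hx, hxb]
    have := add_mem ih h1
    rwa [sub_add_sub_comm, add_comm, add_sub_add_right_eq_sub] at this

/-- By irreducibility, every function of mean zero is a divergence. -/
theorem exists_div_eq {f : X → ℝ} (hf : ∑ x, K.π x * f x = 0) : ∃ Ψ, K.div Ψ = f := by
  classical
  suffices f ∈ LinearMap.range K.divLinear from this
  rcases isEmpty_or_nonempty X with h | ⟨⟨a⟩⟩
  · rw [Subsingleton.elim f 0]
    exact zero_mem _
  have h1 : f = ∑ x, (K.π x * f x) •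
      (Pi.single x (1 / K.π x) - Pi.single a (1 / K.π a) : X → ℝ) := by
    simp_rw [smul_sub, Finset.sum_sub_distrib, ← Finset.sum_smul, hf, zero_smul, sub_zero]
    ext z
    rw [Finset.sum_apply, Finset.sum_eq_single z]
    · have := (K.π_pos z).ne'
      simp
      field_simp
    · intro y _ hy
      simp [Pi.single_eq_of_ne hy.symm]
    · simp
  rw [h1]
  exact Submodule.sum_mem _ fun x _ => Submodule.smul_mem _ _ K.single_sub_single_mem_range

/-! ### Continuous representatives of solutions. -/

namespace IsCE

variable {K} {ρ : I → X → ℝ} {m : I → X → X → ℝ}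

theorem integrable_div (h : K.IsCE ρA ρB ρ m) (x : X) : Integrable fun t => K.div (m t) x :=
  IsDiscreteCE.integrable_div h.2.2.2.1 x

theorem integral_single (h : K.IsCE ρA ρB ρ m) (x : X) {ψ g : ℝ → ℝ} (hg : Continuous g)
    (hψ : ∀ s, HasDerivAt ψ (g s) s) :
    (∫ t : I, g t * ρ t x) - ∫ t : I, ψ t * K.div (m t) x = ψ 1 * ρB x - ψ 0 * ρA x := by
  classical
  have hψc : Continuous ψ := continuous_iff_continuousAt.2 fun s => (hψ s).continuousAt
  have hd : ∀ s, HasDerivAt (fun s => (Pi.single x (ψ s) : X → ℝ)) (Pi.single x (g s)) s := by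
    intro s
    rw [hasDerivAt_pi]
    intro y
    by_cases hy : y = x
    · subst hy
      simpa using hψ s
    · simpa [Pi.single_eq_of_ne hy] using hasDerivAt_const s (0 : ℝ)
  have hC1 : ContDiff ℝ 1 fun s => (Pi.single x (ψ s) : X → ℝ) := by
    rw [contDiff_one_iff_deriv]
    refine ⟨fun s => (hd s).differentiableAt, ?_⟩
    rw [show deriv (fun s => (Pi.single x (ψ s) : X → ℝ)) = fun s => Pi.single x (g s) from
      funext fun s => (hd s).deriv]
    exact (continuous_single x).comp hg
  have h1 := h.2.2.2.2 _ hC1.contDiffOn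
  have hdw : ∀ t : I, derivWithin (fun s => (Pi.single x (ψ s) : X → ℝ)) (Set.Icc 0 1) (t : ℝ) =
      Pi.single x (g t) := fun t =>
    (hd t).hasDerivWithinAt.derivWithin (uniqueDiffOn_Icc_zero_one t t.2)
  have hV : ∀ (c : ℝ) (f : X → ℝ), K.innerV (Pi.single x c) f = c * f x * K.π x := by
    intro c f
    unfold innerV
    rw [Finset.sum_eq_single x]
    · simp
    · intro y _ hy
      simp [Pi.single_eq_of_ne hy]
    · simp
  simp_rw [hdw, K.innerE_grad, hV] at h1
  have hb : ∀ {φ : ℝ → ℝ}, Continuous φ → ∀ {u : I → ℝ}, Integrable u →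
      Integrable fun t : I => φ t * u t := fun {φ} hφ {u} hu => by
    obtain ⟨C, -, hC⟩ := ContinuousMap.exists_abs_le ⟨fun t : I => φ t, by fun_prop⟩
    exact hu.bdd_mul (f := fun t : I => φ t) (by
      exact (hφ.measurable.comp measurable_subtype_coe).aestronglyMeasurable)
      (Eventually.of_forall hC)
  simp_rw [← sub_eq_add_neg] at h1
  rw [integral_sub ((hb hg (h.2.2.1 x)).mul_const _)
    ((hb hψc (h.integrable_div x)).mul_const _), integral_mul_const, integral_mul_const] at h1
  have hπ := (K.π_pos x).ne'
  apply mul_right_cancel₀ hπ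
  linarith

/-- Solutions of the continuity equation have a representative that is absolutely continuous in
time and attains the boundary values. -/
theorem exists_continuous_representative (h : K.IsCE ρA ρB ρ m) :
    ∃ R : I → X → ℝ, Continuous R ∧ R 0 = ρA ∧ R 1 = ρB ∧ (∀ x, ∀ᵐ t, ρ t x = R t x) ∧
      ∀ M j, j < M → ∀ x, R (gridPoint M (j + 1)) x - R (gridPoint M j) x =
        -∫ t in cell M j, K.div (m t) x := by
  set D : X → ℝ → ℝ := fun x => Set.IccExtend (zero_le_one' ℝ) fun t => K.div (m t) x with hD
  have hDi : ∀ x, IntervalIntegrable (D x) volume 0 1 := fun x =>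
    intervalIntegrable_IccExtend (h.integrable_div x)
  have hDsub : ∀ x (a b : ℝ), a ∈ Set.Icc (0 : ℝ) 1 → b ∈ Set.Icc (0 : ℝ) 1 →
      IntervalIntegrable (D x) volume a b := fun x a b ha hb =>
    (hDi x).mono_set (by
      rw [Set.uIcc_of_le zero_le_one]
      exact Set.uIcc_subset_Icc ha hb)
  -- The representative is `ρA` − F. It starts at `ρA` by construction; testing the equation with
  -- constants shows that it ends at `ρB`.
  set F : X → ℝ → ℝ := fun x s => ∫ u in (0 : ℝ)..s, D x u with hF
  have hFac : ∀ x, AbsolutelyContinuousOnInterval (F x) 0 1 := fun x =>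
    (hDi x).absolutelyContinuousOnInterval_intervalIntegral (by simp)
  have hF1 : ∀ x, F x 1 = ρA x - ρB x := fun x => by
    have h1 := h.integral_single x (ψ := fun _ => 1) (g := fun _ => 0) continuous_const
      fun s => hasDerivAt_const s 1
    simp only [zero_mul, integral_zero, one_mul] at h1
    simp only [hF, hD]
    rw [intervalIntegral_IccExtend]
    linarith
  have hRc : ∀ x, Continuous fun t : I => ρA x - F x t := fun x => by
    have := (hFac x).continuousOn
    rw [Set.uIcc_of_le zero_le_one] at this
    exact continuous_const.sub this.domRestrict
  refine ⟨fun t x => ρA x - F x t, continuous_pi hRc, ?_, ?_, fun x => ?_, fun M j hj x => ?_⟩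
  · ext x
    simp [hF]
  · ext x
    simp [hF1]
  · refine ae_eq_of_integral_mul_eq (h.2.2.1 x)
      ((hRc x).integrable_of_hasCompactSupport (HasCompactSupport.of_compactSpace _))
      fun g hg => ?_
    -- Testing with the antiderivative of an arbitrary continuous g and integrating by parts against
    -- the absolutely continuous F shows that ρ and `ρA` − F have the same integral against g.
    set ψ : ℝ → ℝ := fun s => ∫ u in (0 : ℝ)..s, g u with hψ
    have hψd : ∀ s, HasDerivAt ψ (g s) s := fun s => hg.integral_hasStrictDerivAt 0 s |>.hasDerivAt
    have hψ0 : ψ 0 = 0 := by simp [hψ]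
    have hψac : AbsolutelyContinuousOnInterval ψ 0 1 :=
      (hg.intervalIntegrable 0 1).absolutelyContinuousOnInterval_intervalIntegral (by simp)
    have h1 := h.integral_single x hg hψd
    have h2 := hψac.integral_mul_deriv_eq_deriv_mul (hFac x)
    have h3 : ∫ s in (0 : ℝ)..1, ψ s * deriv (F x) s = ∫ t : I, ψ t * K.div (m t) x := by
      rw [intervalIntegral.integral_congr_ae (g := fun s => ψ s * D x s),
        intervalIntegral_eq_integral_unitInterval]
      · simp [hD]
      · filter_upwards [(hDi x).ae_hasDerivAt_integral] with s hs hs'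
        rw [(hs (Set.uIoc_subset_uIcc hs') 0 (by simp)).deriv]
    have h4 : ∫ s in (0 : ℝ)..1, deriv ψ s * F x s = ∫ t : I, g t * F x t := by
      rw [← intervalIntegral_eq_integral_unitInterval fun s => g s * F x s]
      simp_rw [(hψd _).deriv]
    have h5 : ∫ t : I, g t = ψ 1 := by
      rw [← intervalIntegral_eq_integral_unitInterval]
    have hgi : Integrable fun t : I => g t :=
      (hg.comp continuous_subtype_val).integrable_of_hasCompactSupport
        (HasCompactSupport.of_compactSpace _)
    have hgF : Integrable fun t : I => g t * F x t := by
      have hFc : Continuous fun t : I => F x t := by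
        have := (continuous_const (y := ρA x)).sub (hRc x)
        exact this.congr fun t => sub_sub_cancel _ _
      exact ((hg.comp continuous_subtype_val).mul hFc).integrable_of_hasCompactSupport
        (HasCompactSupport.of_compactSpace _)
    have h6 : ∫ t : I, g t * (ρA x - F x t) = ψ 1 * ρA x - ∫ t : I, g t * F x t := by
      simp_rw [mul_sub]
      rw [integral_sub (hgi.mul_const _) hgF, integral_mul_const, h5]
    rw [h6]
    rw [h3, h4, hF1, hψ0] at h2
    rw [hψ0] at h1
    linarith
  · have hM : (0 : ℝ) < M := by exact_mod_cast (Nat.zero_le j).trans_lt hj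
    have h1 : ∫ t in cell M j, K.div (m t) x = ∫ t in cell M j, D x t := by simp [hD]
    change (ρA x - F x (gridPoint M (j + 1))) - (ρA x - F x (gridPoint M j)) = _
    rw [h1, setIntegral_cell_eq_intervalIntegral hj, coe_gridPoint hj.le, coe_gridPoint hj]
    have ha : (j : ℝ) / M ∈ Set.Icc (0 : ℝ) 1 :=
      ⟨by positivity, div_le_one_of_le₀ (by exact_mod_cast hj.le) hM.le⟩
    have hb : ((j : ℝ) + 1) / M ∈ Set.Icc (0 : ℝ) 1 :=
      ⟨by positivity, div_le_one_of_le₀ (by exact_mod_cast hj) hM.le⟩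
    have h2 := intervalIntegral.integral_add_adjacent_intervals
      (hDsub x 0 _ ⟨le_rfl, zero_le_one⟩ ha) (hDsub x _ _ ha hb)
    simp only [hF]
    push_cast
    linarith

end IsCE

end ReversibleChain


theorem alpha_mul_right_le {θ : ℝ → ℝ → ℝ} {c : ℝ} (hc : 0 < c) (s t m : ℝ) :
    alpha θ s t (c * m) ≤ ENNReal.ofReal (c ^ 2) * alpha θ s t m := by
  unfold alpha
  split_ifs with h1 h2
  · rw [← ENNReal.ofReal_mul (by positivity), mul_pow, mul_div_assoc]
  · exact zero_le
  · exact zero_le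
  · rename_i h
    exact absurd ⟨h.1, h.2.1, by rw [h.2.2, mul_zero]⟩ h2
  · rw [ENNReal.mul_top (by simpa using hc.ne')]

theorem integrable_comp_cellIndex {N : ℕ} (hN : 0 < N) (g : ℕ → ℝ) :
    Integrable fun t => g (cellIndex N t) := by
  refine Integrable.of_bound ((measurable_of_countable g).comp
    (measurable_cellIndex N)).aestronglyMeasurable (∑ i ∈ Finset.range N, |g i|)
    (Eventually.of_forall fun t => ?_)
  exact Finset.single_le_sum (f := fun i => |g i|) (fun i _ => abs_nonneg _)
    (Finset.mem_range.2 (cellIndex_lt hN t))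

/-! ### Piecewise affine paths and their energy. -/

/-- The continuous, piecewise affine path through the nodes `n i` at the grid points. -/
def polygonPath {X : Type*} (N : ℕ) (n : ℕ → X → ℝ) (t : I) (x : X) : ℝ :=
  n 0 x + ∑ i ∈ Finset.range N, max 0 (min 1 ((N : ℝ) * t - i)) * (n (i + 1) x - n i x)

section polygonPath

variable {X : Type*} {N : ℕ} (n : ℕ → X → ℝ)

theorem continuous_polygonPath : Continuous (polygonPath N n) := by
  unfold polygonPath
  fun_prop

theorem polygonPath_of_mem_cell {j : ℕ} (hj : j < N) {t : I} (ht : t ∈ cell N j) (x : X) :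
    polygonPath N n t x = n j x + ((N : ℝ) * t - j) * (n (j + 1) x - n j x) := by
  have hN : (0 : ℝ) < N := by exact_mod_cast (Nat.zero_le j).trans_lt hj
  have h1 : (j : ℝ) ≤ N * t := by rw [mul_comm]; exact (div_le_iff₀ hN).1 ht.1
  have h2 : (N : ℝ) * t < j + 1 := by rw [mul_comm]; exact (lt_div_iff₀ hN).1 ht.2
  have h3 : Finset.range (j + 1) ⊆ Finset.range N := by
    intro i hi
    rw [Finset.mem_range] at hi ⊢
    omega
  unfold polygonPath
  rw [← Finset.sum_subset h3, Finset.sum_range_succ, max_eq_right, min_eq_right,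
    Finset.sum_congr rfl (g := fun i => n (i + 1) x - n i x), Finset.sum_range_sub (fun i => n i x)]
  · ring
  · intro i hi
    have : ((i + 1 : ℕ) : ℝ) ≤ j := by exact_mod_cast Finset.mem_range.1 hi
    push_cast at this
    rw [min_eq_left (by linarith), max_eq_right zero_le_one, one_mul]
  · linarith
  · exact le_min zero_le_one (by linarith)
  · intro i _ hi
    have : ((j + 1 : ℕ) : ℝ) ≤ i := by exact_mod_cast not_lt.1 fun h => hi (Finset.mem_range.2 h)
    push_cast at this
    rw [max_eq_left ((min_le_right _ _).trans (by linarith)), zero_mul]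

theorem polygonPath_one (x : X) : polygonPath N n 1 x = n N x := by
  unfold polygonPath
  rw [Finset.sum_congr rfl (g := fun i => n (i + 1) x - n i x), Finset.sum_range_sub (fun i => n i x)]
  · ring
  · intro i hi
    have : ((i + 1 : ℕ) : ℝ) ≤ N := by exact_mod_cast Finset.mem_range.1 hi
    push_cast at this
    rw [Set.Icc.coe_one, min_eq_left (by linarith), max_eq_right zero_le_one, one_mul]

theorem polygonPath_gridPoint (hN : 0 < N) {i : ℕ} (hi : i ≤ N) (x : X) :
    polygonPath N n (gridPoint N i) x = n i x := by
  rcases hi.lt_or_eq with h | rfl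
  · rw [polygonPath_of_mem_cell n h (gridPoint_mem_cell h), coe_gridPoint hi,
      mul_div_cancel₀ _ (by exact_mod_cast hN.ne'), sub_self, zero_mul, add_zero]
  · rw [gridPoint_self hN, polygonPath_one]

theorem setIntegral_cell_polygonPath {j : ℕ} (hj : j < N) (x : X) :
    ∫ t in cell N j, polygonPath N n t x = 1 / N * ((n j x + n (j + 1) x) / 2) := by
  have hN : (N : ℝ) ≠ 0 := by exact_mod_cast ((Nat.zero_le j).trans_lt hj).ne'
  rw [setIntegral_congr_fun (measurableSet_cell N j) fun t ht => polygonPath_of_mem_cell n hj ht x,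
    setIntegral_cell_eq_intervalIntegral hj
      fun s => n j x + ((N : ℝ) * s - j) * (n (j + 1) x - n j x),
    intervalIntegral.integral_add (by simp) (by
      apply Continuous.intervalIntegrable; fun_prop), intervalIntegral.integral_mul_const,
    intervalIntegral.integral_sub (by apply Continuous.intervalIntegrable; fun_prop) (by simp),
    intervalIntegral.integral_const_mul, integral_id, intervalIntegral.integral_const,
    intervalIntegral.integral_const]
  simp only [smul_eq_mul]
  field_simp
  ring

/-- The value at t is a convex combination of two neighbouring nodes, both within one step of t. -/
theorem abs_polygonPath_sub_le (hN : 0 < N) {t : I} {x : X} {a ε : ℝ}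
    (h : ∀ i ≤ N, |(t : ℝ) - (i : ℝ) / N| ≤ 1 / N → |n i x - a| ≤ ε) :
    |polygonPath N n t x - a| ≤ ε := by
  have hN' : (0 : ℝ) < N := by exact_mod_cast hN
  by_cases ht : t = 1
  · subst ht
    rw [polygonPath_one]
    refine h N le_rfl ?_
    rw [div_self hN'.ne']
    simp
  · set j := cellIndex N t
    have hj : j < N := cellIndex_lt hN t
    have htj := mem_cell_cellIndex hN ht
    rw [polygonPath_of_mem_cell n hj htj]
    have h1 : (j : ℝ) / N ≤ t := htj.1
    have h2 : (t : ℝ) < ((j : ℝ) + 1) / N := htj.2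
    have hsplit : ((j : ℝ) + 1) / N = j / N + 1 / N := add_div _ _ _
    have ha := abs_le.1 (h j hj.le (abs_le.2 ⟨by linarith, by linarith⟩))
    have hb := abs_le.1 (h (j + 1) hj (by
      push_cast
      exact abs_le.2 ⟨by linarith, by linarith [(by positivity : (0 : ℝ) ≤ 1 / N)]⟩))
    have h3 : 0 ≤ (N : ℝ) * t - j := by
      have := (div_le_iff₀ hN').1 h1
      linarith
    have h4 : (N : ℝ) * t - j ≤ 1 := by
      have := (lt_div_iff₀ hN').1 h2
      linarith
    rw [abs_le]
    constructor <;> nlinarith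

theorem integrable_polygonPath (x : X) : Integrable fun t => polygonPath N n t x :=
  ((continuous_apply x).comp (continuous_polygonPath n)).integrable_of_hasCompactSupport
    (HasCompactSupport.of_compactSpace _)

end polygonPath

/-- The measure with piecewise affine density through the nodes `n` and piecewise constant
momentum `P`. -/
def polygonMeasure {X : Type*} [Fintype X] (N : ℕ) (n : ℕ → X → ℝ) (P : ℕ → X → X → ℝ) :
    PathMeasure X where
  ρ x := volume.withDensityᵥ fun t => polygonPath N n t x
  m x y := volume.withDensityᵥ fun t => P (cellIndex N t) x y

section polygonMeasure

variable {X : Type*} [Fintype X] {N : ℕ} (n : ℕ → X → ℝ) (P : ℕ → X → X → ℝ)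

theorem hasDensity_polygonMeasure (hN : 0 < N) :
    (polygonMeasure N n P).HasDensity (polygonPath N n) fun t => P (cellIndex N t) :=
  ⟨fun x => ⟨integrable_polygonPath n x, rfl⟩,
    fun x y => ⟨integrable_comp_cellIndex hN fun i => P i x y, rfl⟩⟩

namespace ReversibleChain

variable (K : ReversibleChain X)

theorem isDiscreteCE_polygonPath (hN : 0 < N)
    (h : ∀ i < N, ∀ x, (N : ℝ) * (n (i + 1) x - n i x) + K.div (P i) x = 0) :
    K.IsDiscreteCE N (n 0) (n N) (polygonPath N n) fun t => P (cellIndex N t) := by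
  refine ⟨⟨continuous_polygonPath n, fun i hi => ?_⟩, fun i hi => ⟨P i, fun t ht => ?_⟩,
    fun φ _ => ?_, ?_, ?_⟩
  · refine ⟨fun x => n i x - i * (n (i + 1) x - n i x), fun x => N * (n (i + 1) x - n i x),
      fun t ht x => ?_⟩
    rw [polygonPath_of_mem_cell n hi ht]
    ring
  · simp only [cellIndex_of_mem_cell hi ht]
  · rw [Finset.sum_eq_zero, mul_zero]
    intro i hi
    have hi := Finset.mem_range.1 hi
    unfold innerV
    refine Finset.sum_eq_zero fun x _ => ?_
    simp only [polygonPath_gridPoint n hN (Nat.succ_le_of_lt hi), polygonPath_gridPoint n hN hi.le,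
      cellIndex_of_mem_cell hi (gridPoint_mem_cell hi), h i hi x, zero_mul, zero_mul]
  · ext x
    rw [← gridPoint_zero N, polygonPath_gridPoint n hN (Nat.zero_le _)]
  · ext x
    exact polygonPath_one n x

/-- The mean of an affine density over a cell is the midpoint of its two nodal values. -/
theorem discreteEnergy_polygonMeasure {θ : ℝ → ℝ → ℝ} (hθ : IsAveraging θ) (hN : 0 < N)
    (h : ∀ i < N, ∀ x, (N : ℝ) * (n (i + 1) x - n i x) + K.div (P i) x = 0) :
    K.discreteEnergy N θ (n 0) (n N) (polygonMeasure N n P) = ∑ i ∈ Finset.range N,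
      ENNReal.ofReal (1 / N) *
        K.actionDensity θ (fun x => (n i x + n (i + 1) x) / 2) (P i) := by
  unfold discreteEnergy
  rw [if_pos ⟨_, _, hasDensity_polygonMeasure n P hN, K.isDiscreteCE_polygonPath n P hN h⟩,
    add_zero, K.discreteAction_eq_sum hθ hN]
  refine Finset.sum_congr rfl fun i hi => ?_
  have hi := Finset.mem_range.1 hi
  rw [← K.actionDensity_smul hθ (by positivity)]
  congr 1
  · ext x
    rw [← setIntegral_cell_polygonPath n hi]
    exact withDensityᵥ_apply (integrable_polygonPath n x) (measurableSet_cell N i)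
  · ext x y
    change volume.withDensityᵥ _ _ = _
    rw [withDensityᵥ_apply (integrable_comp_cellIndex hN fun i => P i x y) (measurableSet_cell N i),
      setIntegral_cell_eq hi (c := P i x y) fun t ht => by rw [cellIndex_of_mem_cell hi ht]]
    ring

end ReversibleChain

end polygonMeasure


/-! ### The recovery nodes and momenta. -/

/-- The weight of the constant density in the recovery nodes: `(k / N)²` away from the end points,
and decreasing quadratically to `0` on the first and the last `k` cells. -/
def rampWeight (N k i : ℕ) : ℝ := (((min (min i k) (N - i) : ℕ) : ℝ) / N) ^ 2

/-- Nodes that traverse the path `R` on `M` cells after `k` cells, mixed with the constant density. -/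
def recoveryNode {X : Type*} (N M k : ℕ) (R : I → X → ℝ) (i : ℕ) (x : X) : ℝ :=
  (1 - rampWeight N k i) * R (gridPoint M (i - k)) x + rampWeight N k i

/-- The momentum belonging to `recoveryNode`. -/
def recoveryMomentum {X : Type*} (N M k : ℕ) (nA nB : X → X → ℝ) (m : X → X → SignedMeasure I)
    (i : ℕ) (x y : X) : ℝ :=
  if i < k then (N : ℝ) * (rampWeight N k (i + 1) - rampWeight N k i) * nA x y
  else if i < k + M then (1 - ((k : ℝ) / N) ^ 2) * N * m x y (cellIndex M ⁻¹' {i - k})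
  else (N : ℝ) * (rampWeight N k (i + 1) - rampWeight N k i) * nB x y

/-- Grid points clamp beyond M, and i − k truncates to 0 below k, so the recovery nodes rest at the
end points of R during the ramps. -/
theorem gridPoint_of_le (hM : 0 < M) {j : ℕ} (hj : M ≤ j) : gridPoint M j = 1 := by
  unfold gridPoint
  rw [Set.projIcc_of_right_le]
  · rfl
  · rw [one_le_div (by exact_mod_cast hM)]
    exact_mod_cast hj

section rampWeight

variable {N M k i : ℕ}

theorem rampWeight_left (hN : N = k + M + k) (hi : i ≤ k) : rampWeight N k i = ((i : ℝ) / N) ^ 2 := by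
  unfold rampWeight
  rw [show min (min i k) (N - i) = i by omega]

theorem rampWeight_mid (hN : N = k + M + k) (hi : k ≤ i) (hi' : i ≤ k + M) :
    rampWeight N k i = ((k : ℝ) / N) ^ 2 := by
  unfold rampWeight
  rw [show min (min i k) (N - i) = k by omega]

theorem rampWeight_right (hN : N = k + M + k) (hi : k + M ≤ i) (hi' : i ≤ N) :
    rampWeight N k i = (((N : ℝ) - i) / N) ^ 2 := by
  unfold rampWeight
  rw [show min (min i k) (N - i) = N - i by omega, Nat.cast_sub hi']

theorem rampWeight_nonneg (N k i : ℕ) : 0 ≤ rampWeight N k i := sq_nonneg _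

theorem rampWeight_le (N k i : ℕ) : rampWeight N k i ≤ ((k : ℝ) / N) ^ 2 := by
  unfold rampWeight
  have : ((min (min i k) (N - i) : ℕ) : ℝ) ≤ k := by
    exact_mod_cast (min_le_left _ _).trans (min_le_right _ _)
  gcongr

theorem sq_div_le (hN : N = k + M + k) : ((k : ℝ) / N) ^ 2 ≤ k / N := by
  have h1 : (k : ℝ) / N ≤ 1 := div_le_one_of_le₀ (by exact_mod_cast (by omega)) (by positivity)
  have h0 : 0 ≤ (k : ℝ) / N := by positivity
  nlinarith

theorem sq_div_lt_one (hN : N = k + M + k) (hM : 0 < M) : ((k : ℝ) / N) ^ 2 < 1 := by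
  have hN0 : (0 : ℝ) < N := by exact_mod_cast (by omega)
  have h1 : (k : ℝ) / N < 1 := (div_lt_one hN0).2 (by exact_mod_cast (by omega))
  have h0 : 0 ≤ (k : ℝ) / N := by positivity
  nlinarith

/-- The increments of the ramp are controlled by its mean. -/
theorem sq_mul_rampWeight_sub_le (hN : N = k + M + k) (hN0 : 0 < N) (hi : i < N)
    (h : i < k ∨ k + M ≤ i) :
    0 < (rampWeight N k i + rampWeight N k (i + 1)) / 2 ∧
    ((N : ℝ) * (rampWeight N k (i + 1) - rampWeight N k i)) ^ 2 ≤
      4 * ((rampWeight N k i + rampWeight N k (i + 1)) / 2) := by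
  have hN' : (0 : ℝ) < N := by exact_mod_cast hN0
  -- After clearing denominators this is (2a + 1)² ≤ 2(a² + (a + 1)²). The mean is positive even on
  -- the outermost cell, where one weight vanishes.
  have key : ∀ a : ℝ, 0 ≤ a → ((a / N) ^ 2 + ((a + 1) / N) ^ 2) / 2 > 0 ∧
      ((N : ℝ) * (((a + 1) / N) ^ 2 - (a / N) ^ 2)) ^ 2 ≤
        4 * (((a / N) ^ 2 + ((a + 1) / N) ^ 2) / 2) := by
    intro a ha
    refine ⟨by positivity, ?_⟩
    have e1 : ((N : ℝ) * (((a + 1) / N) ^ 2 - (a / N) ^ 2)) ^ 2 = (2 * a + 1) ^ 2 / N ^ 2 := by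
      field_simp
      ring
    have e2 : 4 * (((a / N) ^ 2 + ((a + 1) / N) ^ 2) / 2) = 2 * (a ^ 2 + (a + 1) ^ 2) / N ^ 2 := by
      field_simp
      ring
    rw [e1, e2]
    gcongr
    nlinarith
  rcases h with h | h
  · rw [rampWeight_left hN h.le, rampWeight_left hN h]
    have := key i (Nat.cast_nonneg _)
    push_cast
    exact this
  · rw [rampWeight_right hN h hi.le, rampWeight_right hN (by omega) hi]
    have h1 : ((i + 1 : ℕ) : ℝ) ≤ N := by exact_mod_cast hi
    -- The right ramp is the left one run backwards; squaring removes the sign of the increment.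
    have := key ((N : ℝ) - (i + 1 : ℕ)) (by linarith)
    rw [show (N : ℝ) - (i + 1 : ℕ) + 1 = N - i by push_cast; ring] at this
    refine ⟨by linarith [this.1], ?_⟩
    linarith [this.2, show ((N : ℝ) * ((((N : ℝ) - i) / N) ^ 2 - (((N : ℝ) - (i + 1 : ℕ)) / N) ^ 2)) ^ 2 =
      ((N : ℝ) * ((((N : ℝ) - (i + 1 : ℕ)) / N) ^ 2 - (((N : ℝ) - i) / N) ^ 2)) ^ 2 by ring]

theorem abs_mul_rampWeight_sub_le (hN : N = k + M + k) (hN0 : 0 < N) (hi : i < N)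
    (h : i < k ∨ k + M ≤ i) : |(N : ℝ) * (rampWeight N k (i + 1) - rampWeight N k i)| ≤ 2 := by
  have h1 := (sq_mul_rampWeight_sub_le hN hN0 hi h).2
  have h2 : ((k : ℝ) / N) ^ 2 ≤ 1 := by
    have h1 : (k : ℝ) / N ≤ 1 := div_le_one_of_le₀ (by exact_mod_cast (by omega)) (by positivity)
    exact pow_le_one₀ (by positivity) h1
  exact abs_le_of_sq_le_sq
    (by linarith [rampWeight_le N k i, rampWeight_le N k (i + 1)]) two_pos.le

/-- Squeezing the path into the middle cells shifts time by k(2j − M)/(MN), with |2j − M| ≤ M; on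
the ramps the time elapsed from the nearer end point is at most k/N. -/
theorem abs_gridPoint_sub_le (hN : N = k + M + k) (hM : 0 < M) (hi : i ≤ N) :
    |(gridPoint M (i - k) : ℝ) - i / N| ≤ k / N := by
  have hN' : (0 : ℝ) < N := by exact_mod_cast (by omega)
  have hM' : (0 : ℝ) < M := by exact_mod_cast hM
  have hNr : (N : ℝ) = k + M + k := by exact_mod_cast hN
  rcases le_or_gt i (k + M) with h | h
  · rw [coe_gridPoint (by omega)]
    rcases le_or_gt k i with h' | h'
    · obtain ⟨j, rfl⟩ := Nat.exists_eq_add_of_le h'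
      have hj : (j : ℝ) ≤ M := by exact_mod_cast (by omega : j ≤ M)
      have e : (j : ℝ) / M - (k + j) / N = k * ((2 * j - M) / M) / N := by
        rw [hNr] at hN' ⊢
        field_simp
        ring
      rw [Nat.add_sub_cancel_left, Nat.cast_add, e, abs_div, abs_mul, abs_of_pos hN', Nat.abs_cast]
      gcongr
      refine mul_le_of_le_one_right (by positivity) ?_
      rw [abs_div, abs_of_pos hM', div_le_one hM', abs_le]
      constructor <;> linarith [(Nat.cast_nonneg j : (0 : ℝ) ≤ j)]
    · rw [Nat.sub_eq_zero_of_le h'.le, Nat.cast_zero, zero_div, zero_sub, abs_neg,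
        abs_of_nonneg (by positivity)]
      gcongr
  · have h1 : gridPoint M (i - k) = 1 := gridPoint_of_le hM (by omega)
    have hiN : (i : ℝ) ≤ N := by exact_mod_cast hi
    have hki : (k : ℝ) + M ≤ i := by exact_mod_cast h.le
    rw [h1, Set.Icc.coe_one, abs_of_nonneg (by rw [sub_nonneg, div_le_one hN']; exact hiN),
      one_sub_div hN'.ne']
    gcongr
    linarith

end rampWeight

section recoveryNode

variable {X : Type*} {N M k : ℕ} {R : I → X → ℝ} {ρA ρB : X → ℝ}

theorem recoveryNode_left (R0 : R 0 = ρA) {i : ℕ} (hi : i ≤ k) (x : X) :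
    recoveryNode N M k R i x = (1 - rampWeight N k i) * ρA x + rampWeight N k i := by
  unfold recoveryNode
  rw [Nat.sub_eq_zero_of_le hi, gridPoint_zero, R0]

theorem recoveryNode_right (hM : 0 < M) (R1 : R 1 = ρB) {i : ℕ} (hi : k + M ≤ i) (x : X) :
    recoveryNode N M k R i x = (1 - rampWeight N k i) * ρB x + rampWeight N k i := by
  unfold recoveryNode
  rw [gridPoint_of_le hM (by omega), R1]

theorem recoveryNode_zero (R0 : R 0 = ρA) : recoveryNode N M k R 0 = ρA := by
  ext x
  rw [recoveryNode_left R0 (Nat.zero_le _)]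
  simp [rampWeight]

theorem recoveryNode_last (hN : N = k + M + k) (hM : 0 < M) (R1 : R 1 = ρB) :
    recoveryNode N M k R N = ρB := by
  ext x
  rw [recoveryNode_right hM R1 (by omega)]
  simp [rampWeight]

end recoveryNode

/-! ### Continuity equation and energy of the recovery sequence. -/

namespace ReversibleChain

variable {X : Type*} [Fintype X] (K : ReversibleChain X) {N M k : ℕ} {R : I → X → ℝ}
  {ρA ρB : X → ℝ} {nA nB : X → X → ℝ} {m : X → X → SignedMeasure I}

theorem div_mul (c : ℝ) (Ψ : X → X → ℝ) (x : X) :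
    K.div (fun x y => c * Ψ x y) x = c * K.div Ψ x := by
  have := congrFun (K.divLinear.map_smul c Ψ) x
  exact this

theorem recovery_grid_eq (hN : N = k + M + k) (hM : 0 < M) (R0 : R 0 = ρA) (R1 : R 1 = ρB)
    (hA : K.div nA = fun x => ρA x - 1) (hB : K.div nB = fun x => ρB x - 1)
    (hR : ∀ j < M, ∀ x, R (gridPoint M (j + 1)) x - R (gridPoint M j) x =
      -K.div (fun x y => m x y (cellIndex M ⁻¹' {j})) x) (i : ℕ) (x : X) :
    (N : ℝ) * (recoveryNode N M k R (i + 1) x - recoveryNode N M k R i x) +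
      K.div (recoveryMomentum N M k nA nB m i) x = 0 := by
  rcases lt_or_ge i k with h1 | h1
  · have : recoveryMomentum N M k nA nB m i =
        fun x y => (N : ℝ) * (rampWeight N k (i + 1) - rampWeight N k i) * nA x y := by
      ext x y
      simp only [recoveryMomentum, if_pos h1]
    rw [this, div_mul, hA, recoveryNode_left R0 h1.le, recoveryNode_left R0 h1]
    ring
  rcases lt_or_ge i (k + M) with h2 | h2
  · have : recoveryMomentum N M k nA nB m i =
        fun x y => (1 - ((k : ℝ) / N) ^ 2) * N * m x y (cellIndex M ⁻¹' {i - k}) := by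
      ext x y
      simp only [recoveryMomentum, if_neg h1.not_gt, if_pos h2]
    have h3 := hR (i - k) (by omega) x
    rw [this, K.div_mul _ fun x y => m x y (cellIndex M ⁻¹' {i - k})]
    unfold recoveryNode
    rw [rampWeight_mid hN h1 h2.le, rampWeight_mid hN (by omega) h2,
      show i + 1 - k = i - k + 1 by omega]
    linear_combination (N : ℝ) * (1 - ((k : ℝ) / N) ^ 2) * h3
  · have : recoveryMomentum N M k nA nB m i =
        fun x y => (N : ℝ) * (rampWeight N k (i + 1) - rampWeight N k i) * nB x y := by
      ext x y
      simp only [recoveryMomentum, if_neg h1.not_gt, if_neg h2.not_gt]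
    rw [this, div_mul, hB, recoveryNode_right hM R1 h2, recoveryNode_right hM R1 (by omega)]
    ring

theorem actionDensity_const_lt_top {θ : ℝ → ℝ → ℝ} (hθ : IsAveraging θ) {c : ℝ} (hc : 0 < c)
    (n : X → X → ℝ) : K.actionDensity θ (fun _ => c) n < ⊤ := by
  unfold actionDensity
  refine ENNReal.mul_lt_top (by simp) (ENNReal.sum_lt_top.2 fun x _ => ENNReal.sum_lt_top.2
    fun y _ => ENNReal.mul_lt_top ?_ ENNReal.ofReal_lt_top)
  exact (alpha_le_of_le hθ hc le_rfl le_rfl _).trans_lt ENNReal.ofReal_lt_top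

/-- On each edge α ≤ (dn)²/c ≤ 4n², which is the value of α at constant density 1/4. The bound does
not depend on the cell. -/
theorem actionDensity_ramp_le {θ : ℝ → ℝ → ℝ} (hθ : IsAveraging θ) {c d : ℝ} (hc : 0 < c)
    (hd : d ^ 2 ≤ 4 * c) {ρ : X → ℝ} (hρ : ∀ x, c ≤ ρ x) (n : X → X → ℝ) :
    K.actionDensity θ ρ (fun x y => d * n x y) ≤ K.actionDensity θ (fun _ => 1 / 4) n := by
  refine K.actionDensity_mono fun x y _ => (alpha_le_of_le hθ hc (hρ x) (hρ y) _).trans ?_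
  refine le_trans (ENNReal.ofReal_le_ofReal ?_)
    (ofReal_sq_div_le_alpha hθ (C := 1 / 4) (by norm_num) le_rfl le_rfl _)
  rw [div_le_iff₀ hc, mul_pow]
  have := mul_le_mul_of_nonneg_right hd (sq_nonneg (n x y))
  linarith

end ReversibleChain


/-- With b the midpoint of the two values of R, the oscillation bound gives a cell mean of at most b
+ c, while the mixed midpoint is (1 − c)b + c, which exceeds (1 − c)(b + c) by c². -/
theorem le_recoveryNode_average {X : Type*} {N M k : ℕ} {R ρ : I → X → ℝ} (hN : N = k + M + k) (hM : 0 < M) (hRc : Continuous R)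
    (hae : ∀ x, ∀ᵐ t, ρ t x = R t x)
    (hω : ∀ s t : I, |(s : ℝ) - t| ≤ 1 / M → ∀ x, |R s x - R t x| ≤ ((k : ℝ) / N) ^ 2)
    {j : ℕ} (hj : j < M) (x : X) :
    (1 - ((k : ℝ) / N) ^ 2) * M * ∫ t in cell M j, ρ t x ≤
      (recoveryNode N M k R (k + j) x + recoveryNode N M k R (k + j + 1) x) / 2 := by
  have hM' : (0 : ℝ) < M := by exact_mod_cast hM
  set c := ((k : ℝ) / N) ^ 2 with hc
  have hc1 : c < 1 := sq_div_lt_one hN hM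
  have hc0 : 0 ≤ c := sq_nonneg _
  set b := (R (gridPoint M j) x + R (gridPoint M (j + 1)) x) / 2 with hb
  have h1 : ∫ t in cell M j, ρ t x ≤ ∫ t in cell M j, (b + c) := by
    rw [setIntegral_congr_ae (g := fun t => R t x) (measurableSet_cell M j)
      ((hae x).mono fun t ht _ => ht)]
    refine setIntegral_mono_on ?_ (by simp) (measurableSet_cell M j) fun t ht => ?_
    · exact (((continuous_apply x).comp hRc).integrable_of_hasCompactSupport
        (HasCompactSupport.of_compactSpace _)).integrableOn
    · have e : ((j : ℝ) + 1) / M = j / M + 1 / M := add_div _ _ _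
      have h1 : (j : ℝ) / M ≤ t := ht.1
      have h2 : (t : ℝ) < ((j : ℝ) + 1) / M := ht.2
      have ha := hω t (gridPoint M j) (by
        rw [coe_gridPoint hj.le]
        exact abs_le.2 ⟨by linarith [(by positivity : (0 : ℝ) ≤ 1 / M)], by linarith⟩) x
      have hb := hω t (gridPoint M (j + 1)) (by
        rw [coe_gridPoint hj, Nat.cast_add_one]
        exact abs_le.2 ⟨by linarith, by linarith [(by positivity : (0 : ℝ) ≤ 1 / M)]⟩) x
      have := (abs_le.1 ha).2
      have := (abs_le.1 hb).2
      linarith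
  rw [setIntegral_cell_eq hj (c := b + c) fun _ _ => rfl, le_div_iff₀ hM'] at h1
  have h2 : (recoveryNode N M k R (k + j) x + recoveryNode N M k R (k + j + 1) x) / 2 =
      (1 - c) * b + c := by
    unfold recoveryNode
    rw [rampWeight_mid hN (by omega) (by omega), rampWeight_mid hN (by omega) (by omega),
      Nat.add_sub_cancel_left, show k + j + 1 - k = j + 1 by omega]
    ring
  rw [h2]
  have := mul_le_mul_of_nonneg_left h1 (sub_nonneg.2 hc1.le)
  nlinarith

namespace ReversibleChain

variable {X : Type*} [Fintype X] (K : ReversibleChain X) {θ : ℝ → ℝ → ℝ} {N M k : ℕ}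
  {R : I → X → ℝ} {ρA ρB : X → ℝ} {nA nB : X → X → ℝ} {m : X → X → SignedMeasure I}
  {ρ : I → X → ℝ} {p : I → X → X → ℝ}

theorem actionDensity_recovery_mid_le (hθ : IsAveraging θ) (hN : N = k + M + k) (hM : 0 < M)
    (hρ : ∀ x, Integrable fun t => ρ t x) (hp : ∀ x y, 0 < K.Q x y → Integrable fun t => p t x y)
    (hm : ∀ x y, 0 < K.Q x y → ∀ j < M, m x y (cellIndex M ⁻¹' {j}) = ∫ t in cell M j, p t x y)
    (hRc : Continuous R) (hae : ∀ x, ∀ᵐ t, ρ t x = R t x)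
    (hω : ∀ s t : I, |(s : ℝ) - t| ≤ 1 / M → ∀ x, |R s x - R t x| ≤ ((k : ℝ) / N) ^ 2)
    {j : ℕ} (hj : j < M) :
    ENNReal.ofReal (1 / N) * K.actionDensity θ
      (fun x => (recoveryNode N M k R (k + j) x + recoveryNode N M k R (k + j + 1) x) / 2)
      (recoveryMomentum N M k nA nB m (k + j)) ≤
    ENNReal.ofReal (N / M) * ∫⁻ t in cell M j, K.actionDensity θ (ρ t) (p t) := by
  have hM' : (0 : ℝ) < M := by exact_mod_cast hM
  have hN' : (0 : ℝ) < N := by exact_mod_cast (by omega)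
  set c := ((k : ℝ) / N) ^ 2 with hc
  have hc1 : 0 < 1 - c := sub_pos.2 (sq_div_lt_one hN hM)
  have hc0 : 0 ≤ c := sq_nonneg _
  have h1 : K.actionDensity θ
      (fun x => (recoveryNode N M k R (k + j) x + recoveryNode N M k R (k + j + 1) x) / 2)
      (recoveryMomentum N M k nA nB m (k + j)) ≤
      ENNReal.ofReal ((1 - c) * M * ((N : ℝ) / M) ^ 2) *
        K.actionDensity θ (fun x => ∫ t in cell M j, ρ t x)
          (fun x y => ∫ t in cell M j, p t x y) := by
    refine K.actionDensity_le_mul _ fun x y hQ => ?_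
    -- Density and momentum share the factor (1 − c)M, which leaves α linearly; the momentum keeps
    -- the speed-up N/M, which leaves α squared. With the step 1/N, the net factor is (1 − c)N/M.
    have hmom : recoveryMomentum N M k nA nB m (k + j) x y =
        (1 - c) * M * ((N / M) * ∫ t in cell M j, p t x y) := by
      unfold recoveryMomentum
      rw [if_neg (by omega), if_pos (by omega), Nat.add_sub_cancel_left, hm x y hQ j hj, ← hc]
      clear_value c
      field_simp
    rw [hmom]
    refine (alpha_antitone hθ (le_recoveryNode_average hN hM hRc hae hω hj x)
      (le_recoveryNode_average hN hM hRc hae hω hj y) _).trans ?_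
    rw [alpha_smul hθ (mul_pos hc1 hM'), ENNReal.ofReal_mul (q := ((N : ℝ) / M) ^ 2)
      (mul_pos hc1 hM').le, mul_assoc]
    exact mul_le_mul_right (alpha_mul_right_le (by positivity) _ _ _) _
  have h2 := K.actionDensity_integral_le hθ (ν := volume.restrict (cell M j))
    (fun x => (hρ x).integrableOn) (fun x y hQ => (hp x y hQ).integrableOn)
  refine (mul_le_mul_right (h1.trans (mul_le_mul_right h2 _)) _).trans ?_
  rw [← mul_assoc, ← ENNReal.ofReal_mul (by positivity)]
  refine mul_le_mul_left (ENNReal.ofReal_le_ofReal ?_) _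
  have : 1 / (N : ℝ) * ((1 - c) * M * ((N : ℝ) / M) ^ 2) = (1 - c) * (N / M) := by
    field_simp
  rw [this]
  exact mul_le_of_le_one_left (by positivity) (by linarith)

theorem recovery_discreteEnergy_le (hθ : IsAveraging θ) (hN : N = k + M + k) (hM : 0 < M)
    (hA0 : ∀ x, 0 ≤ ρA x) (hB0 : ∀ x, 0 ≤ ρB x) (R0 : R 0 = ρA) (R1 : R 1 = ρB)
    (hA : K.div nA = fun x => ρA x - 1) (hB : K.div nB = fun x => ρB x - 1)
    (hR : ∀ j < M, ∀ x, R (gridPoint M (j + 1)) x - R (gridPoint M j) x =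
      -K.div (fun x y => m x y (cellIndex M ⁻¹' {j})) x)
    (hρ : ∀ x, Integrable fun t => ρ t x) (hp : ∀ x y, 0 < K.Q x y → Integrable fun t => p t x y)
    (hm : ∀ x y, 0 < K.Q x y → ∀ j < M, m x y (cellIndex M ⁻¹' {j}) = ∫ t in cell M j, p t x y)
    (hRc : Continuous R) (hae : ∀ x, ∀ᵐ t, ρ t x = R t x)
    (hω : ∀ s t : I, |(s : ℝ) - t| ≤ 1 / M → ∀ x, |R s x - R t x| ≤ ((k : ℝ) / N) ^ 2) :
    K.discreteEnergy N θ ρA ρB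
      (polygonMeasure N (recoveryNode N M k R) (recoveryMomentum N M k nA nB m)) ≤
    ENNReal.ofReal (N / M) * K.action θ ρ p + ENNReal.ofReal (k / N) *
      (K.actionDensity θ (fun _ => 1 / 4) nA + K.actionDensity θ (fun _ => 1 / 4) nB) := by
  have hN0 : 0 < N := by omega
  have h1 := K.discreteEnergy_polygonMeasure (recoveryNode N M k R)
    (recoveryMomentum N M k nA nB m) hθ hN0 fun i _ x =>
      K.recovery_grid_eq hN hM R0 R1 hA hB hR i x
  rw [recoveryNode_zero R0, recoveryNode_last hN hM R1] at h1
  rw [h1]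
  have hweight : ∀ i, rampWeight N k i ≤ 1 := fun i =>
    (rampWeight_le N k i).trans (sq_div_lt_one hN hM).le
  have hnode : ∀ {f : X → ℝ}, (∀ x, 0 ≤ f x) → ∀ i x,
      rampWeight N k i ≤ (1 - rampWeight N k i) * f x + rampWeight N k i := fun {f} hf i x =>
    le_add_of_nonneg_left (mul_nonneg (sub_nonneg.2 (hweight i)) (hf x))
  have hleft : ∀ i < k, K.actionDensity θ
      (fun x => (recoveryNode N M k R i x + recoveryNode N M k R (i + 1) x) / 2)
      (recoveryMomentum N M k nA nB m i) ≤ K.actionDensity θ (fun _ => 1 / 4) nA := by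
    intro i hi
    obtain ⟨hc, hd⟩ := sq_mul_rampWeight_sub_le hN hN0 (by omega) (Or.inl hi)
    have hP : recoveryMomentum N M k nA nB m i =
        fun x y => (N : ℝ) * (rampWeight N k (i + 1) - rampWeight N k i) * nA x y := by
      ext x y
      simp only [recoveryMomentum, if_pos hi]
    rw [hP]
    refine K.actionDensity_ramp_le hθ hc hd (fun x => ?_) nA
    rw [recoveryNode_left R0 hi.le, recoveryNode_left R0 hi]
    linarith [hnode hA0 i x, hnode hA0 (i + 1) x]
  have hright : ∀ i, k + M ≤ i → i < N → K.actionDensity θ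
      (fun x => (recoveryNode N M k R i x + recoveryNode N M k R (i + 1) x) / 2)
      (recoveryMomentum N M k nA nB m i) ≤ K.actionDensity θ (fun _ => 1 / 4) nB := by
    intro i hi hiN
    obtain ⟨hc, hd⟩ := sq_mul_rampWeight_sub_le hN hN0 hiN (Or.inr hi)
    have hP : recoveryMomentum N M k nA nB m i =
        fun x y => (N : ℝ) * (rampWeight N k (i + 1) - rampWeight N k i) * nB x y := by
      ext x y
      simp only [recoveryMomentum, if_neg (show ¬ i < k by omega), if_neg hi.not_gt]
    rw [hP]
    refine K.actionDensity_ramp_le hθ hc hd (fun x => ?_) nB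
    rw [recoveryNode_right hM R1 hi, recoveryNode_right hM R1 (by omega)]
    linarith [hnode hB0 i x, hnode hB0 (i + 1) x]
  have hramp : (k : ℝ≥0∞) * ENNReal.ofReal (1 / N) = ENNReal.ofReal (k / N) := by
    rw [← ENNReal.ofReal_natCast, ← ENNReal.ofReal_mul (Nat.cast_nonneg _), mul_one_div]
  have hsplit : Finset.range N = Finset.range (k + M + k) := by rw [← hN]
  rw [hsplit, Finset.sum_range_add, Finset.sum_range_add, mul_add, add_assoc, add_comm (∑ _ ∈ _, _),
    add_assoc, add_comm (ENNReal.ofReal (k / N) * _)]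
  refine add_le_add ?_ (add_le_add ?_ ?_)
  · rw [action, lintegral_eq_sum_cell hM, Finset.mul_sum]
    refine Finset.sum_le_sum fun j hj => ?_
    exact K.actionDensity_recovery_mid_le hθ hN hM hρ hp hm hRc hae hω (Finset.mem_range.1 hj)
  · refine (Finset.sum_le_card_nsmul _ _ _ fun j hj => mul_le_mul_right (hright (k + M + j)
      (by omega) (by have := Finset.mem_range.1 hj; omega)) _).trans (le_of_eq ?_)
    rw [Finset.card_range, nsmul_eq_mul, ← mul_assoc, hramp]
  · refine (Finset.sum_le_card_nsmul _ _ _ fun j hj => mul_le_mul_right (hleft j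
      (Finset.mem_range.1 hj)) _).trans (le_of_eq ?_)
    rw [Finset.card_range, nsmul_eq_mul, ← mul_assoc, hramp]

end ReversibleChain


/-! ### Weak* convergence of the recovery sequence. -/

section recoveryConvergence

variable {X : Type*} [Fintype X] {N M k : ℕ} {R : I → X → ℝ} {nA nB : X → X → ℝ}
  {m : X → X → SignedMeasure I}

omit [Fintype X] in
theorem abs_polygonPath_recoveryNode_sub_le (hN : N = k + M + k) (hM : 0 < M) {x : X} {η B : ℝ}
    (hη : ∀ s t : I, |(s : ℝ) - t| ≤ ((k : ℝ) + 1) / N → |R s x - R t x| ≤ η)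
    (hB : ∀ t, |R t x| ≤ B) (t : I) :
    |polygonPath N (recoveryNode N M k R) t x - R t x| ≤ η + (k : ℝ) / N * (1 + B) := by
  refine abs_polygonPath_sub_le _ (by omega) fun i hi hti => ?_
  have h1 := abs_gridPoint_sub_le hN hM hi
  have h2 : |R (gridPoint M (i - k)) x - R t x| ≤ η := by
    refine hη _ _ ((abs_sub_le _ ((i : ℝ) / N) _).trans ?_)
    rw [abs_sub_comm ((i : ℝ) / N), add_div]
    exact add_le_add h1 hti
  have h3 : |rampWeight N k i * (1 - R (gridPoint M (i - k)) x)| ≤ (k : ℝ) / N * (1 + B) := by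
    rw [abs_mul, abs_of_nonneg (rampWeight_nonneg N k i)]
    refine mul_le_mul ((rampWeight_le N k i).trans (sq_div_le hN)) ?_ (abs_nonneg _) (by positivity)
    refine (abs_sub _ _).trans (add_le_add (by simp) (hB _))
  have h4 : recoveryNode N M k R i x - R t x = (R (gridPoint M (i - k)) x - R t x) +
      rampWeight N k i * (1 - R (gridPoint M (i - k)) x) := by
    unfold recoveryNode
    ring
  rw [h4]
  exact (abs_add_le _ _).trans (add_le_add h2 h3)

theorem abs_integral_recovery_ρ_sub_le (hN : N = k + M + k) (hM : 0 < M) (hRc : Continuous R)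
    {x : X} {η B C : ℝ} (hη : ∀ s t : I, |(s : ℝ) - t| ≤ ((k : ℝ) + 1) / N → |R s x - R t x| ≤ η)
    (hB : ∀ t, |R t x| ≤ B) (φ : C(I, ℝ)) (hC : ∀ t, |φ t| ≤ C) (P : ℕ → X → X → ℝ) :
    |(∫ᵛ t, φ t ∂•((polygonMeasure N (recoveryNode N M k R) P).ρ x)) - ∫ t, φ t * R t x| ≤
      C * (η + (k : ℝ) / N * (1 + B)) := by
  have hcomp : ∀ {f : I → ℝ}, Continuous f → Integrable f := fun hf =>
    hf.integrable_of_hasCompactSupport (HasCompactSupport.of_compactSpace _)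
  have hRx : Continuous fun t => R t x := (continuous_apply x).comp hRc
  have hpx : Continuous fun t => polygonPath N (recoveryNode N M k R) t x :=
    (continuous_apply x).comp (continuous_polygonPath _)
  have h1 : (∫ᵛ t, φ t ∂•((polygonMeasure N (recoveryNode N M k R) P).ρ x)) =
      ∫ t, φ t * polygonPath N (recoveryNode N M k R) t x :=
    SignedMeasure.integral_withDensityᵥ (integrable_polygonPath _ x) φ.continuous.measurable hC
  rw [h1, ← integral_sub (f := fun t => φ t * polygonPath N (recoveryNode N M k R) t x)
    (g := fun t => φ t * R t x) (hcomp (φ.continuous.mul hpx)) (hcomp (φ.continuous.mul hRx))]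
  have h2 := norm_integral_le_of_norm_le_const (μ := (volume : Measure I))
    (f := fun t => φ t * polygonPath N (recoveryNode N M k R) t x - φ t * R t x)
    (C := C * (η + (k : ℝ) / N * (1 + B))) (Eventually.of_forall fun t => ?_)
  · simpa using h2
  · rw [← mul_sub, Real.norm_eq_abs, abs_mul]
    exact mul_le_mul (hC t) (abs_polygonPath_recoveryNode_sub_le hN hM hη hB t) (abs_nonneg _)
      ((abs_nonneg _).trans (hC t))

theorem abs_mul_setIntegral_cell_sub_le (hN : N = k + M + k) (hM : 0 < M) {η : ℝ} {φ : C(I, ℝ)}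
    (hη : ∀ s t : I, |(s : ℝ) - t| ≤ ((k : ℝ) + 1) / N + 1 / M → |φ s - φ t| ≤ η) (t : I) :
    |(N : ℝ) * (∫ s in cell N (k + cellIndex M t), φ s) - φ t| ≤ η := by
  have hN' : (0 : ℝ) < N := by exact_mod_cast (by omega)
  set j := cellIndex M t with hj
  have hjM : j < M := cellIndex_lt hM t
  have hjN : k + j < N := by omega
  have hint : IntegrableOn φ (cell N (k + j)) :=
    (φ.continuous.integrable_of_hasCompactSupport (HasCompactSupport.of_compactSpace _)).integrableOn
  have h1 : (N : ℝ) * (∫ s in cell N (k + j), φ s) - φ t =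
      N * ∫ s in cell N (k + j), (φ s - φ t) := by
    rw [integral_sub hint (by simp), setIntegral_cell_eq hjN (c := φ t) fun _ _ => rfl]
    field_simp
  have h2 := norm_setIntegral_le_of_norm_le_const (μ := (volume : Measure I)) (s := cell N (k + j))
    (f := fun s => φ s - φ t) (C := η) (measure_lt_top _ _) fun s hs => hη s t ?_
  · rw [h1, abs_mul, abs_of_pos hN']
    rw [volume_real_cell hjN, mul_one_div, le_div_iff₀ hN'] at h2
    rwa [mul_comm, ← Real.norm_eq_abs]
  · have e : (((k + j : ℕ) : ℝ) + 1) / N = ((k + j : ℕ) : ℝ) / N + 1 / N := add_div _ _ _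
    have a1 : ((k + j : ℕ) : ℝ) / N ≤ s := hs.1
    have a2 : (s : ℝ) < (((k + j : ℕ) : ℝ) + 1) / N := hs.2
    have a3 := abs_le.1 (abs_gridPoint_sub_le hN hM hjN.le)
    rw [Nat.add_sub_cancel_left] at a3
    have a4 := abs_le.1 (abs_sub_gridPoint_cellIndex_le hM t)
    rw [← hj] at a4
    rw [add_div, abs_le]
    constructor <;> linarith [a3.1, a3.2, a4.1, a4.2, (by positivity : (0 : ℝ) ≤ 1 / N)]

/-- The discretisation is moved onto the test function, and the error is measured in total
variation. Thus m(x,y) may be any measure, as is required off the edges, where it can be singular.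
-/
theorem abs_integral_recovery_m_sub_le (hN : N = k + M + k) (hM : 0 < M) {x y : X} {η C : ℝ}
    {φ : C(I, ℝ)} (hC : ∀ t, |φ t| ≤ C)
    (hη : ∀ s t : I, |(s : ℝ) - t| ≤ ((k : ℝ) + 1) / N + 1 / M → |φ s - φ t| ≤ η)
    (n : ℕ → X → ℝ) :
    |(∫ᵛ t, φ t ∂•((polygonMeasure N n (recoveryMomentum N M k nA nB m)).m x y)) -
        ∫ᵛ t, φ t ∂•(m x y)| ≤
      (k : ℝ) / N * (2 * C * (|nA x y| + |nB x y|)) +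
        (η + (k : ℝ) / N * C) * (m x y).variation.real Set.univ := by
  have hN0 : 0 < N := by omega
  have hN' : (0 : ℝ) < N := by exact_mod_cast hN0
  have hC0 : 0 ≤ C := (abs_nonneg _).trans (hC 0)
  set P := recoveryMomentum N M k nA nB m with hP
  set c := ((k : ℝ) / N) ^ 2 with hc
  have hc0 : 0 ≤ c := sq_nonneg _
  have hc1 : c < 1 := sq_div_lt_one hN hM
  -- `g j` is 1 − c times the mean of φ over the fine cell k + j; the middle part of the pairing is
  -- the integral of this step function against m. The index function includes the point 1 in the
  -- last coarse cell, so an atom there is kept.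
  set g : ℕ → ℝ := fun j => (1 - c) * (N * ∫ s in cell N (k + j), φ s) with hg
  have hφi : Integrable φ :=
    φ.continuous.integrable_of_hasCompactSupport (HasCompactSupport.of_compactSpace _)
  have hcell : ∀ i < N, |∫ s in cell N i, φ s| ≤ C / N := fun i hi => by
    have := norm_setIntegral_le_of_norm_le_const (μ := (volume : Measure I)) (s := cell N i)
      (f := φ) (C := C) (measure_lt_top _ _) fun s _ => hC s
    rwa [volume_real_cell hi, mul_one_div] at this
  have h1 : (∫ᵛ t, φ t ∂•((polygonMeasure N n P).m x y)) =
      ∑ i ∈ Finset.range (k + M + k), P i x y * ∫ s in cell N i, φ s := by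
    rw [← hN, ← integral_mul_comp_cellIndex hN0 hφi fun i => P i x y]
    simp_rw [mul_comm _ (φ _)]
    exact SignedMeasure.integral_withDensityᵥ (integrable_comp_cellIndex hN0 fun i => P i x y)
      φ.continuous.measurable hC
  have h2 : ∑ j ∈ Finset.range M, P (k + j) x y * ∫ s in cell N (k + j), φ s =
      ∫ᵛ t, g (cellIndex M t) ∂•(m x y) := by
    rw [SignedMeasure.integral_comp_fin_range _ (measurable_cellIndex M) (cellIndex_lt hM)]
    refine Finset.sum_congr rfl fun j hj => ?_
    have hj := Finset.mem_range.1 hj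
    rw [hP, recoveryMomentum, if_neg (by omega), if_pos (by omega), Nat.add_sub_cancel_left]
    simp only [hg, hc]
    ring
  have hgb : ∀ t, |g (cellIndex M t)| ≤ C := fun t => by
    simp only [hg]
    rw [abs_mul, abs_mul, abs_of_pos (sub_pos.2 hc1), abs_of_pos hN']
    have := hcell (k + cellIndex M t) (by have := cellIndex_lt hM t; omega)
    rw [le_div_iff₀ hN'] at this
    nlinarith [abs_nonneg (∫ s in cell N (k + cellIndex M t), φ s)]
  have h3 : |(∫ᵛ t, g (cellIndex M t) ∂•(m x y)) - ∫ᵛ t, φ t ∂•(m x y)| ≤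
      (η + (k : ℝ) / N * C) * (m x y).variation.real Set.univ := by
    rw [← VectorMeasure.integral_fun_sub (f := fun t => g (cellIndex M t))
      (SignedMeasure.integrable_of_bound _ ((measurable_from_nat (f := g)).comp (measurable_cellIndex M)) hgb)
      (SignedMeasure.integrable_of_bound _ φ.continuous.measurable hC)]
    refine SignedMeasure.abs_integral_le _ fun t => ?_
    have e : g (cellIndex M t) - φ t =
        (1 - c) * ((N : ℝ) * (∫ s in cell N (k + cellIndex M t), φ s) - φ t) - c * φ t := by
      simp only [hg]
      ring
    rw [e]
    refine (abs_sub _ _).trans (add_le_add ?_ ?_)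
    · rw [abs_mul, abs_of_pos (sub_pos.2 hc1)]
      exact (mul_le_of_le_one_left (abs_nonneg _) (by linarith)).trans
        (abs_mul_setIntegral_cell_sub_le hN hM hη t)
    · rw [abs_mul, abs_of_nonneg hc0]
      exact mul_le_mul (sq_div_le hN) (hC t) (abs_nonneg _) (by positivity)
  have hramp : ∀ (a : ℕ → ℕ) (q : ℝ), (∀ j < k, a j < N ∧ (a j < k ∨ k + M ≤ a j) ∧
      P (a j) x y = (N : ℝ) * (rampWeight N k (a j + 1) - rampWeight N k (a j)) * q) →
      |∑ j ∈ Finset.range k, P (a j) x y * ∫ s in cell N (a j), φ s| ≤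
        (k : ℝ) / N * (2 * C * |q|) := by
    intro a q h
    refine (Finset.abs_sum_le_sum_abs _ _).trans ((Finset.sum_le_card_nsmul _ _
      (2 * |q| * (C / N)) fun j hj => ?_).trans (le_of_eq ?_))
    · obtain ⟨e1, e2, e3⟩ := h j (Finset.mem_range.1 hj)
      rw [e3, abs_mul, abs_mul]
      have := abs_mul_rampWeight_sub_le hN hN0 e1 e2
      have := hcell _ e1
      gcongr
    · rw [Finset.card_range, nsmul_eq_mul]
      ring
  have hl := hramp (fun j => j) (nA x y) fun j hj => ⟨by omega, Or.inl hj, by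
    rw [hP, recoveryMomentum, if_pos hj]⟩
  have hr := hramp (fun j => k + M + j) (nB x y) fun j hj => ⟨by omega, Or.inr (by omega), by
    rw [hP, recoveryMomentum, if_neg (by omega), if_neg (by omega)]⟩
  rw [h1, Finset.sum_range_add, Finset.sum_range_add, h2]
  rw [abs_le] at hl hr h3 ⊢
  constructor <;> linarith [hl.1, hl.2, hr.1, hr.2, h3.1, h3.2]

end recoveryConvergence


/-! ### Choice of the ramp length and the Γ-limit. -/

/-- A ramp length `k N = o(N)` whose square dominates the modulus of continuity of `R`. -/
theorem exists_ramp_length {X : Type*} [Fintype X] {R : I → X → ℝ} (hR : Continuous R) :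
    ∃ k : ℕ → ℕ, Tendsto (fun N => (k N : ℝ) / N) atTop (𝓝 0) ∧ ∀ N : ℕ, 0 < N → ∀ s t : I,
      |(s : ℝ) - t| ≤ 2 / N → ∀ x, |R s x - R t x| ≤ ((k N : ℝ) / N) ^ 2 := by
  set S : ℕ → Set ℝ := fun N => {d | ∃ s t : I, |(s : ℝ) - t| ≤ 2 / N ∧ d = ‖R s - R t‖} with hS
  set w : ℕ → ℝ := fun N => sSup (S N) with hw
  have hw0 : ∀ N, 0 ≤ w N := fun N => Real.sSup_nonneg (by
    rintro _ ⟨s, t, -, rfl⟩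
    exact norm_nonneg _)
  have hbdd : ∀ N, BddAbove (S N) := fun N => by
    have hc : Continuous fun q : I × I => ‖R q.1 - R q.2‖ := by fun_prop
    refine (isCompact_range hc).bddAbove.mono ?_
    rintro _ ⟨s, t, -, rfl⟩
    exact ⟨(s, t), rfl⟩
  have hwlim : Tendsto w atTop (𝓝 0) := by
    rw [Metric.tendsto_atTop]
    intro ε hε
    obtain ⟨δ, hδ, h⟩ := Metric.uniformContinuous_iff.1
      (CompactSpace.uniformContinuous_of_continuous hR) (ε / 2) (half_pos hε)
    obtain ⟨N₀, hN₀⟩ := ((tendsto_const_div_atTop_nhds_zero_nat (2 : ℝ)).eventually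
      (gt_mem_nhds hδ)).exists_forall_of_atTop
    refine ⟨N₀, fun N hN => ?_⟩
    have : w N ≤ ε / 2 := Real.sSup_le (by
      rintro _ ⟨s, t, hst, rfl⟩
      rw [← dist_eq_norm]
      exact (h (hst.trans_lt (hN₀ N hN))).le) (half_pos hε).le
    rw [Real.dist_eq, sub_zero, abs_of_nonneg (hw0 N)]
    linarith
  -- Here w(N) is the modulus of continuity at scale 2/N; rounding N√w(N) up gives (k/N)² ≥ w(N) and
  -- k/N ≤ √w(N) + 1/N.
  refine ⟨fun N => ⌈(N : ℝ) * √(w N)⌉₊, ?_, fun N hN s t hst x => ?_⟩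
  · have h1 : Tendsto (fun N : ℕ => √(w N) + 1 / (N : ℝ)) atTop (𝓝 0) := by
      simpa using hwlim.sqrt.add (tendsto_const_div_atTop_nhds_zero_nat (1 : ℝ))
    refine squeeze_zero' (Eventually.of_forall fun N => by positivity) ?_ h1
    filter_upwards [eventually_gt_atTop 0] with N hN
    have hN' : (0 : ℝ) < N := by exact_mod_cast hN
    rw [div_le_iff₀ hN', add_mul, div_mul_cancel₀ _ hN'.ne', mul_comm (√_)]
    exact (Nat.ceil_lt_add_one (by positivity)).le
  · have hN' : (0 : ℝ) < N := by exact_mod_cast hN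
    have h1 : |R s x - R t x| ≤ w N :=
      (norm_le_pi_norm (R s - R t) x).trans (le_csSup (hbdd N) ⟨s, t, hst, rfl⟩)
    refine h1.trans ?_
    rw [← Real.sq_sqrt (hw0 N)]
    gcongr
    rw [le_div_iff₀ hN', mul_comm]
    exact Nat.le_ceil _

theorem withDensityᵥ_cellIndex_preimage {f : I → ℝ} (hf : Integrable f) {M j : ℕ} (hj : j < M) :
    volume.withDensityᵥ f (cellIndex M ⁻¹' {j}) = ∫ t in cell M j, f t := by
  rw [withDensityᵥ_apply hf (measurable_cellIndex M (measurableSet_singleton j))]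
  refine setIntegral_congr_set ?_
  filter_upwards [Measure.ae_ne volume (1 : I)] with t ht
  refine propext ?_
  change t ∈ cellIndex M ⁻¹' {j} ↔ t ∈ cell M j
  rw [mem_cell_iff hj]
  exact ⟨fun h => ⟨ht, h⟩, fun h => h.2⟩

namespace ReversibleChain

variable {X : Type*} [Fintype X] (K : ReversibleChain X) {θ : ℝ → ℝ → ℝ} {ρA ρB : X → ℝ}

theorem integral_div {Ω : Type*} [MeasurableSpace Ω] {μ : Measure Ω} {p : Ω → X → X → ℝ}
    (hp : ∀ x y, 0 < K.Q x y → Integrable (fun t => p t x y) μ) {q : X → X → ℝ}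
    (hq : ∀ x y, 0 < K.Q x y → q x y = ∫ t, p t x y ∂μ) (x : X) :
    ∫ t, K.div (p t) x ∂μ = K.div q x := by
  unfold div
  rw [integral_const_mul, integral_finsetSum]
  · congr 1
    refine Finset.sum_congr rfl fun y _ => ?_
    by_cases hQ : 0 < K.Q x y
    · have hQ' := K.Q_pos_comm.1 hQ
      rw [integral_const_mul, integral_sub (hp y x hQ') (hp x y hQ), hq x y hQ, hq y x hQ']
    · simp [K.Q_eq_zero_of_not_pos hQ]
  · intro y _
    by_cases hQ : 0 < K.Q x y
    · exact ((hp y x (K.Q_pos_comm.1 hQ)).sub (hp x y hQ)).const_mul _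
    · simp [K.Q_eq_zero_of_not_pos hQ]

theorem exists_div_eq_sub_one {ρ : X → ℝ} (hρ : ∑ x, K.π x * ρ x = 1) :
    ∃ n, K.div n = fun x => ρ x - 1 :=
  K.exists_div_eq (by simp [mul_sub, hρ, K.π_sum])

/-- Existence of recovery sequences. -/
theorem exists_recovery_sequence (hθ : IsAveraging θ) (hA : K.IsProbDensity ρA)
    (hB : K.IsProbDensity ρB) (u : PathMeasure X) :
    ∃ v : ℕ → PathMeasure X, Tendsto v atTop (𝓝 u) ∧
      limsup (fun N => K.discreteEnergy N θ ρA ρB (v N)) atTop ≤ K.energy θ ρA ρB u := by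
  by_cases htop : K.energy θ ρA ρB u = ⊤
  -- Where the limit energy is infinite, the constant sequence serves.
  · exact ⟨fun _ => u, tendsto_const_nhds, htop ▸ le_top⟩
  have hac : (∀ x, u.ρ x ≪ᵥ (volume : Measure I).toENNRealVectorMeasure) ∧
      (∀ x y, 0 < K.Q x y → u.m x y ≪ᵥ (volume : Measure I).toENNRealVectorMeasure) := by
    by_contra h
    exact htop (by rw [energy, if_neg h])
  rw [energy, if_pos hac] at htop ⊢
  set ρ : I → X → ℝ := fun t x => (u.ρ x).rnDeriv volume t with hρdef
  set p : I → X → X → ℝ := fun t x y => (u.m x y).rnDeriv volume t with hpdef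
  have hCE : K.IsCE ρA ρB ρ p := by
    by_contra h
    exact htop (by rw [pathEnergy, if_neg h, add_top])
  rw [pathEnergy, if_pos hCE, add_zero] at htop ⊢
  have hρu : ∀ x, u.ρ x = volume.withDensityᵥ fun t => ρ t x := fun x =>
    (SignedMeasure.withDensityᵥ_rnDeriv_eq _ _ (hac.1 x)).symm
  have hpu : ∀ x y, 0 < K.Q x y → u.m x y = volume.withDensityᵥ fun t => p t x y :=
    fun x y hQ => (SignedMeasure.withDensityᵥ_rnDeriv_eq _ _ (hac.2 x y hQ)).symm
  have hρi : ∀ x, Integrable fun t => ρ t x := hCE.2.2.1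
  have hpi : ∀ x y, 0 < K.Q x y → Integrable fun t => p t x y := hCE.2.2.2.1
  have hm : ∀ M x y, 0 < K.Q x y → ∀ j < M,
      u.m x y (cellIndex M ⁻¹' {j}) = ∫ t in cell M j, p t x y := fun M x y hQ j hj => by
    rw [hpu x y hQ, withDensityᵥ_cellIndex_preimage (hpi x y hQ) hj]
  obtain ⟨R, hRc, R0, R1, hae, hR⟩ := hCE.exists_continuous_representative
  obtain ⟨nA, hnA⟩ := K.exists_div_eq_sub_one hA.2
  obtain ⟨nB, hnB⟩ := K.exists_div_eq_sub_one hB.2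
  obtain ⟨k, hk, hkR⟩ := exists_ramp_length hRc
  set M : ℕ → ℕ := fun N => N - 2 * k N with hMdef
  have hev : ∀ᶠ N : ℕ in atTop, N = k N + M N + k N ∧ 0 < M N ∧ 1 / (M N : ℝ) ≤ 2 / N := by
    -- Once k/N < 1/4, M = N − 2k is at least N/2, so the coarse mesh 1/M is within the scale 2/N
    -- used to choose k.
    filter_upwards [hk.eventually (gt_mem_nhds (show (0 : ℝ) < 1 / 4 by norm_num)),
      eventually_gt_atTop 0] with N hkN hN
    have hN' : (0 : ℝ) < N := by exact_mod_cast hN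
    rw [div_lt_iff₀ hN'] at hkN
    have h4 : 4 * k N < N := by
      have : 4 * (k N : ℝ) < N := by linarith
      exact_mod_cast this
    have hM : 0 < M N := by simp only [hMdef]; omega
    refine ⟨by simp only [hMdef]; omega, hM, ?_⟩
    rw [div_le_div_iff₀ (by exact_mod_cast hM) hN']
    exact_mod_cast (show 1 * N ≤ 2 * M N by simp only [hMdef]; omega)
  have hmesh : ∀ δ > 0, ∀ᶠ N : ℕ in atTop, ((k N : ℝ) + 1) / N + 1 / (M N : ℝ) < δ := by
    intro δ hδ
    have h1 : Tendsto (fun N : ℕ => (k N : ℝ) / N + 1 / N + 2 / N) atTop (𝓝 0) := by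
      simpa using (hk.add (tendsto_const_div_atTop_nhds_zero_nat (1 : ℝ))).add
        (tendsto_const_div_atTop_nhds_zero_nat (2 : ℝ))
    filter_upwards [hev, h1.eventually (gt_mem_nhds hδ)] with N h2 h3
    rw [add_div]
    linarith [h2.2.2]
  refine ⟨fun N => polygonMeasure N (recoveryNode N (M N) (k N) R)
    (recoveryMomentum N (M N) (k N) nA nB u.m), ?_, ?_⟩
  · rw [PathMeasure.tendsto_nhds_iff_components]
    refine ⟨fun x φ => ?_, fun x y φ => ?_⟩
    · obtain ⟨C, hC0, hC⟩ := φ.exists_abs_le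
      obtain ⟨B, hB0, hBR⟩ := ContinuousMap.exists_abs_le
        ⟨fun t => R t x, (continuous_apply x).comp hRc⟩
      have hlim : (∫ᵛ t, φ t ∂•(u.ρ x)) = ∫ t, φ t * R t x := by
        rw [hρu x, SignedMeasure.integral_withDensityᵥ (hρi x) φ.continuous.measurable hC]
        exact integral_congr_ae ((hae x).mono fun t ht => by simp only [ht])
      rw [hlim, Metric.tendsto_nhds]
      intro ε hε
      obtain ⟨η, hη0, hη⟩ : ∃ η > 0, C * η < ε / 2 :=
        ⟨ε / (2 * (C + 1)), by positivity, by
          rw [mul_div_assoc', div_lt_div_iff₀ (by positivity) two_pos]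
          nlinarith⟩
      obtain ⟨δ, hδ, hφδ⟩ := exists_forall_abs_sub_lt
        ⟨fun t => R t x, (continuous_apply x).comp hRc⟩ hη0
      have h1 : Tendsto (fun N : ℕ => C * ((k N : ℝ) / N * (1 + B))) atTop (𝓝 0) := by
        simpa using (hk.mul_const (1 + B)).const_mul C
      filter_upwards [hev, hmesh δ hδ, h1.eventually (gt_mem_nhds (half_pos hε))]
        with N ⟨hN, hM, _⟩ hmN hCN
      rw [Real.dist_eq]
      refine (abs_integral_recovery_ρ_sub_le hN hM hRc (η := η) (fun s t hst => (hφδ s t ?_).le)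
        hBR φ hC _).trans_lt (by rw [mul_add]; linarith)
      have : (0 : ℝ) ≤ 1 / (M N : ℝ) := by positivity
      linarith
    · obtain ⟨C, hC0, hC⟩ := φ.exists_abs_le
      rw [Metric.tendsto_nhds]
      intro ε hε
      set V := (u.m x y).variation.real Set.univ with hV
      have hV0 : 0 ≤ V := measureReal_nonneg
      obtain ⟨η, hη0, hη⟩ : ∃ η > 0, η * V < ε / 2 :=
        ⟨ε / (2 * (V + 1)), by positivity, by
          rw [div_mul_eq_mul_div, div_lt_div_iff₀ (by positivity) two_pos]
          nlinarith⟩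
      obtain ⟨δ, hδ, hφδ⟩ := exists_forall_abs_sub_lt φ hη0
      have h1 : Tendsto (fun N : ℕ => (k N : ℝ) / N * (2 * C * (|nA x y| + |nB x y|)) +
          (k N : ℝ) / N * C * V) atTop (𝓝 0) := by
        simpa using (hk.mul_const (2 * C * (|nA x y| + |nB x y|))).add
          ((hk.mul_const C).mul_const V)
      filter_upwards [hev, hmesh δ hδ, h1.eventually (gt_mem_nhds (half_pos hε))]
        with N ⟨hN, hM, _⟩ hmN hCN
      rw [Real.dist_eq]
      refine (abs_integral_recovery_m_sub_le hN hM (η := η) hC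
        (fun s t hst => (hφδ s t (hst.trans_lt hmN)).le) _).trans_lt ?_
      rw [add_mul]
      linarith
  · set CAB := K.actionDensity θ (fun _ => 1 / 4) nA + K.actionDensity θ (fun _ => 1 / 4) nB
    have hCAB : CAB ≠ ⊤ := ENNReal.add_ne_top.2
      ⟨(K.actionDensity_const_lt_top hθ (by norm_num) nA).ne,
        (K.actionDensity_const_lt_top hθ (by norm_num) nB).ne⟩
    have hle : ∀ᶠ N : ℕ in atTop, K.discreteEnergy N θ ρA ρB
        (polygonMeasure N (recoveryNode N (M N) (k N) R)
          (recoveryMomentum N (M N) (k N) nA nB u.m)) ≤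
        ENNReal.ofReal (N / M N) * K.action θ ρ p + ENNReal.ofReal (k N / N) * CAB := by
      filter_upwards [hev] with N ⟨hN, hM, hMN⟩
      refine K.recovery_discreteEnergy_le hθ hN hM hA.1 hB.1 R0 R1 hnA hnB (fun j hj x => ?_)
        hρi hpi (hm _) hRc hae fun s t hst => hkR N (by omega) s t (hst.trans hMN)
      rw [hR _ j hj x, K.integral_div (fun x y hQ => (hpi x y hQ).integrableOn)
        fun x y hQ => hm _ x y hQ j hj]
    have hratio : Tendsto (fun N : ℕ => (N : ℝ) / M N) atTop (𝓝 1) := by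
      have h1 : Tendsto (fun N : ℕ => (1 - 2 * ((k N : ℝ) / N))⁻¹) atTop (𝓝 1) := by
        simpa using (hk.const_mul 2).const_sub 1 |>.inv₀ (by norm_num)
      refine h1.congr' ?_
      filter_upwards [hev] with N ⟨hN, hM, _⟩
      have hN' : (N : ℝ) ≠ 0 := by exact_mod_cast (by omega : N ≠ 0)
      have e : (M N : ℝ) = N - 2 * k N := by
        have : (N : ℝ) = k N + M N + k N := by exact_mod_cast hN
        linarith
      rw [e, ← inv_div ((N : ℝ) - 2 * k N) N, sub_div, div_self hN', mul_div_assoc]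
    have hlim : Tendsto (fun N : ℕ => ENNReal.ofReal (N / M N) * K.action θ ρ p +
        ENNReal.ofReal (k N / N) * CAB) atTop (𝓝 (K.action θ ρ p)) := by
      have h1 := ENNReal.Tendsto.mul_const (b := K.action θ ρ p) (ENNReal.tendsto_ofReal hratio)
        (Or.inl (by simp))
      have h2 := ENNReal.Tendsto.mul_const (b := CAB) (ENNReal.tendsto_ofReal hk) (Or.inr hCAB)
      simpa using h1.add h2
    exact (limsup_le_limsup hle).trans hlim.limsup_eq.le

end ReversibleChain

/-- Γ-convergence, as `h = 1 / N → 0`, of the time-discrete energies to the energy, for the weak*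
topology of measures. -/
theorem mainTheorem1 {X : Type*} [Fintype X] (K : ReversibleChain X)
    (θ : ℝ → ℝ → ℝ) (hθ : IsAveraging θ)
    (ρA ρB : X → ℝ) (hA : K.IsProbDensity ρA) (hB : K.IsProbDensity ρB) :
    GammaConverges (fun N : ℕ => K.discreteEnergy N θ ρA ρB) (K.energy θ ρA ρB) :=
  ⟨fun _ _ hv => K.energy_le_liminf hθ hA.2 hv, K.exists_recovery_sequence hθ hA hB⟩

end
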